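/- Let $\lambda=e^{2\pi i p/q}$ with $q\ge 1$ and $\gcd(p,q)=1$. For $(c,a)\in\mathbb C^2$ let $H_{c,a}(x,y)=(x^2+c+ay,\,ax)$, and let $$\mathcal P_\lambda=\Big\{(c,a): c=(1-a^2)\big(\tfrac{\lambda}{2}-\tfrac{a^2}{2\lambda}\big)-\big(\tfrac{\lambda}{2}-\tfrac{a^2}{2\lambda}\big)^2\Big\}.$$ For $(c,a)\in\mathcal P_\lambda$ the map $H_a=H_{c,a}$ has the fixed point $\mathbf q_a=\big(\tfrac{\lambda}{2}-\tfrac{a^2}{2\lambda},\,a(\tfrac{\lambda}{2}-\tfrac{a^2}{2\lambda})\big)$, at which $DH_a$ has eigenvalues $\lambda$ and $\mu=-a^2/\lambda$. Put $W^s(\mathbf q_a)=\{z:\exists M\ \forall m\ge 0,\ \|H_a^{\circ m}(z)-\mathbf q_a\|\le M|\mu|^m\}$, and let $W^s_{loc}(\mathbf q_a)$ be the connected component (in the intrinsic topology of this immersed curve) of $W^s(\mathbf q_a)\cap\{|y|<r\}$ containing $\mathbf q_a$. Let $p(x)=x^2+\frac{\lambda}{2}-\frac{\lambda^2}{4}$,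 with parabolic fixed point $q_0=\lambda/2$ of multiplier $\lambda$. A normalizing coordinate for $p$ is a biholomorphic map $\phi:V_0\to\mathbb D_\rho$ from an open neighborhood $V_0$ of $q_0$ onto the disk $\mathbb D_\rho=\{|x|<\rho\}$ with $\phi(q_0)=0$ and, for some constant $C$, $$\phi\circ p\circ\phi^{-1}(x)=\lambda x\big(1+x^q+Cx^{2q}+O(x^{2q+1})\big)\quad (x\to 0).$$ **Theorem.** Normalizing coordinates for $p$ exist. Let $\phi:V_0\to\mathbb D_\rho$ be any of them, let $\rho'>0$ be such that $\mathbb D_{2\rho'}(q_0)\subset V_0$, let $r>3$, and put $B=\mathbb D_{\rho'}(q_0)\times\mathbb D_r$. Then there are $\delta,\varepsilon>0$ and $K$ and, for all $(c,a)\in\mathcal P_\lambda$ with $|a|<\delta$, a holomorphic coordinate change (biholomorphic onto an open image) $\phi_a:B\to\mathbb D_\rho\times\mathbb D_{r+K|a|}$ such that: 1. $B$ is a tubular neighborhood of the local stable manifold, which $\phi_a$ straightens: $W^s_{loc}(\mathbf q_a)=\{z\in B:\phi_a(z)\in\{0\}\times\mathbb C\}$. 2. On $\Omega_a=\phi_a(B\cap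 H_a^{-1}(B))$ the map $\widetilde H_a=\phi_a\circ H_a\circ\phi_a^{-1}$ has the form $\widetilde H_a(x,y)=(x_1,y_1)$ with $$x_1=\lambda\big(x+x^{q+1}+C_ax^{2q+1}+a_{2q+2}(y)x^{2q+2}+\dots\big),\qquad y_1=\mu y+xh_a(x,y),$$ where $C_a$ is a constant depending on $a$, $h_a$ is holomorphic on $\Omega_a$, and $|xh_a(x,y)|\le K|a|$ on $\Omega_a$. Here the dots mean that the terms from $x^{2q+2}$ on are $x^{2q+2}g_a(x,y)$ with $g_a$ holomorphic on $\Omega_a$, that $\Omega_a$ contains $\mathbb D_\varepsilon\times Y_a$, where $Y_a$ is the projection of $\phi_a(B)$ to the second coordinate, and that on $\mathbb D_\varepsilon\times Y_a$ the function $g_a$ is the sum of its power series $\sum_{k\ge0}a_{2q+2+k}(y)x^k$, with coefficients holomorphic on $Y_a$. 3. $(a,x,y)\mapsto\phi_a(x,y)$ is holomorphic on $\mathbb D_\delta\times B$, and as $a\to0$ the maps $\phi_a$ converge, uniformly on $B$, to $\phi_0(x,y)=(\phi(x),y)$. -/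

import Mathlib

open Set Filter Topology Metric Asymptotics

noncomputable section

namespace SemiParabolicHenon

/-- The complex Hénon map `H_{c,a}(x, y) = (x² + c + a y, a x)`. -/
def henon (c a : ℂ) (z : ℂ × ℂ) : ℂ × ℂ :=
  (z.1 ^ 2 + c + a * z.2, a * z.1)

/-- The number `λ/2 - a²/(2λ)`, first coordinate of the semi-parabolic fixed point. -/
def fixedPointX (lam a : ℂ) : ℂ :=
  lam / 2 - a ^ 2 / (2 * lam)

/-- The parameter curve `𝒫_λ` of the pairs `(c, a)` with
`c = (1 - a²)(λ/2 - a²/(2λ)) - (λ/2 - a²/(2λ))²`. -/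
def paramCurve (lam : ℂ) : Set (ℂ × ℂ) :=
  {ca | ca.1 = (1 - ca.2 ^ 2) * fixedPointX lam ca.2 - fixedPointX lam ca.2 ^ 2}

/-- The semi-parabolic fixed point `𝐪_a` of `H_{c,a}`, for `(c, a) ∈ 𝒫_λ`. -/
def fixedPoint (lam a : ℂ) : ℂ × ℂ :=
  (fixedPointX lam a, a * fixedPointX lam a)

/-- The second eigenvalue `μ = -a²/λ` at the semi-parabolic fixed point. -/
def eigenMu (lam a : ℂ) : ℂ :=
  -a ^ 2 / lam

/-- The parabolic fixed point `q₀ = λ/2` of `p`. -/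
def q₀ (lam : ℂ) : ℂ :=
  lam / 2

/-- The parabolic polynomial `p(x) = x² + c₀` with `c₀ = λ/2 - λ²/4`. -/
def parabolicPoly (lam x : ℂ) : ℂ :=
  x ^ 2 + (lam / 2 - lam ^ 2 / 4)

/-- `φ` is a normalizing coordinate for `p` at `q₀`: an isomorphism of an open neighbourhood `V` of
`q₀` onto the disk `𝔻_ρ`, with `φ(q₀) = 0`, for which
`φ ∘ p ∘ φ⁻¹ (x) = λ x (1 + x^q + C x^{2q} + O(x^{2q+1}))` as `x → 0`
(written at `x = φ z`). -/
structure IsNormalizingCoordinate (lam : ℂ) (q : ℕ) (V : Set ℂ) (ρ : ℝ) (φ : ℂ → ℂ) : Prop where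
  isOpen : IsOpen V
  mem : q₀ lam ∈ V
  radius_pos : 0 < ρ
  holomorphic : DifferentiableOn ℂ φ V
  bijOn : BijOn φ V (ball 0 ρ)
  map_fixed : φ (q₀ lam) = 0
  normalForm : ∃ C : ℂ,
    (fun z => φ (parabolicPoly lam z)
        - lam * (φ z + φ z ^ (q + 1) + C * φ z ^ (2 * q + 1)))
      =O[𝓝 (q₀ lam)] fun z => φ z ^ (2 * q + 2)

/-- The tube `B = 𝔻_{ρ'}(q₀) × 𝔻_r`. -/
def tube (lam : ℂ) (ρ' r : ℝ) : Set (ℂ × ℂ) :=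
  ball (q₀ lam) ρ' ×ˢ ball 0 r

/-- The strong stable manifold `W^s(𝐪_a)`: the points whose forward orbit converges to `𝐪_a` at the
rate `|μ|^m`. (The inequality is not strict, so that the definition also makes sense for `a = 0`,
where `μ = 0`.) -/
def stableManifold (lam c a : ℂ) : Set (ℂ × ℂ) :=
  {z | ∃ M : ℝ, ∀ m : ℕ, ‖(henon c a)^[m] z - fixedPoint lam a‖ ≤ M * ‖eigenMu lam a‖ ^ m}

/-- The local stable manifold `W^s_loc(𝐪_a)`: the connected component of
`W^s(𝐪_a) ∩ {|y| < r}` that contains `𝐪_a`. As `W^s(𝐪_a)` is an injectively immersed complex curve,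
the component is taken in its intrinsic topology: it consists of the points that are joined to
`𝐪_a` by a holomorphic curve `u : U → W^s(𝐪_a) ∩ {|y| < r}` with connected parameter domain. -/
def localStableManifold (lam c a : ℂ) (r : ℝ) : Set (ℂ × ℂ) :=
  {z | ∃ (U : Set ℂ) (u : ℂ → ℂ × ℂ), IsOpen U ∧ IsConnected U ∧ DifferentiableOn ℂ u U ∧
    MapsTo u U (stableManifold lam c a ∩ {w | ‖w.2‖ < r}) ∧
    ∃ s ∈ U, ∃ t ∈ U, u s = fixedPoint lam a ∧ u t = z}

/-- `f` is a holomorphic coordinate change on `B`: it maps `B` biholomorphically onto an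
open set. -/
def IsCoordinateChangeOn (f : ℂ × ℂ → ℂ × ℂ) (B : Set (ℂ × ℂ)) : Prop :=
  DifferentiableOn ℂ f B ∧ IsOpen (f '' B) ∧
    ∃ finv : ℂ × ℂ → ℂ × ℂ, DifferentiableOn ℂ finv (f '' B) ∧ LeftInvOn finv f B

/-- In the coordinates `f` on `B`, the map `H` takes the form
* `x₁ = λ (x + x^{q+1} + C x^{2q+1} + a_{2q+2}(y) x^{2q+2} + a_{2q+3}(y) x^{2q+3} + …)`,
* `y₁ = μ y + x h(x, y)`.

The map `f ∘ H ∘ f⁻¹` lives on `Ω = f(B ∩ H⁻¹(B))`. There the higher order part of `x₁` is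
`x^{2q+2} g(x, y)` with `g` and `h` holomorphic on `Ω`; moreover `Ω` contains the product of the
disk `𝔻_ε` with `Y`, the set of second coordinates of points of `f(B)`, and on this product `g` is
the sum of its power series `∑ₖ a_{2q+2+k}(y) x^k`, with coefficients holomorphic on `Y`
(`coeff k` is `a_{2q+2+k}`). -/
structure HasNormalForm (lam mu C : ℂ) (q : ℕ) (ε : ℝ) (coeff : ℕ → ℂ → ℂ) (g h : ℂ × ℂ → ℂ)
    (H : ℂ × ℂ → ℂ × ℂ) (B : Set (ℂ × ℂ)) (f : ℂ × ℂ → ℂ × ℂ) : Prop where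
  holomorphic_g : DifferentiableOn ℂ g (f '' (B ∩ H ⁻¹' B))
  holomorphic_h : DifferentiableOn ℂ h (f '' (B ∩ H ⁻¹' B))
  fst_eq : ∀ z ∈ B ∩ H ⁻¹' B,
    (f (H z)).1 = lam * ((f z).1 + (f z).1 ^ (q + 1) + C * (f z).1 ^ (2 * q + 1)
      + (f z).1 ^ (2 * q + 2) * g (f z))
  snd_eq : ∀ z ∈ B ∩ H ⁻¹' B, (f (H z)).2 = mu * (f z).2 + (f z).1 * h (f z)
  polydisk : ball (0 : ℂ) ε ×ˢ (Prod.snd '' (f '' B)) ⊆ f '' (B ∩ H ⁻¹' B)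
  holomorphic_coeff : ∀ k, DifferentiableOn ℂ (coeff k) (Prod.snd '' (f '' B))
  series : ∀ x ∈ ball (0 : ℂ) ε, ∀ y ∈ Prod.snd '' (f '' B),
    HasSum (fun k => coeff k y * x ^ k) (g (x, y))

end SemiParabolicHenon

end

open SemiParabolicHenon

/-! Everything is done holomorphically in the parameter `a`, as a perturbation of the degenerate map
at `a = 0`, where the first coordinate follows the polynomial `p`.

Write X for the first coordinate of the fixed point and v = y - aX. The local stable manifold is
sought as a graph x = X + σ(a, v) with σ = a v θ(a, v). Invariance says σ(a, aσ) = (λ + μ)σ + σ² +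
av; divided by av this is an equation for θ that a contracting graph transform solves
(`exists_stable_slope`). With d = x - X - σ the Hénon map becomes a skew map (d, v) ↦ (D, V) that
preserves {d = 0} and acts there by v ↦ F(a, v) = aσ, which contracts by at least 1/2 towards the
fixed point v = 0.

Because of this contraction, equations of the form b - κ b∘F = β with |κ| = 1 and β = 0 at the fixed
point are solved by a convergent series (`exists_cohomological_solution`). Taking exponentials makes
the transversal multiplier constantly λ, and also linearizes F to multiplication by μ
(`exists_multiplicative_solution`). One then normalizes order by order with X ↦ X + B(a, v) X^(N+1):
the cohomological equation removes the dependence of the next coefficient on v, and a function of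
`a` removes the coefficient itself unless q divides N (`SkewSystem.isNormalizing_succ`). Up to order
2q+1 only the exponents 1, q+1 and 2q+1 survive, and a rescaling makes the coefficient of x^(q+1)
equal to λ. The procedure starts from the given coordinate of `p`, for which at `a = 0` nothing has
to be corrected; hence φ_0 = (φ, y), and for small `a` the map φ_a is an O(a)-perturbation of a
biholomorphism (`IsNormalFamily.exists_conclusion`). The remainders g and h come from dividing by
powers of x (`exists_eq_pow_mul`).

The straightened curve is the local stable manifold (`IsStableSlope.localStableManifold_eq`).
Linearizing F gives the rate |μ|^m on the graph. Conversely, near the fixed point |d| shrinks at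
most by the factor 1/2 per step, whereas orbits in the stable manifold converge at rate |μ| < 1/2;
so d = 0 there, and the identity theorem extends this along every admissible curve.

Existence of a normalizing coordinate for `p` uses the same normalization with trivial fibres. The
one extra fact is that the coefficient of order q+1 is nonzero. Otherwise the q-th iterate of `p`
would have more than q attracting petals of the same kind, each containing a point of the single
critical orbit, and the residues mod q of the visiting times leave room for only q of them
(`parabolic_multiplicity_le`). -/

namespace SemiParabolicHenon

/-! ### Holomorphic functions on normed spaces: Cauchy estimates, limits, Taylor coefficients,
division. -/

section Holomorphic

variable {E F : Type*} [NormedAddCommGroup E] [NormedSpace ℂ E]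
  [NormedAddCommGroup F] [NormedSpace ℂ F]

/-- A holomorphic function bounded by `M` on a ball of radius `η` is Lipschitz at its centre. -/
theorem norm_sub_le_of_bounded {f : E → F} {c z : E} {η M : ℝ} (hη : 0 < η)
    (hd : DifferentiableOn ℂ f (ball c η)) (hM : ∀ x ∈ ball c η, ‖f x‖ ≤ M) (hz : ‖f z‖ ≤ M) :
    ‖f z - f c‖ ≤ 2 * M / η * ‖z - c‖ := by
  have hc : ‖f c‖ ≤ M := hM c (mem_ball_self hη)
  have hM0 : 0 ≤ M := (norm_nonneg _).trans hc
  by_cases hzc : z ∈ ball c η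
  · have hmaps : MapsTo f (ball c η) (closedBall (f c) (2 * M)) := by
      intro x hx
      rw [mem_closedBall, dist_eq_norm]
      exact (norm_sub_le _ _).trans (by linarith [hM x hx])
    have := Complex.dist_le_div_mul_dist_of_mapsTo_ball hd hmaps hzc
    rwa [dist_eq_norm, dist_eq_norm] at this
  · rw [mem_ball, dist_eq_norm, not_lt] at hzc
    calc ‖f z - f c‖ ≤ 2 * M := (norm_sub_le _ _).trans (by linarith)
      _ = 2 * M / η * η := by field_simp
      _ ≤ 2 * M / η * ‖z - c‖ := by gcongr

/-- A holomorphic function bounded by `M` on a ball of radius `η`, vanishing at the centre. -/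
theorem norm_le_of_bounded_of_zero {f : E → F} {c z : E} {η M : ℝ}
    (hd : DifferentiableOn ℂ f (ball c η)) (hM : ∀ x ∈ ball c η, ‖f x‖ ≤ M) (h0 : f c = 0)
    (hz : z ∈ ball c η) : ‖f z‖ ≤ M / η * ‖z - c‖ := by
  have := Complex.dist_le_div_mul_dist_of_mapsTo_ball hd
    (R₂ := M) (fun x hx => by simpa [h0] using hM x hx) hz
  simpa [h0, dist_eq_norm] using this

/-- Locally uniform limits of holomorphic functions on open subsets of a complex normed space are
holomorphic. -/
theorem differentiableAt_of_tendstoUniformlyOn_nhds [CompleteSpace F] {f : ℕ → E → F} {g : E → F}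
    {x₀ : E} {t : Set E} (ht : t ∈ 𝓝 x₀) (hdt : ∀ᶠ n in atTop, DifferentiableOn ℂ (f n) t)
    (hu : TendstoUniformlyOn f g atTop t) : DifferentiableAt ℂ g x₀ := by
  obtain ⟨ρ, hρ, hρt⟩ := Metric.mem_nhds_iff.1 ht
  obtain ⟨n₀, hn₀⟩ := eventually_atTop.1 hdt
  set f1 : ℕ → E → F := fun n => f (n + n₀) with hf1
  have hd : ∀ n, DifferentiableOn ℂ (f1 n) (ball x₀ ρ) := fun n =>
    (hn₀ _ (Nat.le_add_left _ _)).mono hρt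
  have hu1 : TendstoUniformlyOn f1 g atTop (ball x₀ ρ) := by
    intro v hv
    exact (tendsto_add_atTop_nat n₀).eventually ((hu.mono hρt) v hv)
  have hsub : ∀ x ∈ ball x₀ (ρ / 2), ball x (ρ / 2) ⊆ ball x₀ ρ := fun x hx =>
    ball_subset_ball' (by rw [mem_ball] at hx; linarith)
  have hin : ball x₀ (ρ / 2) ⊆ ball x₀ ρ := ball_subset_ball (by linarith)
  -- Cauchy's estimate on balls of half the radius passes the uniform Cauchy property from the
  -- functions to their derivatives.
  have hcau : UniformCauchySeqOn (fun n => fderiv ℂ (f1 n)) atTop (ball x₀ (ρ / 2)) := by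
    rw [Metric.uniformCauchySeqOn_iff]
    intro ε hε
    obtain ⟨N, hN⟩ := Metric.uniformCauchySeqOn_iff.1 hu1.uniformCauchySeqOn (ε * ρ / 8)
      (by positivity)
    refine ⟨N, fun m hm n hn x hx => ?_⟩
    have hdm := (hd m).differentiableAt (isOpen_ball.mem_nhds (hin hx))
    have hdn := (hd n).differentiableAt (isOpen_ball.mem_nhds (hin hx))
    rw [dist_eq_norm, ← fderiv_sub hdm hdn]
    have hb : ∀ y ∈ ball x (ρ / 2), ‖(f1 m - f1 n) y‖ ≤ ε * ρ / 8 := fun y hy => by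
      have := hN m hm n hn y (hsub x hx hy)
      rw [dist_eq_norm] at this
      exact this.le
    have := Complex.norm_fderiv_le_div_of_mapsTo_ball (R₂ := 2 * (ε * ρ / 8))
      (((hd m).sub (hd n)).mono (hsub x hx)) (fun y hy => by
        rw [mem_closedBall, dist_eq_norm]
        exact (norm_sub_le _ _).trans (by
          linarith [hb y hy, hb x (mem_ball_self (by linarith))])) (by linarith)
    refine this.trans_lt ?_
    have : 2 * (ε * ρ / 8) / (ρ / 2) = ε / 2 := by field_simp; ring
    linarith
  have hlim : ∀ x ∈ ball x₀ (ρ / 2), ∃ L, Tendsto (fun n => fderiv ℂ (f1 n) x) atTop (𝓝 L) :=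
    fun x hx => cauchySeq_tendsto_of_complete (hcau.cauchySeq hx)
  choose! g' hg' using hlim
  have htu := hcau.tendstoUniformlyOn_of_tendsto hg'
  exact (hasFDerivAt_of_tendstoUniformlyOn isOpen_ball htu (fun n x hx =>
    ((hd n).differentiableAt (isOpen_ball.mem_nhds (hin hx))).hasFDerivAt)
    (fun x hx => hu1.tendsto_at (hin hx)) (mem_ball_self (by linarith))).differentiableAt

/-- A series of holomorphic functions that converges normally near each point is holomorphic. -/
theorem differentiableOn_tsum_of_summable_nhds [CompleteSpace F] {f : ℕ → E → F} {U : Set E}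
    (hU : IsOpen U) (hf : ∀ n, DifferentiableOn ℂ (f n) U)
    (hs : ∀ x ∈ U, ∃ t ∈ 𝓝 x, ∃ u : ℕ → ℝ, Summable u ∧ ∀ n, ∀ y ∈ t, ‖f n y‖ ≤ u n) :
    DifferentiableOn ℂ (fun x => ∑' n, f n x) U := by
  intro x hx
  obtain ⟨t, ht, u, hu, hb⟩ := hs x hx
  refine (differentiableAt_of_tendstoUniformlyOn_nhds (t := t ∩ U)
    (f := fun N x => ∑ n ∈ Finset.range N, f n x) (inter_mem ht (hU.mem_nhds hx))
    (Eventually.of_forall fun N => ?_) ?_).differentiableWithinAt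
  · exact DifferentiableOn.fun_sum fun n _ => (hf n).mono inter_subset_right
  · exact (tendstoUniformlyOn_tsum_nat hu hb).mono inter_subset_left

/-- Directional derivatives of holomorphic functions are holomorphic. -/
theorem differentiableOn_fderiv_apply [CompleteSpace F] {f : E → F} {U : Set E} (hU : IsOpen U)
    (hf : DifferentiableOn ℂ f U) (v : E) : DifferentiableOn ℂ (fun x => fderiv ℂ f x v) U := by
  have hpos : 0 < ‖v‖ + 1 := by positivity
  have key : ∀ x₀ ∈ U, ∃ η > 0, ∃ M, ball x₀ (3 * η) ⊆ U ∧ ∀ x ∈ ball x₀ (3 * η), ‖f x‖ ≤ M := by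
    intro x₀ hx₀
    have hc := (hf.differentiableAt (hU.mem_nhds hx₀)).continuousAt
    have h1 : ∀ᶠ x in 𝓝 x₀, ‖f x‖ < ‖f x₀‖ + 1 := hc.norm.eventually_lt_const (by linarith)
    obtain ⟨ρ, hρ, h⟩ := Metric.mem_nhds_iff.1 (inter_mem h1 (hU.mem_nhds hx₀))
    refine ⟨ρ / 3, by positivity, ‖f x₀‖ + 1, ?_, ?_⟩
    · rw [mul_div_cancel₀ _ (by norm_num)]; exact fun x hx => (h hx).2
    · rw [mul_div_cancel₀ _ (by norm_num)]; exact fun x hx => (h hx).1.le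
  intro x₀ hx₀
  obtain ⟨η, hη, M, hsub, hM⟩ := key x₀ hx₀
  set ρ := η / (‖v‖ + 1) with hρdef
  have hρ : 0 < ρ := by positivity
  -- Step lengths tending to zero; the shift by 2 keeps them strictly below ρ from n = 0 on.
  set h : ℕ → ℝ := fun n => ρ / (n + 2) with hh
  have hhpos : ∀ n, 0 < h n := fun n => by simp only [hh]; positivity
  have hhlt : ∀ n, h n < ρ := fun n => by
    simp only [hh]
    rw [div_lt_iff₀ (by positivity)]
    nlinarith [(Nat.cast_nonneg n : (0 : ℝ) ≤ n)]
  have hM0 : 0 ≤ M := (norm_nonneg _).trans (hM x₀ (mem_ball_self (by positivity)))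
  have hline : ∀ x ∈ ball x₀ η, ∀ t : ℂ, ‖t‖ < 2 * ρ → x + t • v ∈ ball x₀ (3 * η) := by
    intro x hx t ht
    have h1 : ‖t • v‖ ≤ 2 * η := by
      rw [norm_smul]
      calc ‖t‖ * ‖v‖ ≤ 2 * ρ * (‖v‖ + 1) := by gcongr; linarith
        _ = 2 * η := by rw [hρdef]; field_simp
    rw [mem_ball, dist_eq_norm] at hx ⊢
    calc ‖x + t • v - x₀‖ = ‖(x - x₀) + t • v‖ := by congr 1; abel
      _ ≤ ‖x - x₀‖ + ‖t • v‖ := norm_add_le _ _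
      _ < 3 * η := by linarith
  have hfd : ∀ x ∈ ball x₀ (3 * η), DifferentiableAt ℂ f x := fun x hx =>
    hf.differentiableAt (hU.mem_nhds (hsub hx))
  have hin : ball x₀ η ⊆ ball x₀ (3 * η) := ball_subset_ball (by linarith)
  refine (differentiableAt_of_tendstoUniformlyOn_nhds (t := ball x₀ η)
    (f := fun n x => ((h n : ℂ))⁻¹ • (f (x + (h n : ℂ) • v) - f x)) (ball_mem_nhds _ hη)
    (Eventually.of_forall fun n => ?_) ?_).differentiableWithinAt
  · intro x hx
    refine DifferentiableAt.differentiableWithinAt (DifferentiableAt.const_smul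
      (DifferentiableAt.sub ?_ (hfd x (hin hx))) _)
    refine DifferentiableAt.comp x (g := f) (hfd _ (hline x hx _ ?_)) (by fun_prop)
    rw [Complex.norm_real, Real.norm_of_nonneg (hhpos n).le]
    linarith [hhlt n]
  -- The difference quotients converge at a rate that does not depend on x: along each complex line
  -- they are values of a `dslope`, which is bounded by Schwarz and therefore Lipschitz at 0.
  · have hest : ∀ x ∈ ball x₀ η, ∀ n, ‖((h n : ℂ))⁻¹ • (f (x + (h n : ℂ) • v) - f x)
        - fderiv ℂ f x v‖ ≤ 2 * (2 * M / ρ) / ρ * h n := by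
      intro x hx n
      set g : ℂ → F := fun t => f (x + t • v) with hg
      have hgd : DifferentiableOn ℂ g (ball 0 ρ) := fun t ht => by
        rw [mem_ball_zero_iff] at ht
        exact (DifferentiableAt.comp t (g := f) (hfd _ (hline x hx t (by linarith)))
          (by fun_prop)).differentiableWithinAt
      have hgM : MapsTo g (ball 0 ρ) (closedBall (g 0) (2 * M)) := fun t ht => by
        rw [mem_ball_zero_iff] at ht
        rw [mem_closedBall, dist_eq_norm]
        exact (norm_sub_le _ _).trans (by
          linarith [hM _ (hline x hx t (by linarith)), hM _ (hline x hx 0 (by simpa using hρ))])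
      have hb : ∀ t ∈ ball (0 : ℂ) ρ, ‖dslope g 0 t‖ ≤ 2 * M / ρ := fun t ht =>
        Complex.norm_dslope_le_div_of_mapsTo_ball hgd hgM ht
      have hdd : DifferentiableOn ℂ (dslope g 0) (ball 0 ρ) :=
        (Complex.differentiableOn_dslope (ball_mem_nhds _ hρ)).2 hgd
      have hmem : (h n : ℂ) ∈ ball (0 : ℂ) ρ := by
        rw [mem_ball_zero_iff, Complex.norm_real, Real.norm_of_nonneg (hhpos n).le]
        exact hhlt n
      have hne : (h n : ℂ) ≠ 0 := by exact_mod_cast (hhpos n).ne'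
      have h0 : dslope g 0 0 = fderiv ℂ f x v := by
        rw [dslope_same]
        have h1 : HasDerivAt (fun t : ℂ => x + t • v) v 0 := by
          simpa using ((hasDerivAt_id (0 : ℂ)).smul_const v).const_add x
        have h2 : HasFDerivAt f (fderiv ℂ f x) (x + (0 : ℂ) • v) := by
          simpa using (hfd x (hin hx)).hasFDerivAt
        exact (h2.comp_hasDerivAt (0 : ℂ) h1).deriv
      have := norm_sub_le_of_bounded hρ hdd hb (hb _ hmem)
      rw [h0, dslope_of_ne _ hne, slope_def_module, sub_zero, Complex.norm_real,
        Real.norm_of_nonneg (hhpos n).le] at this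
      simpa [hg] using this
    rw [Metric.tendstoUniformlyOn_iff]
    intro ε hε
    have hlim : Tendsto (fun n => 2 * (2 * M / ρ) / ρ * h n) atTop (𝓝 0) := by
      have : Tendsto h atTop (𝓝 0) := by
        refine tendsto_const_nhds.div_atTop ?_
        exact tendsto_atTop_add_const_right _ _ tendsto_natCast_atTop_atTop
      simpa using this.const_mul (2 * (2 * M / ρ) / ρ)
    filter_upwards [hlim.eventually_lt_const hε] with n hn x hx
    rw [dist_comm, dist_eq_norm]
    exact (hest x hx n).trans_lt hn

/-- A function holomorphic near a point that is `O(w ^ N)` has vanishing Taylor coefficients of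
index less than `N`. -/
theorem iteratedDeriv_eq_zero_of_isBigO {f : ℂ → ℂ} {N : ℕ} (hf : AnalyticAt ℂ f 0)
    (hO : f =O[𝓝 0] fun w => w ^ N) {i : ℕ} (hi : i < N) : iteratedDeriv i f 0 = 0 := by
  refine (natCast_le_analyticOrderAt_iff_iteratedDeriv_eq_zero hf).1 ?_ i hi
  by_contra hlt
  rw [not_le] at hlt
  obtain ⟨m, hm⟩ := ENat.ne_top_iff_exists.1 (ne_top_of_lt hlt)
  rw [← hm, Nat.cast_lt] at hlt
  obtain ⟨g, hg, hg0, hfg⟩ := (hf.analyticOrderAt_eq_natCast).1 hm.symm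
  have h1 : (fun w : ℂ => w ^ m * g w) =O[𝓝 0] fun w => w ^ m * w ^ (N - m) := by
    refine (hO.congr' ?_ ?_)
    · filter_upwards [hfg] with w hw
      simpa using hw
    · filter_upwards with w
      rw [← pow_add, Nat.add_sub_cancel' hlt.le]
  obtain ⟨c, hc⟩ := h1.bound
  have h2 : ∀ᶠ w in 𝓝[≠] (0 : ℂ), ‖g w‖ ≤ c * ‖w ^ (N - m)‖ := by
    filter_upwards [hc.filter_mono nhdsWithin_le_nhds, self_mem_nhdsWithin] with w hw hw0
    rw [norm_mul, norm_mul] at hw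
    have : 0 < ‖w ^ m‖ := norm_pos_iff.2 (pow_ne_zero _ hw0)
    refine le_of_mul_le_mul_left ?_ this
    linarith
  have h3 : Tendsto (fun w : ℂ => c * ‖w ^ (N - m)‖) (𝓝[≠] 0) (𝓝 0) := by
    have : Continuous fun w : ℂ => c * ‖w ^ (N - m)‖ := by fun_prop
    have h := this.tendsto 0
    rw [zero_pow (by omega), norm_zero, mul_zero] at h
    exact h.mono_left nhdsWithin_le_nhds
  have h4 : Tendsto (fun w => ‖g w‖) (𝓝[≠] 0) (𝓝 ‖g 0‖) :=
    (hg.continuousAt.norm.tendsto).mono_left nhdsWithin_le_nhds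
  have := le_of_tendsto_of_tendsto h4 h3 h2
  exact hg0 (norm_le_zero_iff.1 this)

/-- The Taylor coefficient of index `k` in the first variable. -/
noncomputable def taylorCoeff {ι : Type*} (G : ℂ × ι → ℂ) (k : ℕ) (e : ι) : ℂ :=
  (k.factorial : ℂ)⁻¹ * iteratedDeriv k (fun w => G (w, e)) 0

/-- Each further derivative in w is a directional derivative along (1, 0) of a jointly holomorphic
function, so holomorphy in all variables survives the induction. -/
theorem differentiableOn_iteratedDeriv_fst {G : ℂ × E → ℂ} {Ω : Set (ℂ × E)} (hΩ : IsOpen Ω)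
    (hG : DifferentiableOn ℂ G Ω) (k : ℕ) :
    DifferentiableOn ℂ (fun p : ℂ × E => iteratedDeriv k (fun w => G (w, p.2)) p.1) Ω := by
  induction k with
  | zero => simpa using hG
  | succ k ih =>
    refine (differentiableOn_fderiv_apply hΩ ih (1, 0)).congr fun p hp => ?_
    rw [iteratedDeriv_succ]
    have h1 : HasDerivAt (fun t : ℂ => (t, p.2)) ((1 : ℂ), (0 : E)) p.1 :=
      (hasDerivAt_id p.1).prodMk (hasDerivAt_const _ _)
    have h2 := (ih.differentiableAt (hΩ.mem_nhds hp)).hasFDerivAt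
    exact (h2.comp_hasDerivAt p.1 h1).deriv

theorem differentiableOn_taylorCoeff {G : ℂ × E → ℂ} {Ω : Set (ℂ × E)} (hΩ : IsOpen Ω)
    (hG : DifferentiableOn ℂ G Ω) (k : ℕ) {V : Set E} (hV : ∀ e ∈ V, ((0 : ℂ), e) ∈ Ω) :
    DifferentiableOn ℂ (taylorCoeff G k) V := by
  refine DifferentiableOn.const_mul ?_ _
  exact (differentiableOn_iteratedDeriv_fst hΩ hG k).comp (f := fun e : E => ((0 : ℂ), e))
    (by fun_prop) hV

theorem hasSum_taylorCoeff {ι : Type*} {G : ℂ × ι → ℂ} {e : ι} {ρ : ℝ}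
    (hG : DifferentiableOn ℂ (fun w => G (w, e)) (ball 0 ρ)) {w : ℂ} (hw : w ∈ ball (0 : ℂ) ρ) :
    HasSum (fun k => taylorCoeff G k e * w ^ k) (G (w, e)) := by
  have h := Complex.hasSum_taylorSeries_on_ball hG hw
  have he : (fun k => taylorCoeff G k e * w ^ k) = fun n : ℕ => (n.factorial : ℂ)⁻¹ •
      (w - 0) ^ n • iteratedDeriv n (fun w => G (w, e)) 0 := by
    funext k
    simp only [taylorCoeff, sub_zero, smul_eq_mul]
    ring
  rw [he]
  exact h

/-- Division by a power of the first variable: a holomorphic function `G(w, e)` that is `O(w ^ N)`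
for each fixed `e` is `w ^ N` times a holomorphic function. -/
theorem exists_eq_pow_mul {G : ℂ × E → ℂ} {Ω : Set (ℂ × E)} (hΩ : IsOpen Ω)
    (hG : DifferentiableOn ℂ G Ω) (N : ℕ)
    (hO : ∀ e, ((0 : ℂ), e) ∈ Ω → (fun w => G (w, e)) =O[𝓝 0] fun w => w ^ N) :
    ∃ Q : ℂ × E → ℂ, DifferentiableOn ℂ Q Ω ∧ ∀ p ∈ Ω, G p = p.1 ^ N * Q p := by
  classical
  -- On w = 0 the quotient can only be the N-th Taylor coefficient. Near that hyperplane both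
  -- branches are the sum of the Taylor series shifted by N, and this common description gives
  -- holomorphy.
  set Q : ℂ × E → ℂ := fun p => if p.1 = 0 then taylorCoeff G N p.2 else G p / p.1 ^ N with hQ
  have hcoeff : ∀ e, ((0 : ℂ), e) ∈ Ω → ∀ i < N, taylorCoeff G i e = 0 := by
    intro e he i hi
    have han : AnalyticAt ℂ (fun w => G (w, e)) 0 := by
      have hop : IsOpen {w : ℂ | (w, e) ∈ Ω} := hΩ.preimage (by fun_prop)
      refine DifferentiableOn.analyticAt (s := {w : ℂ | (w, e) ∈ Ω}) ?_ (hop.mem_nhds he)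
      exact hG.comp (f := fun w : ℂ => (w, e)) (by fun_prop) fun w hw => hw
    rw [taylorCoeff, iteratedDeriv_eq_zero_of_isBigO han (hO e he) hi, mul_zero]
  refine ⟨Q, ?_, ?_⟩
  · rintro ⟨w₀, e₀⟩ hp
    by_cases hw₀ : w₀ = 0
    · subst hw₀
      have hc := (hG.differentiableAt (hΩ.mem_nhds hp)).continuousAt
      have h1 : ∀ᶠ x in 𝓝 ((0 : ℂ), e₀), ‖G x‖ < ‖G (0, e₀)‖ + 1 :=
        hc.norm.eventually_lt_const (by linarith)
      obtain ⟨ρ, hρ, h⟩ := Metric.mem_nhds_iff.1 (inter_mem h1 (hΩ.mem_nhds hp))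
      set M := ‖G (0, e₀)‖ + 1 with hM
      have hM0 : 0 ≤ M := by positivity
      rw [← ball_prod_same] at h
      have hsl : ∀ e ∈ ball e₀ ρ, DifferentiableOn ℂ (fun w => G (w, e)) (ball 0 ρ) :=
        fun e he => hG.comp (f := fun w : ℂ => (w, e)) (by fun_prop)
          fun w hw => (h (mk_mem_prod hw he)).2
      have hsum : ∀ p ∈ ball (0 : ℂ) (ρ / 4) ×ˢ ball e₀ ρ,
          HasSum (fun k => taylorCoeff G (k + N) p.2 * p.1 ^ k) (Q p) := by
        rintro ⟨w, e⟩ ⟨hw, he⟩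
        have he0 : ((0 : ℂ), e) ∈ Ω := (h (mk_mem_prod (mem_ball_self hρ) he)).2
        by_cases hw0 : w = 0
        · subst hw0
          simp only [hQ, if_true]
          convert hasSum_single (f := fun k => taylorCoeff G (k + N) e * (0 : ℂ) ^ k) 0 ?_ using 1
          · simp
          · intro k hk; simp [hk]
        · simp only [hQ, hw0, if_false]
          have hs := hasSum_taylorCoeff (hsl e he) (ball_subset_ball (by linarith) hw)
          rw [← hasSum_nat_add_iff' N] at hs
          rw [Finset.sum_eq_zero fun i hi => by
            rw [hcoeff e he0 i (Finset.mem_range.1 hi), zero_mul], sub_zero] at hs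
          have hq : (fun k => taylorCoeff G (k + N) e * w ^ k) =
              fun k => taylorCoeff G (k + N) e * w ^ (k + N) / w ^ N := by
            funext k
            rw [pow_add]
            field_simp
          rw [hq]
          exact hs.div_const (w ^ N)
      have hdiff : DifferentiableOn ℂ (fun p : ℂ × E => ∑' k, taylorCoeff G (k + N) p.2 * p.1 ^ k)
          (ball (0 : ℂ) (ρ / 4) ×ˢ ball e₀ ρ) := by
        -- Cauchy's estimate on the circle of radius ρ/2, used for |w| < ρ/4, gives a geometric
        -- majorant of ratio 1/2.
        refine differentiableOn_tsum_of_summable_nhds (isOpen_ball.prod isOpen_ball)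
          (fun k => ?_) fun x hx => ⟨_, (isOpen_ball.prod isOpen_ball).mem_nhds hx,
            fun k => M / (ρ / 2) ^ N * (1 / 2) ^ k, ?_, ?_⟩
        · refine DifferentiableOn.mul ?_ (by fun_prop)
          refine (differentiableOn_taylorCoeff hΩ hG (k + N) (V := ball e₀ ρ) fun e he =>
            (h (mk_mem_prod (mem_ball_self hρ) he)).2).comp (f := fun p : ℂ × E => p.2)
            (by fun_prop) fun p hp => hp.2
        · exact (summable_geometric_of_lt_one (by norm_num) (by norm_num)).mul_left _
        · rintro k ⟨w, e⟩ ⟨hw, he⟩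
          rw [mem_ball_zero_iff] at hw
          simp only at hw he
          have hcb : closedBall (0 : ℂ) (ρ / 2) ⊆ ball 0 ρ := closedBall_subset_ball (by linarith)
          have hi := Complex.norm_iteratedDeriv_le_of_forall_mem_sphere_norm_le (k + N)
            (c := 0) (R := ρ / 2) (C := M) (by positivity)
            (((hsl e he).mono hcb).diffContOnCl_ball Subset.rfl)
            (fun z hz => (h (mk_mem_prod (hcb (sphere_subset_closedBall hz)) he)).1.le)
          have hfac : (0 : ℝ) < (k + N).factorial := by exact_mod_cast Nat.factorial_pos _
          rw [norm_mul, norm_pow, taylorCoeff, norm_mul, norm_inv, Complex.norm_natCast]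
          calc ((k + N).factorial : ℝ)⁻¹ * ‖iteratedDeriv (k + N) (fun w => G (w, e)) 0‖ * ‖w‖ ^ k
              ≤ ((k + N).factorial : ℝ)⁻¹ * ((k + N).factorial * M / (ρ / 2) ^ (k + N))
                * (ρ / 4) ^ k := by gcongr
            _ = M / (ρ / 2) ^ N * (1 / 2) ^ k := by
                rw [pow_add, show ρ / 4 = ρ / 2 * (1 / 2) by ring, mul_pow]
                field_simp
      have hmem : ((0 : ℂ), e₀) ∈ ball (0 : ℂ) (ρ / 4) ×ˢ ball e₀ ρ :=
        mk_mem_prod (mem_ball_self (by positivity)) (mem_ball_self hρ)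
      have hnhds := (isOpen_ball.prod isOpen_ball).mem_nhds hmem
      refine ((hdiff.differentiableAt hnhds).congr_of_eventuallyEq ?_).differentiableWithinAt
      filter_upwards [hnhds] with p hp
      exact ((hsum p hp).tsum_eq).symm
    · have hd : DifferentiableAt ℂ (fun p : ℂ × E => G p / p.1 ^ N) (w₀, e₀) :=
        (hG.differentiableAt (hΩ.mem_nhds hp)).mul
          ((differentiableAt_fst.pow N).inv (pow_ne_zero _ hw₀))
      refine (hd.congr_of_eventuallyEq ?_).differentiableWithinAt
      have : ∀ᶠ p : ℂ × E in 𝓝 (w₀, e₀), p.1 ≠ 0 :=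
        continuousAt_fst.eventually_ne hw₀
      filter_upwards [this] with p hp
      simp only [hQ, hp, if_false, div_eq_mul_inv]
  · rintro ⟨w, e⟩ hp
    by_cases hw : w = 0
    · subst hw
      simp only [hQ, if_true]
      by_cases hN : N = 0
      · subst hN; simp [taylorCoeff]
      · rw [zero_pow hN, zero_mul]
        have := hcoeff e hp 0 (by omega)
        simpa [taylorCoeff] using this
    · simp only [hQ, hw, if_false]
      have : w ^ N ≠ 0 := pow_ne_zero _ hw
      field_simp

/-- A holomorphic function on `𝔻_δ × U` that vanishes for `a = 0` is `O(a)` and `O(a)`-Lipschitz on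
compact subsets of `U`. -/
theorem exists_norm_le_mul_of_zero [ProperSpace E] {G : ℂ → E → F} {δ : ℝ} (hδ : 0 < δ) {U K : Set E}
    (hU : IsOpen U) (hG : DifferentiableOn ℂ (fun p : ℂ × E => G p.1 p.2) (ball 0 δ ×ˢ U))
    (h0 : ∀ e ∈ U, G 0 e = 0) (hK : IsCompact K) (hKU : K ⊆ U) :
    ∃ δ' > 0, δ' ≤ δ ∧ ∃ M, 0 ≤ M ∧ ∀ a : ℂ, ‖a‖ < δ' → (∀ e ∈ K, ‖G a e‖ ≤ M * ‖a‖) ∧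
      ∀ e ∈ K, ∀ e' ∈ K, ‖G a e' - G a e‖ ≤ M * ‖a‖ * ‖e' - e‖ := by
  obtain ⟨η, hη, hηU⟩ := hK.exists_cthickening_subset_open hU hKU
  have hKη : IsCompact (cthickening η K) := hK.cthickening
  have hcomp : IsCompact (closedBall (0 : ℂ) (δ / 2) ×ˢ cthickening η K) :=
    (isCompact_closedBall _ _).prod hKη
  have hsub : closedBall (0 : ℂ) (δ / 2) ×ˢ cthickening η K ⊆ ball 0 δ ×ˢ U :=
    prod_mono (closedBall_subset_ball (by linarith)) hηU
  obtain ⟨M, hM⟩ := hcomp.exists_bound_of_continuousOn (hG.mono hsub).continuousOn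
  -- Schwarz in the variable `a`, on a thickening of K. The thickening leaves room for a second
  -- Cauchy estimate in `e`, which gives the Lipschitz bound with the same factor ‖a‖.
  have hb : ∀ a : ℂ, ‖a‖ < δ / 2 → ∀ e ∈ cthickening η K, ‖G a e‖ ≤ M / (δ / 2) * ‖a‖ := by
    intro a ha e he
    have := norm_le_of_bounded_of_zero (f := fun a => G a e) (c := 0) (z := a) (η := δ / 2) (M := M)
      ?_ ?_ (h0 e (hηU he)) (by simpa using ha)
    · simpa using this
    · refine hG.comp (f := fun a : ℂ => (a, e)) (by fun_prop) fun a ha => ?_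
      exact mk_mem_prod (ball_subset_ball (by linarith) ha) (hηU he)
    · intro x hx
      exact hM (x, e) (mk_mem_prod (ball_subset_closedBall hx) he)
  refine ⟨δ / 2, by positivity, by linarith, max (M / (δ / 2)) (2 * (M / (δ / 2)) / η) ⊔ 0,
    le_max_right _ _, fun a ha => ⟨fun e he => ?_, fun e he e' he' => ?_⟩⟩
  · refine (hb a ha e (self_subset_cthickening K he)).trans ?_
    gcongr
    exact (le_max_left _ _).trans (le_max_left _ _)
  · have hbe : ball e η ⊆ cthickening η K := fun x hx =>
      mem_cthickening_of_dist_le x e η K he (mem_ball.1 hx).le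
    have := norm_sub_le_of_bounded (f := G a) (c := e) (z := e') hη
      (hG.comp (f := fun e : E => (a, e)) (by fun_prop) fun x hx => mk_mem_prod
        (by rw [mem_ball_zero_iff]; linarith) (hηU (hbe hx)))
      (fun x hx => hb a ha x (hbe hx)) (hb a ha e' (self_subset_cthickening K he'))
    refine this.trans ?_
    gcongr
    calc 2 * (M / (δ / 2) * ‖a‖) / η = 2 * (M / (δ / 2)) / η * ‖a‖ := by ring
      _ ≤ _ := by
        gcongr
        exact (le_max_right _ _).trans (le_max_left _ _)

end Holomorphic

/-- An injective holomorphic function has nonvanishing derivative, and its inverse is holomorphic. -/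
theorem deriv_ne_zero_and_hasDerivAt_inverse {f g : ℂ → ℂ} {V : Set ℂ} (hV : IsOpen V)
    (hf : DifferentiableOn ℂ f V) (hg : ∀ z ∈ V, g (f z) = z) {z₀ : ℂ} (hz₀ : z₀ ∈ V) :
    deriv f z₀ ≠ 0 ∧ DifferentiableAt ℂ g (f z₀) ∧ f '' V ∈ 𝓝 (f z₀) := by
  have hinj : InjOn f V := fun x hx y hy h => by rw [← hg x hx, ← hg y hy, h]
  have hnc : ∀ z ∈ V, ¬ ∀ᶠ w in 𝓝 z, f w = f z := by
    intro z hz h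
    have h1 : ∀ᶠ w in 𝓝[≠] z, False := by
      filter_upwards [(h.and (hV.mem_nhds hz)).filter_mono nhdsWithin_le_nhds,
        self_mem_nhdsWithin] with w hw hne
      exact hne (hinj hw.2 hz hw.1)
    exact (h1.exists).elim fun _ h => h
  have hopen : ∀ z ∈ V, 𝓝 (f z) ≤ map f (𝓝 z) := fun z hz =>
    ((hf.analyticAt (hV.mem_nhds hz)).eventually_constant_or_nhds_le_map_nhds).resolve_left
      (hnc z hz)
  have hcont : ∀ z ∈ V, ContinuousAt g (f z) := by
    intro z hz
    rw [ContinuousAt, hg z hz]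
    intro W hW
    rw [mem_map]
    have : f '' (W ∩ V) ∈ 𝓝 (f z) := hopen z hz (image_mem_map (inter_mem hW (hV.mem_nhds hz)))
    filter_upwards [this]
    rintro _ ⟨x, hx, rfl⟩
    rw [mem_preimage, hg x hx.2]
    exact hx.1
  have himg : ∀ z ∈ V, f '' V ∈ 𝓝 (f z) := fun z hz =>
    hopen z hz (image_mem_map (hV.mem_nhds hz))
  have hright : ∀ z ∈ V, ∀ᶠ w in 𝓝 (f z), f (g w) = w := by
    intro z hz
    filter_upwards [himg z hz]
    rintro _ ⟨x, hx, rfl⟩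
    rw [hg x hx]
  have hreg : ∀ z ∈ V, deriv f z ≠ 0 → DifferentiableAt ℂ g (f z) := by
    intro z hz hne
    have h1 : HasDerivAt f (deriv f z) (g (f z)) := by
      rw [hg z hz]; exact (hf.differentiableAt (hV.mem_nhds hz)).hasDerivAt
    exact (HasDerivAt.of_local_left_inverse (hcont z hz) h1 hne (hright z hz)).differentiableAt
  have hdiff : DifferentiableAt ℂ g (f z₀) := by
    -- A zero of the derivative would be isolated, so `g` is holomorphic on a punctured
    -- neighbourhood and continuous at the centre: a removable singularity. The chain rule for `g ∘
    -- f = id` then excludes the zero.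
    by_cases hd : deriv f z₀ = 0
    · have han : AnalyticAt ℂ (deriv f) z₀ := (hf.analyticAt (hV.mem_nhds hz₀)).deriv
      rcases han.eventually_eq_zero_or_eventually_ne_zero with h | h
      · exfalso
        obtain ⟨η, hη, hsub⟩ := Metric.mem_nhds_iff.1 (inter_mem h (hV.mem_nhds hz₀))
        refine hnc z₀ hz₀ ?_
        filter_upwards [ball_mem_nhds z₀ hη] with w hw
        refine (convex_ball z₀ η).is_const_of_fderivWithin_eq_zero (𝕜 := ℂ) (f := f)
          (hf.mono fun x hx => (hsub hx).2) (fun x hx => ?_) hw (mem_ball_self hη)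
        rw [fderivWithin_of_isOpen isOpen_ball hx]
        ext
        simpa using (hsub hx).1
      · refine (Complex.analyticAt_of_differentiable_on_punctured_nhds_of_continuousAt ?_
          (hcont z₀ hz₀)).differentiableAt
        have hgt : Tendsto g (𝓝[≠] (f z₀)) (𝓝[≠] z₀) := by
          refine tendsto_nhdsWithin_iff.2 ⟨?_, ?_⟩
          · have := (hcont z₀ hz₀).tendsto
            rw [hg z₀ hz₀] at this
            exact this.mono_left nhdsWithin_le_nhds
          · filter_upwards [(hright z₀ hz₀).filter_mono nhdsWithin_le_nhds,
              self_mem_nhdsWithin] with w hw hne h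
            rw [mem_singleton_iff] at h
            rw [h] at hw
            exact hne hw.symm
        filter_upwards [hgt.eventually h, (himg z₀ hz₀ : f '' V ∈ 𝓝 (f z₀)) |>
          fun h => mem_nhdsWithin_of_mem_nhds h] with w hw hwV
        obtain ⟨x, hx, rfl⟩ := hwV
        rw [hg x hx] at hw
        exact hreg x hx hw
    · exact hreg z₀ hz₀ hd
  refine ⟨fun hd => ?_, hdiff, himg z₀ hz₀⟩
  have h1 := (hdiff.hasDerivAt).comp z₀ (hf.differentiableAt (hV.mem_nhds hz₀)).hasDerivAt
  have h2 : HasDerivAt (g ∘ f) 1 z₀ := by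
    refine (hasDerivAt_id z₀).congr_of_eventuallyEq ?_
    filter_upwards [hV.mem_nhds hz₀] with z hz
    exact hg z hz
  rw [hd, mul_zero] at h1
  exact zero_ne_one (h1.unique h2)

end SemiParabolicHenon

namespace SemiParabolicHenon

/-! ### Cohomological equations over a fibred contraction. -/

section Cohomological

variable {δ R : ℝ} {F : ℂ × ℂ → ℂ}

/-- The fibred map `(a, v) ↦ (a, F (a, v))`. -/
def fibred (F : ℂ × ℂ → ℂ) (p : ℂ × ℂ) : ℂ × ℂ := (p.1, F p)

theorem fibred_iterate_fst (F : ℂ × ℂ → ℂ) (n : ℕ) (p : ℂ × ℂ) : ((fibred F)^[n] p).1 = p.1 := by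
  induction n generalizing p with
  | zero => rfl
  | succ n ih => rw [Function.iterate_succ_apply, ih]; rfl

theorem mapsTo_fibred (hFb : ∀ p ∈ ball (0 : ℂ) δ ×ˢ ball (0 : ℂ) R, ‖F p‖ ≤ ‖p.2‖ / 2)
    {δ' R' : ℝ} (hδ' : δ' ≤ δ) (hR' : R' ≤ R) :
    MapsTo (fibred F) (ball (0 : ℂ) δ' ×ˢ ball (0 : ℂ) R') (ball (0 : ℂ) δ' ×ˢ ball (0 : ℂ) R') := by
  rintro ⟨a, v⟩ ⟨ha, hv⟩
  refine ⟨ha, ?_⟩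
  have := hFb (a, v) ⟨ball_subset_ball hδ' ha, ball_subset_ball hR' hv⟩
  simp only [mem_ball_zero_iff, fibred] at *
  linarith [norm_nonneg v]

theorem norm_fibred_iterate_snd_le (hFb : ∀ p ∈ ball (0 : ℂ) δ ×ˢ ball (0 : ℂ) R, ‖F p‖ ≤ ‖p.2‖ / 2)
    {p : ℂ × ℂ} (hp : p ∈ ball (0 : ℂ) δ ×ˢ ball (0 : ℂ) R) (n : ℕ) :
    ‖((fibred F)^[n] p).2‖ ≤ ‖p.2‖ * (1 / 2) ^ n := by
  induction n with
  | zero => simp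
  | succ n ih =>
    have hmem : (fibred F)^[n] p ∈ ball (0 : ℂ) δ ×ˢ ball (0 : ℂ) R :=
      (mapsTo_fibred hFb le_rfl le_rfl).iterate n hp
    rw [Function.iterate_succ_apply']
    have := hFb _ hmem
    calc ‖F ((fibred F)^[n] p)‖ ≤ _ := this
      _ ≤ ‖p.2‖ * (1 / 2) ^ (n + 1) := by rw [pow_succ]; linarith

/-- The equation `b - κ b ∘ F = β` over a fibred contraction, for `β` vanishing at the fixed point. -/
theorem exists_cohomological_solution {β : ℂ × ℂ → ℂ} {κ : ℂ} (hδ : 0 < δ) (hR : 0 < R) (hκ : ‖κ‖ = 1)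
    (hF : DifferentiableOn ℂ F (ball (0 : ℂ) δ ×ˢ ball (0 : ℂ) R))
    (hFb : ∀ p ∈ ball (0 : ℂ) δ ×ˢ ball (0 : ℂ) R, ‖F p‖ ≤ ‖p.2‖ / 2)
    (hβ : DifferentiableOn ℂ β (ball (0 : ℂ) δ ×ˢ ball (0 : ℂ) R))
    (hβ0 : ∀ a ∈ ball (0 : ℂ) δ, β (a, 0) = 0) :
    ∃ b : ℂ × ℂ → ℂ, DifferentiableOn ℂ b (ball (0 : ℂ) δ ×ˢ ball (0 : ℂ) R) ∧
      (∀ p ∈ ball (0 : ℂ) δ ×ˢ ball (0 : ℂ) R, b p - κ * b (p.1, F p) = β p) ∧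
      (∀ a ∈ ball (0 : ℂ) δ, b (a, 0) = 0) ∧
      ((∀ v ∈ ball (0 : ℂ) R, β (0, v) = 0) → ∀ v ∈ ball (0 : ℂ) R, b (0, v) = 0) := by
  set Δ := ball (0 : ℂ) δ ×ˢ ball (0 : ℂ) R with hΔ
  have hΔo : IsOpen Δ := isOpen_ball.prod isOpen_ball
  have hmaps : MapsTo (fibred F) Δ Δ := mapsTo_fibred hFb le_rfl le_rfl
  have hTd : DifferentiableOn ℂ (fibred F) Δ := differentiableOn_fst.prodMk hF
  have hTn : ∀ n, DifferentiableOn ℂ ((fibred F)^[n]) Δ := fun n => hTd.iterate hmaps n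
  have hterm : ∀ x ∈ Δ, ∃ t ∈ 𝓝 x, ∃ u : ℕ → ℝ, Summable u ∧
      ∀ n, ∀ y ∈ t, ‖κ ^ n * β ((fibred F)^[n] y)‖ ≤ u n := by
    rintro ⟨a₀, v₀⟩ ⟨ha₀, hv₀⟩
    obtain ⟨δ₁, hδ₁, hδ₁'⟩ := exists_between (mem_ball_zero_iff.1 ha₀)
    obtain ⟨R₁, hR₁, hR₁'⟩ := exists_between (mem_ball_zero_iff.1 hv₀)
    simp only at hδ₁ hR₁
    have hR₁0 : 0 < R₁ := (norm_nonneg _).trans_lt hR₁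
    have hsub : closedBall (0 : ℂ) δ₁ ×ˢ closedBall (0 : ℂ) R₁ ⊆ Δ :=
      prod_mono (closedBall_subset_ball hδ₁') (closedBall_subset_ball hR₁')
    obtain ⟨M, hM⟩ := ((isCompact_closedBall (0 : ℂ) δ₁).prod
      (isCompact_closedBall (0 : ℂ) R₁)).exists_bound_of_continuousOn (hβ.mono hsub).continuousOn
    refine ⟨ball 0 δ₁ ×ˢ ball 0 R₁, (isOpen_ball.prod isOpen_ball).mem_nhds
      ⟨by simpa using hδ₁, by simpa using hR₁⟩, fun n => M * (1 / 2) ^ n,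
      (summable_geometric_of_lt_one (by norm_num) (by norm_num)).mul_left _, ?_⟩
    intro n y hy
    have hyΔ : y ∈ Δ := hsub (prod_mono ball_subset_closedBall ball_subset_closedBall hy)
    have hM0 : 0 ≤ M := (norm_nonneg _).trans
      (hM y (prod_mono ball_subset_closedBall ball_subset_closedBall hy))
    have hmem : (fibred F)^[n] y ∈ ball (0 : ℂ) δ₁ ×ˢ ball (0 : ℂ) R₁ :=
      (mapsTo_fibred hFb hδ₁'.le hR₁'.le).iterate n hy
    set z := (fibred F)^[n] y with hz
    have hz1 : ((z.1, z.2) : ℂ × ℂ) = z := rfl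
    have h1 := norm_le_of_bounded_of_zero (f := fun v => β (z.1, v)) (c := 0) (z := z.2) (η := R₁)
      (M := M) (hβ.comp (f := fun v : ℂ => (z.1, v)) (by fun_prop) fun v hv => hsub
        ⟨ball_subset_closedBall hmem.1, ball_subset_closedBall hv⟩)
      (fun v hv => hM _ ⟨ball_subset_closedBall hmem.1, ball_subset_closedBall hv⟩)
      (hβ0 _ (ball_subset_ball hδ₁'.le hmem.1)) hmem.2
    rw [norm_mul, norm_pow, hκ, one_pow, one_mul]
    simp only [sub_zero] at h1
    have h2 := norm_fibred_iterate_snd_le hFb hyΔ n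
    have h3 : ‖y.2‖ ≤ R₁ := (mem_ball_zero_iff.1 hy.2).le
    calc ‖β z‖ ≤ M / R₁ * ‖z.2‖ := h1
      _ ≤ M / R₁ * (R₁ * (1 / 2) ^ n) := by
        gcongr
        exact h2.trans (by gcongr)
      _ = M * (1 / 2) ^ n := by field_simp
  have hsummable : ∀ x ∈ Δ, Summable fun n => κ ^ n * β ((fibred F)^[n] x) := by
    intro x hx
    obtain ⟨t, ht, u, hu, hb⟩ := hterm x hx
    exact Summable.of_norm_bounded hu fun n => hb n x (mem_of_mem_nhds ht)
  -- The formal solution Σ κⁿ β∘Tⁿ. It converges because |κ| = 1, the fibre coordinate of Tⁿ is at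
  -- most 2⁻ⁿ times the initial one, and β vanishes at fibre coordinate 0.
  refine ⟨fun p => ∑' n, κ ^ n * β ((fibred F)^[n] p), ?_, ?_, ?_, ?_⟩
  · refine differentiableOn_tsum_of_summable_nhds hΔo (fun n => ?_) hterm
    exact (hβ.comp (hTn n) (hmaps.iterate n)).const_mul _
  · intro p hp
    beta_reduce
    rw [(hsummable p hp).tsum_eq_zero_add, ← tsum_mul_left]
    have : ∀ n, κ ^ (n + 1) * β ((fibred F)^[n + 1] p)
        = κ * (κ ^ n * β ((fibred F)^[n] (p.1, F p))) := by
      intro n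
      rw [Function.iterate_succ_apply, pow_succ]
      simp only [fibred]
      ring
    simp only [this]
    simp
  · intro a ha
    refine (tsum_congr fun n => ?_).trans tsum_zero
    have hmem : ((a, 0) : ℂ × ℂ) ∈ Δ := ⟨ha, mem_ball_self hR⟩
    have h := norm_fibred_iterate_snd_le hFb hmem n
    simp only [norm_zero, zero_mul, norm_le_zero_iff] at h
    have h' : (fibred F)^[n] (a, 0) = (a, 0) :=
      Prod.ext (fibred_iterate_fst F n (a, 0)) h
    rw [h', hβ0 a ha, mul_zero]
  · intro h v hv
    refine (tsum_congr fun n => ?_).trans tsum_zero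
    have hmem : ((0, v) : ℂ × ℂ) ∈ Δ := ⟨mem_ball_self hδ, hv⟩
    have h1 := hmaps.iterate n hmem
    have h2 := fibred_iterate_fst F n (0, v)
    have h3 : (fibred F)^[n] (0, v) = (0, ((fibred F)^[n] (0, v)).2) := Prod.ext h2 rfl
    rw [h3, h _ h1.2, mul_zero]

/-- The equation `u ∘ F * m = u` over a fibred contraction, for `m` equal to `1` at the fixed point
and for `a = 0`. -/
theorem exists_multiplicative_solution {m : ℂ × ℂ → ℂ} {R' : ℝ} (hδ : 0 < δ) (hR' : 0 < R')
    (hRR' : R' < R) (hF : DifferentiableOn ℂ F (ball (0 : ℂ) δ ×ˢ ball (0 : ℂ) R))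
    (hFb : ∀ p ∈ ball (0 : ℂ) δ ×ˢ ball (0 : ℂ) R, ‖F p‖ ≤ ‖p.2‖ / 2)
    (hm : DifferentiableOn ℂ m (ball (0 : ℂ) δ ×ˢ ball (0 : ℂ) R))
    (hm0 : ∀ a ∈ ball (0 : ℂ) δ, m (a, 0) = 1) (hm1 : ∀ v ∈ ball (0 : ℂ) R, m (0, v) = 1) :
    ∃ δ' > 0, δ' ≤ δ ∧ ∃ u : ℂ × ℂ → ℂ,
      DifferentiableOn ℂ u (ball (0 : ℂ) δ' ×ˢ ball (0 : ℂ) R') ∧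
      (∀ p, u p ≠ 0) ∧
      (∀ p ∈ ball (0 : ℂ) δ' ×ˢ ball (0 : ℂ) R', u (p.1, F p) * m p = u p) ∧
      (∀ a ∈ ball (0 : ℂ) δ', u (a, 0) = 1) ∧ ∀ v ∈ ball (0 : ℂ) R', u (0, v) = 1 := by
  obtain ⟨δ₁, hδ₁, hδ₁δ, M, hM0, hM⟩ := exists_norm_le_mul_of_zero (G := fun a v => m (a, v) - 1)
    (K := closedBall (0 : ℂ) R') hδ isOpen_ball (hm.sub_const 1)
    (fun v hv => by rw [hm1 v hv, sub_self]) (isCompact_closedBall _ _)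
    (closedBall_subset_ball hRR')
  -- The second bound forces |m - 1| < 1, so the principal logarithm of `m` is holomorphic.
  set δ' := min δ₁ (1 / (M + 1)) with hδ'
  have hδ'0 : 0 < δ' := lt_min hδ₁ (by positivity)
  have hδ'δ : δ' ≤ δ := (min_le_left _ _).trans hδ₁δ
  have hsub : ball (0 : ℂ) δ' ×ˢ ball (0 : ℂ) R' ⊆ ball (0 : ℂ) δ ×ˢ ball (0 : ℂ) R :=
    prod_mono (ball_subset_ball hδ'δ) (ball_subset_ball hRR'.le)
  have hslit : ∀ p ∈ ball (0 : ℂ) δ' ×ˢ ball (0 : ℂ) R', m p ∈ Complex.slitPlane := by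
    rintro ⟨a, v⟩ ⟨ha, hv⟩
    rw [mem_ball_zero_iff] at ha
    have h1 := (hM a (ha.trans_le (min_le_left _ _))).1 v (ball_subset_closedBall hv)
    have h2 : M * ‖a‖ < 1 := by
      have : ‖a‖ < 1 / (M + 1) := ha.trans_le (min_le_right _ _)
      rw [lt_div_iff₀ (by positivity)] at this
      nlinarith [norm_nonneg a]
    have := Complex.mem_slitPlane_of_norm_lt_one (h1.trans_lt h2)
    simpa using this
  -- The additive equation with κ = 1 for log m; its exponential solves the multiplicative one.
  obtain ⟨b, hb, hbe, hb0, hb1⟩ := exists_cohomological_solution (β := fun p => Complex.log (m p))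
    (κ := 1) hδ'0 hR' (by simp) (hF.mono hsub) (fun p hp => hFb p (hsub hp))
    ((hm.mono hsub).clog hslit) (fun a ha => by
      simp [hm0 a (ball_subset_ball hδ'δ ha)])
  refine ⟨δ', hδ'0, hδ'δ, fun p => Complex.exp (b p), hb.cexp, fun p => Complex.exp_ne_zero _,
    fun p hp => ?_, fun a ha => by simp [hb0 a ha], fun v hv => ?_⟩
  · have h := hbe p hp
    rw [one_mul, sub_eq_iff_eq_add] at h
    beta_reduce
    rw [h, Complex.exp_add, Complex.exp_log (Complex.slitPlane_ne_zero (hslit p hp)), mul_comm]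
  · beta_reduce
    rw [hb1 (fun v hv => by simp [hm1 v (ball_subset_ball hRR'.le hv)]) v hv, Complex.exp_zero]

end Cohomological

end SemiParabolicHenon

namespace SemiParabolicHenon

/-! ### The stable manifold as a graph: contraction of the graph transform. -/

section StableManifold

/-- The graph transform for the slope `θ` of the local stable manifold `x = X + a v θ(a, v)`. -/
noncomputable def graphTransform (lam : ℂ) (θ : ℂ × ℂ → ℂ) (p : ℂ × ℂ) : ℂ :=
  -(1 + p.1 * p.2 * θ p ^ 2 - p.1 ^ 2 * θ p * θ (p.1, p.1 ^ 2 * p.2 * θ p))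
    / (lam + eigenMu lam p.1)

theorem norm_eigenMu {lam : ℂ} (hlam : ‖lam‖ = 1) (a : ℂ) : ‖eigenMu lam a‖ = ‖a‖ ^ 2 := by
  simp [eigenMu, hlam]

variable {lam : ℂ} {δ R : ℝ}

theorem one_sub_le_norm_lam_add_mu (hlam : ‖lam‖ = 1) (a : ℂ) :
    1 - ‖a‖ ^ 2 ≤ ‖lam + eigenMu lam a‖ := by
  have h := norm_sub_norm_le lam (-eigenMu lam a)
  rwa [norm_neg, norm_eigenMu hlam, hlam, sub_neg_eq_add] at h

/-- Points `(a, a² v t)` with `‖t‖ ≤ 2` lie well inside the bidisk. -/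
theorem norm_sq_mul_mul_lt (hR : 1 ≤ R) (hδR : δ * R ≤ 1 / 64) {p : ℂ × ℂ}
    (hp : p ∈ ball (0 : ℂ) δ ×ˢ ball (0 : ℂ) R) {t : ℂ} (ht : ‖t‖ ≤ 2) :
    ‖p.1 ^ 2 * p.2 * t‖ < R / 2 := by
  have h1 : ‖p.1‖ < δ := mem_ball_zero_iff.1 hp.1
  have h2 : ‖p.2‖ < R := mem_ball_zero_iff.1 hp.2
  have hδ : 0 < δ := (norm_nonneg _).trans_lt h1
  have hδ1 : δ ≤ 1 / 64 := by nlinarith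
  rw [norm_mul, norm_mul, norm_pow]
  calc ‖p.1‖ ^ 2 * ‖p.2‖ * ‖t‖ ≤ δ ^ 2 * R * 2 := by gcongr
    _ = 2 * δ * (δ * R) := by ring
    _ ≤ 2 * (1 / 64) * (1 / 64) := by gcongr
    _ < R / 2 := by linarith

theorem mem_of_norm_sq_mul (hR : 1 ≤ R) (hδR : δ * R ≤ 1 / 64) {p : ℂ × ℂ}
    (hp : p ∈ ball (0 : ℂ) δ ×ˢ ball (0 : ℂ) R) {t : ℂ} (ht : ‖t‖ ≤ 2) :
    (p.1, p.1 ^ 2 * p.2 * t) ∈ ball (0 : ℂ) δ ×ˢ ball (0 : ℂ) R :=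
  ⟨hp.1, mem_ball_zero_iff.2 ((norm_sq_mul_mul_lt hR hδR hp ht).trans (by linarith))⟩

theorem lam_add_mu_bound (hlam : ‖lam‖ = 1) (hR : 1 ≤ R) (hδR : δ * R ≤ 1 / 64) {a : ℂ}
    (ha : a ∈ ball (0 : ℂ) δ) : 3 / 4 ≤ ‖lam + eigenMu lam a‖ := by
  have h1 : ‖a‖ < δ := mem_ball_zero_iff.1 ha
  have hδ1 : δ ≤ 1 / 64 := by nlinarith [(norm_nonneg a).trans_lt h1]
  have := one_sub_le_norm_lam_add_mu hlam a
  nlinarith [norm_nonneg a]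

/-- The smallness of δR bounds both nonlinear terms by 1/16 and the denominator below by 3/4, so the
value is at most (9/8)/(3/4) = 3/2. -/
theorem graphTransform_norm_le (hlam : ‖lam‖ = 1) (hR : 1 ≤ R) (hδR : δ * R ≤ 1 / 64)
    {θ : ℂ × ℂ → ℂ} (hθ : ∀ p ∈ ball (0 : ℂ) δ ×ˢ ball (0 : ℂ) R, ‖θ p‖ ≤ 2) :
    ∀ p ∈ ball (0 : ℂ) δ ×ˢ ball (0 : ℂ) R, ‖graphTransform lam θ p‖ ≤ 2 := by
  intro p hp
  have h1 : ‖p.1‖ < δ := mem_ball_zero_iff.1 hp.1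
  have h2 : ‖p.2‖ < R := mem_ball_zero_iff.1 hp.2
  have hδ : 0 < δ := (norm_nonneg _).trans_lt h1
  have hδ1 : δ ≤ 1 / 64 := by nlinarith
  have hS := lam_add_mu_bound hlam hR hδR hp.1
  have ht := hθ p hp
  have ht' := hθ _ (mem_of_norm_sq_mul hR hδR hp ht)
  rw [graphTransform, norm_div, norm_neg, div_le_iff₀ (by linarith)]
  have e1 : ‖p.1 * p.2 * θ p ^ 2‖ ≤ 1 / 16 := by
    rw [norm_mul, norm_mul, norm_pow]
    calc ‖p.1‖ * ‖p.2‖ * ‖θ p‖ ^ 2 ≤ δ * R * 2 ^ 2 := by gcongr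
      _ ≤ 1 / 16 := by linarith
  have e2 : ‖p.1 ^ 2 * θ p * θ (p.1, p.1 ^ 2 * p.2 * θ p)‖ ≤ 1 / 16 := by
    rw [norm_mul, norm_mul, norm_pow]
    calc ‖p.1‖ ^ 2 * ‖θ p‖ * ‖θ (p.1, p.1 ^ 2 * p.2 * θ p)‖ ≤ (1 / 64) ^ 2 * 2 * 2 := by
          gcongr; linarith
      _ ≤ 1 / 16 := by norm_num
  have e3 := norm_sub_le (1 + p.1 * p.2 * θ p ^ 2) (p.1 ^ 2 * θ p * θ (p.1, p.1 ^ 2 * p.2 * θ p))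
  have e4 := norm_add_le (1 : ℂ) (p.1 * p.2 * θ p ^ 2)
  rw [norm_one] at e4
  linarith

theorem graphTransform_differentiableOn (hlam : ‖lam‖ = 1) (hR : 1 ≤ R) (hδR : δ * R ≤ 1 / 64)
    {θ : ℂ × ℂ → ℂ} (hd : DifferentiableOn ℂ θ (ball (0 : ℂ) δ ×ˢ ball (0 : ℂ) R))
    (hθ : ∀ p ∈ ball (0 : ℂ) δ ×ˢ ball (0 : ℂ) R, ‖θ p‖ ≤ 2) :
    DifferentiableOn ℂ (graphTransform lam θ) (ball (0 : ℂ) δ ×ˢ ball (0 : ℂ) R) := by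
  have hcomp : DifferentiableOn ℂ (fun p : ℂ × ℂ => θ (p.1, p.1 ^ 2 * p.2 * θ p))
      (ball (0 : ℂ) δ ×ˢ ball (0 : ℂ) R) :=
    hd.comp (f := fun p : ℂ × ℂ => (p.1, p.1 ^ 2 * p.2 * θ p)) (by fun_prop)
      fun p hp => mem_of_norm_sq_mul hR hδR hp (hθ p hp)
  unfold graphTransform
  simp only [div_eq_mul_inv]
  refine DifferentiableOn.mul (DifferentiableOn.neg (DifferentiableOn.sub (by fun_prop)
    (DifferentiableOn.mul (by fun_prop) hcomp))) (DifferentiableOn.inv ?_ fun p hp => ?_)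
  · unfold eigenMu
    fun_prop
  · have := lam_add_mu_bound hlam hR hδR hp.1
    intro h
    rw [h, norm_zero] at this
    linarith

/-- The delicate term is the composition θ(a, a²vθ), where changing θ also moves the argument. The
arguments lie in the half-size disk, so Cauchy's estimate makes θ' Lipschitz there and the
displacement costs a small multiple of ε. Only θ' has to be holomorphic, so the estimate can compare
an iterate with the limit. -/
theorem graphTransform_contraction (hlam : ‖lam‖ = 1) (hR : 1 ≤ R) (hδR : δ * R ≤ 1 / 64)
    {θ θ' : ℂ × ℂ → ℂ} (hθ : ∀ p ∈ ball (0 : ℂ) δ ×ˢ ball (0 : ℂ) R, ‖θ p‖ ≤ 2)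
    (hd' : DifferentiableOn ℂ θ' (ball (0 : ℂ) δ ×ˢ ball (0 : ℂ) R))
    (hθ' : ∀ p ∈ ball (0 : ℂ) δ ×ˢ ball (0 : ℂ) R, ‖θ' p‖ ≤ 2) {ε : ℝ}
    (hε : ∀ p ∈ ball (0 : ℂ) δ ×ˢ ball (0 : ℂ) R, ‖θ p - θ' p‖ ≤ ε) :
    ∀ p ∈ ball (0 : ℂ) δ ×ˢ ball (0 : ℂ) R,
      ‖graphTransform lam θ p - graphTransform lam θ' p‖ ≤ ε / 2 := by
  intro p hp
  have h1 : ‖p.1‖ < δ := mem_ball_zero_iff.1 hp.1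
  have h2 : ‖p.2‖ < R := mem_ball_zero_iff.1 hp.2
  have hδ : 0 < δ := (norm_nonneg _).trans_lt h1
  have hδ1 : δ ≤ 1 / 64 := by nlinarith
  have hS := lam_add_mu_bound hlam hR hδR hp.1
  have ht := hθ p hp
  have ht' := hθ' p hp
  have hεp := hε p hp
  have hε0 : 0 ≤ ε := (norm_nonneg _).trans hεp
  set s := p.1 ^ 2 * p.2 * θ p with hs
  set s' := p.1 ^ 2 * p.2 * θ' p with hs'
  have hsm := mem_of_norm_sq_mul hR hδR hp ht
  have hsm' := mem_of_norm_sq_mul hR hδR hp ht'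
  have hsn : ‖s'‖ < R / 2 := norm_sq_mul_mul_lt hR hδR hp ht'
  have hlip : ‖θ' (p.1, s) - θ' (p.1, s')‖ ≤ ε := by
    have hball : ∀ x ∈ ball s' (R / 2), (p.1, x) ∈ ball (0 : ℂ) δ ×ˢ ball (0 : ℂ) R := fun x hx => by
      refine ⟨hp.1, mem_ball_zero_iff.2 ?_⟩
      rw [mem_ball, dist_eq_norm] at hx
      calc ‖x‖ = ‖(x - s') + s'‖ := by ring_nf
        _ ≤ ‖x - s'‖ + ‖s'‖ := norm_add_le _ _
        _ < R := by linarith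
    have := norm_sub_le_of_bounded (f := fun x => θ' (p.1, x)) (c := s') (z := s) (η := R / 2)
      (M := 2) (by linarith) (hd'.comp (f := fun x : ℂ => (p.1, x)) (by fun_prop) hball)
      (fun x hx => hθ' _ (hball x hx)) (hθ' _ hsm)
    refine this.trans ?_
    have hss : s - s' = p.1 ^ 2 * p.2 * (θ p - θ' p) := by rw [hs, hs']; ring
    rw [hss, norm_mul, norm_mul, norm_pow]
    calc 2 * 2 / (R / 2) * (‖p.1‖ ^ 2 * ‖p.2‖ * ‖θ p - θ' p‖)
        ≤ 2 * 2 / (R / 2) * ((1 / 64) ^ 2 * R * ε) := by gcongr; linarith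
      _ = 8 / 64 ^ 2 * ε := by field_simp; ring
      _ ≤ ε := by linarith
  have hA : ‖p.1 * p.2 * (θ p ^ 2 - θ' p ^ 2)‖ ≤ ε / 16 := by
    have : θ p ^ 2 - θ' p ^ 2 = (θ p + θ' p) * (θ p - θ' p) := by ring
    rw [this, norm_mul, norm_mul, norm_mul]
    calc ‖p.1‖ * ‖p.2‖ * (‖θ p + θ' p‖ * ‖θ p - θ' p‖) ≤ δ * R * (4 * ε) := by
          gcongr
          exact (norm_add_le _ _).trans (by linarith)
      _ ≤ 1 / 64 * (4 * ε) := by gcongr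
      _ = ε / 16 := by ring
  have hB : ‖p.1 ^ 2 * (θ p * θ (p.1, s) - θ' p * θ' (p.1, s'))‖ ≤ ε / 16 := by
    have e : θ p * θ (p.1, s) - θ' p * θ' (p.1, s') = (θ p - θ' p) * θ (p.1, s)
        + θ' p * ((θ (p.1, s) - θ' (p.1, s)) + (θ' (p.1, s) - θ' (p.1, s'))) := by ring
    have e1 : ‖(θ p - θ' p) * θ (p.1, s)‖ ≤ ε * 2 := by
      rw [norm_mul]; gcongr; exact hθ _ hsm
    have e2 : ‖θ' p * ((θ (p.1, s) - θ' (p.1, s)) + (θ' (p.1, s) - θ' (p.1, s')))‖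
        ≤ 2 * (ε + ε) := by
      rw [norm_mul]; gcongr
      exact (norm_add_le _ _).trans (add_le_add (hε _ hsm) hlip)
    rw [e, norm_mul, norm_pow]
    calc _ ≤ (1 / 64) ^ 2 * (ε * 2 + 2 * (ε + ε)) := by
          gcongr
          · linarith
          · exact (norm_add_le _ _).trans (add_le_add e1 e2)
      _ ≤ ε / 16 := by linarith
  have key : graphTransform lam θ p - graphTransform lam θ' p =
      (p.1 ^ 2 * (θ p * θ (p.1, s) - θ' p * θ' (p.1, s')) - p.1 * p.2 * (θ p ^ 2 - θ' p ^ 2))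
        / (lam + eigenMu lam p.1) := by
    simp only [graphTransform, ← hs, ← hs']
    ring
  rw [key, norm_div, div_le_iff₀ (by linarith)]
  refine (norm_sub_le _ _).trans ?_
  nlinarith

/-- The local stable manifolds of the maps `H_{c,a}` are graphs `x = X + a v θ(a, v)`, where `v` is
the distance of `y` from the fixed point and `θ` is holomorphic. -/
theorem exists_stable_slope (hlam : ‖lam‖ = 1) (hδ : 0 < δ) (hR : 1 ≤ R) (hδR : δ * R ≤ 1 / 64) :
    ∃ θ : ℂ × ℂ → ℂ, DifferentiableOn ℂ θ (ball (0 : ℂ) δ ×ˢ ball (0 : ℂ) R) ∧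
      (∀ p ∈ ball (0 : ℂ) δ ×ˢ ball (0 : ℂ) R, ‖θ p‖ ≤ 2) ∧
      (∀ p ∈ ball (0 : ℂ) δ ×ˢ ball (0 : ℂ) R,
        p.1 ^ 2 * θ p * θ (p.1, p.1 ^ 2 * p.2 * θ p)
          = (lam + eigenMu lam p.1) * θ p + p.1 * p.2 * θ p ^ 2 + 1) ∧
      (∀ v ∈ ball (0 : ℂ) R, θ (0, v) = -1 / lam) ∧
      (∀ a ∈ ball (0 : ℂ) δ, θ (a, 0) = -1 / lam) := by
  have hlam0 : lam ≠ 0 := by rintro rfl; simp at hlam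
  have hδ1 : δ ≤ 1 / 64 := by nlinarith
  set Δ := ball (0 : ℂ) δ ×ˢ ball (0 : ℂ) R with hΔ
  have hΔo : IsOpen Δ := isOpen_ball.prod isOpen_ball
  set θn : ℕ → ℂ × ℂ → ℂ := fun n => (graphTransform lam)^[n] (fun _ => 0) with hθn
  have hsucc : ∀ n, θn (n + 1) = graphTransform lam (θn n) := fun n => by
    simp only [hθn, Function.iterate_succ_apply']
  have hadm : ∀ n, DifferentiableOn ℂ (θn n) Δ ∧ ∀ p ∈ Δ, ‖θn n p‖ ≤ 2 := by
    intro n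
    induction n with
    | zero => exact ⟨by simp [hθn], fun p _ => by simp [hθn]⟩
    | succ n ih =>
      rw [hsucc]
      exact ⟨graphTransform_differentiableOn hlam hR hδR ih.1 ih.2,
        graphTransform_norm_le hlam hR hδR ih.2⟩
  have hdist : ∀ n, ∀ p ∈ Δ, ‖θn n p - θn (n + 1) p‖ ≤ 2 * (1 / 2) ^ n := by
    intro n
    induction n with
    | zero =>
      intro p hp
      have := (hadm 1).2 p hp
      simpa [hθn] using this
    | succ n ih =>
      intro p hp
      have := graphTransform_contraction hlam hR hδR (hadm n).2 (hadm (n + 1)).1 (hadm (n + 1)).2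
        ih p hp
      rw [← hsucc n, ← hsucc (n + 1)] at this
      rw [pow_succ]
      linarith
  have hcau : ∀ p ∈ Δ, ∃ L, Tendsto (fun n => θn n p) atTop (𝓝 L) := fun p hp =>
    cauchySeq_tendsto_of_complete (cauchySeq_of_le_geometric (1 / 2) 2 (by norm_num)
      fun n => by rw [dist_eq_norm]; exact hdist n p hp)
  choose! θ hθ using hcau
  have hest : ∀ n, ∀ p ∈ Δ, ‖θn n p - θ p‖ ≤ 4 * (1 / 2) ^ n := by
    intro n p hp
    have := dist_le_of_le_geometric_of_tendsto (1 / 2) 2 (by norm_num)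
      (fun n => by rw [dist_eq_norm]; exact hdist n p hp) (hθ p hp) n
    rw [dist_eq_norm] at this
    refine this.trans_eq ?_
    ring
  have hgeo : Tendsto (fun n : ℕ => (4 : ℝ) * (1 / 2) ^ n) atTop (𝓝 0) := by
    simpa using (tendsto_pow_atTop_nhds_zero_of_lt_one (r := (1 / 2 : ℝ)) (by norm_num)
      (by norm_num)).const_mul 4
  have hunif : TendstoUniformlyOn θn θ atTop Δ := by
    rw [Metric.tendstoUniformlyOn_iff]
    intro ε hε
    filter_upwards [hgeo.eventually_lt_const hε] with n hn p hp
    rw [dist_comm, dist_eq_norm]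
    exact (hest n p hp).trans_lt hn
  have hdθ : DifferentiableOn ℂ θ Δ := fun p hp =>
    (differentiableAt_of_tendstoUniformlyOn_nhds (hΔo.mem_nhds hp)
      (Eventually.of_forall fun n => (hadm n).1) hunif).differentiableWithinAt
  have hbθ : ∀ p ∈ Δ, ‖θ p‖ ≤ 2 := fun p hp =>
    le_of_tendsto (hθ p hp).norm (Eventually.of_forall fun n => (hadm n).2 p hp)
  have hfix : ∀ p ∈ Δ, graphTransform lam θ p = θ p := by
    intro p hp
    have h1 : ∀ n : ℕ, ‖graphTransform lam θ p - θ p‖ ≤ 4 * (1 / 2) ^ n := by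
      intro n
      have e1 := graphTransform_contraction hlam hR hδR (hadm n).2 hdθ hbθ (hest n) p hp
      rw [← hsucc n] at e1
      have e2 := hest (n + 1) p hp
      have : graphTransform lam θ p - θ p = (θn (n + 1) p - θ p)
        - (θn (n + 1) p - graphTransform lam θ p) := by ring
      rw [this]
      refine (norm_sub_le _ _).trans ?_
      rw [pow_succ] at e2
      linarith
    have := ge_of_tendsto hgeo (Eventually.of_forall h1)
    exact sub_eq_zero.1 (norm_le_zero_iff.1 this)
  have heq : ∀ p ∈ Δ, p.1 ^ 2 * θ p * θ (p.1, p.1 ^ 2 * p.2 * θ p)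
      = (lam + eigenMu lam p.1) * θ p + p.1 * p.2 * θ p ^ 2 + 1 := by
    intro p hp
    have h := hfix p hp
    have hS : lam + eigenMu lam p.1 ≠ 0 := by
      have := lam_add_mu_bound hlam hR hδR hp.1
      intro h
      rw [h, norm_zero] at this
      linarith
    rw [graphTransform, div_eq_iff hS] at h
    linear_combination h
  refine ⟨θ, hdθ, hbθ, heq, fun v hv => ?_, fun a ha => ?_⟩
  · have := heq (0, v) ⟨mem_ball_self hδ, hv⟩
    simp only [eigenMu] at this
    rw [eq_div_iff hlam0]
    simp at this
    linear_combination -this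
  · have hmem : ((a, 0) : ℂ × ℂ) ∈ Δ := ⟨ha, mem_ball_self (by linarith)⟩
    have h := heq (a, 0) hmem
    simp only [mul_zero, zero_mul, eigenMu] at h
    -- At v = 0 the invariance equation is quadratic in θ and factors; the root θ = λ/a² is too
    -- large for the bound |θ| ≤ 2.
    have hfac : (θ (a, 0) + 1 / lam) * (a ^ 2 * θ (a, 0) - lam) = 0 := by
      field_simp
      field_simp at h
      linear_combination h
    rcases mul_eq_zero.1 hfac with h1 | h1
    · linear_combination h1
    · exfalso
      have h2 := hbθ _ hmem
      have h3 : ‖a ^ 2 * θ (a, 0)‖ = 1 := by rw [sub_eq_zero.1 h1, hlam]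
      rw [norm_mul, norm_pow] at h3
      have h4 : ‖a‖ < δ := mem_ball_zero_iff.1 ha
      have : ‖a‖ ^ 2 * ‖θ (a, 0)‖ ≤ (1 / 64) ^ 2 * 2 := by gcongr; linarith
      rw [h3] at this
      norm_num at this

end StableManifold

end SemiParabolicHenon

namespace SemiParabolicHenon

/-! ### Order estimates for one step of the normalization. -/

section BigO

/-- A function holomorphic near `0` agrees with its linear part up to `O(d²)`. -/
theorem isBigO_sub_linear {f : ℂ → ℂ} {c : ℂ} (hf : ∀ᶠ d in 𝓝 0, DifferentiableAt ℂ f d)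
    (h0 : f 0 = 0) (hc : HasDerivAt f c 0) : (fun d => f d - c * d) =O[𝓝 0] fun d => d ^ 2 := by
  have hd : DifferentiableAt ℂ (dslope f 0) 0 := by
    obtain ⟨s, hs, hfs⟩ := eventually_iff_exists_mem.1 hf
    exact (((Complex.differentiableOn_dslope (c := 0) hs).2
      fun x hx => (hfs x hx).differentiableWithinAt).differentiableAt hs)
  have h1 := hd.isBigO_sub
  have h2 : (fun d : ℂ => d * (dslope f 0 d - dslope f 0 0)) =O[𝓝 0] fun d => d * (d - 0) :=
    (isBigO_refl _ _).mul h1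
  refine h2.congr (fun d => ?_) fun d => by ring
  have := sub_smul_dslope f 0 d
  rw [smul_eq_mul, h0, sub_zero, sub_zero] at this
  rw [mul_sub, this, dslope_same, hc.deriv]
  ring

theorem isBigO_pow_of_le {m n : ℕ} (h : m ≤ n) :
    (fun d : ℂ => d ^ n) =O[𝓝 0] fun d => d ^ m := by
  have : (fun d : ℂ => d ^ n) = fun d => d ^ m * d ^ (n - m) := by
    funext d; rw [← pow_add, Nat.add_sub_cancel' h]
  rw [this]
  have h1 : (fun d : ℂ => d ^ (n - m)) =O[𝓝 0] fun _ => (1 : ℂ) :=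
    ((continuous_pow (n - m)).tendsto 0).isBigO_one ℂ
  simpa using (isBigO_refl (fun d : ℂ => d ^ m) (𝓝 0)).mul h1

/-- Each extra factor gains one order, by f^(k+2) - g^(k+2) = f^(k+1)(f - g) + (f^(k+1) - g^(k+1))
g. -/
theorem isBigO_pow_sub_pow {f g : ℂ → ℂ} {m : ℕ} (hf : f =O[𝓝 0] fun d : ℂ => d)
    (hg : g =O[𝓝 0] fun d : ℂ => d) (hfg : (fun d => f d - g d) =O[𝓝 0] fun d => d ^ m) (k : ℕ) :
    (fun d => f d ^ (k + 1) - g d ^ (k + 1)) =O[𝓝 0] fun d => d ^ (m + k) := by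
  induction k with
  | zero => simpa using hfg
  | succ k ih =>
    have h1 : (fun d => f d ^ (k + 1) * (f d - g d)) =O[𝓝 0] fun d => d ^ (m + (k + 1)) :=
      ((hf.pow (k + 1)).mul hfg).congr_right fun d => by ring
    have h2 : (fun d => (f d ^ (k + 1) - g d ^ (k + 1)) * g d) =O[𝓝 0]
        fun d => d ^ (m + (k + 1)) := (ih.mul hg).congr_right fun d => by ring
    exact (h1.add h2).congr_left fun d => by ring

theorem isBigO_id_of_isBigO_sub {f : ℂ → ℂ} {c : ℂ}
    (hf : (fun d => f d - c * d) =O[𝓝 0] fun d => d ^ 2) : f =O[𝓝 0] fun d : ℂ => d := by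
  have h1 : (fun d : ℂ => d ^ 2) =O[𝓝 0] fun d : ℂ => d := by
    simpa using isBigO_pow_of_le (m := 1) (n := 2) (by norm_num)
  have h2 : (fun d : ℂ => c * d) =O[𝓝 0] fun d : ℂ => d := isBigO_const_mul_self c _ _
  exact ((hf.trans h1).add h2).congr_left fun d => by ring

/-- If `f` agrees with `c d` up to `O(d²)` then a truncated sum `∑ ν_k f ^ k` agrees with
`ν₁ c d` up to `O(d²)`. -/
theorem isBigO_sum_sub_linear {x : ℂ → ℂ} {c : ℂ} (ν : ℕ → ℂ) {N : ℕ} (hN : 1 ≤ N)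
    (hx : (fun d => x d - c * d) =O[𝓝 0] fun d => d ^ 2) :
    (fun d => ∑ k ∈ Finset.Icc 1 N, ν k * x d ^ k - ν 1 * c * d) =O[𝓝 0] fun d => d ^ 2 := by
  have hx1 := isBigO_id_of_isBigO_sub hx
  rw [← Finset.insert_Icc_succ_left_eq_Icc hN]
  have h1 : (fun d => ∑ k ∈ Finset.Icc (Order.succ 1) N, ν k * x d ^ k) =O[𝓝 0]
      fun d : ℂ => d ^ 2 := by
    refine IsBigO.fun_sum fun k hk => ?_
    have hk2 : 2 ≤ k := by simpa using (Finset.mem_Icc.1 hk).1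
    exact ((hx1.pow k).trans (isBigO_pow_of_le hk2)).const_mul_left _
  refine (h1.add (hx.const_mul_left (ν 1))).congr_left fun d => ?_
  rw [Finset.sum_insert (by simp)]
  ring

/-- One step of the normalization, for a fixed value of the parameters. -/
theorem normalization_step {x y b₁ : ℂ → ℂ} {ν : ℕ → ℂ} {N : ℕ} {e lam α b bF ν' : ℂ} (hN : 1 ≤ N)
    (hν1 : ν 1 = lam) (hx : (fun d => x d - e * d) =O[𝓝 0] fun d => d ^ 2)
    (hy : (fun d => y d - ∑ k ∈ Finset.Icc 1 N, ν k * x d ^ k - α * d ^ (N + 1)) =O[𝓝 0]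
      fun d => d ^ (N + 2))
    (hb₁ : (fun d => b₁ d - bF) =O[𝓝 0] fun d : ℂ => d)
    (heq : α + (lam ^ (N + 1) * bF - lam * b - ν') * e ^ (N + 1) = 0) :
    (fun d => (y d + b₁ d * y d ^ (N + 1)) - (∑ k ∈ Finset.Icc 1 N, ν k * (x d + b * x d ^ (N + 1)) ^ k
      + ν' * (x d + b * x d ^ (N + 1)) ^ (N + 1))) =O[𝓝 0] fun d => d ^ (N + 2) := by
  have hx1 := isBigO_id_of_isBigO_sub hx
  have he1 : (fun d : ℂ => e * d) =O[𝓝 0] fun d : ℂ => d := isBigO_const_mul_self e _ _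
  have hxN : (fun d => x d ^ (N + 1)) =O[𝓝 0] fun d => d ^ (N + 1) := hx1.pow _
  -- the transformed coordinate
  have hz : (fun d => (x d + b * x d ^ (N + 1)) - x d) =O[𝓝 0] fun d => d ^ (N + 1) :=
    (hxN.const_mul_left b).congr_left fun d => by ring
  have hz2 : (fun d => (x d + b * x d ^ (N + 1)) - e * d) =O[𝓝 0] fun d => d ^ 2 :=
    ((hz.trans (isBigO_pow_of_le (by omega))).add hx).congr_left fun d => by ring
  have hz1 := isBigO_id_of_isBigO_sub hz2
  -- `y` is `lam * e * d + O(d²)`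
  have hylin : (fun d => y d - lam * e * d) =O[𝓝 0] fun d => d ^ 2 := by
    have h1 := isBigO_sum_sub_linear ν hN hx
    have h2 : (fun d : ℂ => α * d ^ (N + 1)) =O[𝓝 0] fun d => d ^ 2 :=
      (isBigO_pow_of_le (by omega)).const_mul_left α
    refine (((hy.trans (isBigO_pow_of_le (by omega))).add h2).add h1).congr_left fun d => ?_
    rw [hν1]
    ring
  have hy1 := isBigO_id_of_isBigO_sub hylin
  have hle1 : (fun d : ℂ => lam * e * d) =O[𝓝 0] fun d : ℂ => d := isBigO_const_mul_self _ _ _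
  have hyN := isBigO_pow_sub_pow hy1 hle1 hylin N
  -- The image is already multiplied by a power of order N+1, so the correction coefficient at the
  -- image point may be frozen at its value on {d = 0}.
  have A2 : (fun d => b₁ d * y d ^ (N + 1) - bF * (lam * e * d) ^ (N + 1)) =O[𝓝 0]
      fun d => d ^ (N + 2) := by
    have h1 : (fun d => (b₁ d - bF) * y d ^ (N + 1)) =O[𝓝 0] fun d => d ^ (N + 2) :=
      (hb₁.mul (hy1.pow (N + 1))).congr_right fun d => by ring
    have h2 : (fun d => bF * (y d ^ (N + 1) - (lam * e * d) ^ (N + 1))) =O[𝓝 0]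
        fun d => d ^ (N + 2) := (hyN.const_mul_left bF).congr_right fun d => by ring
    exact (h1.add h2).congr_left fun d => by ring
  have hxpow : (fun d => x d ^ (N + 1) - (e * d) ^ (N + 1)) =O[𝓝 0] fun d => d ^ (N + 2) :=
    (isBigO_pow_sub_pow hx1 he1 hx N).congr_right fun d => by ring
  -- Only the linear term feels the coordinate change at order N+1: for k ≥ 2 the change in the k-th
  -- power has order at least N+2.
  have A3 : (fun d => ∑ k ∈ Finset.Icc 1 N, ν k * ((x d + b * x d ^ (N + 1)) ^ k - x d ^ k)
      - lam * b * (e * d) ^ (N + 1)) =O[𝓝 0] fun d => d ^ (N + 2) := by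
    rw [← Finset.insert_Icc_succ_left_eq_Icc hN]
    have h1 : (fun d => ∑ k ∈ Finset.Icc (Order.succ 1) N,
        ν k * ((x d + b * x d ^ (N + 1)) ^ k - x d ^ k)) =O[𝓝 0] fun d : ℂ => d ^ (N + 2) := by
      refine IsBigO.fun_sum fun k hk => ?_
      have hk2 : 2 ≤ k := by simpa using (Finset.mem_Icc.1 hk).1
      obtain ⟨j, rfl⟩ : ∃ j, k = j + 1 := ⟨k - 1, by omega⟩
      exact ((isBigO_pow_sub_pow hz1 hx1 hz j).trans
        (isBigO_pow_of_le (by omega))).const_mul_left _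
    refine (h1.add (hxpow.const_mul_left (lam * b))).congr_left fun d => ?_
    rw [Finset.sum_insert (by simp), hν1]
    ring
  have A4 : (fun d => (x d + b * x d ^ (N + 1)) ^ (N + 1) - (e * d) ^ (N + 1)) =O[𝓝 0]
      fun d => d ^ (N + 2) :=
    (isBigO_pow_sub_pow hz1 he1 hz2 N).congr_right fun d => by ring
  -- What is left at order N+1 is the homological expression in `heq`, times d^(N+1).
  refine (((hy.add A2).sub A3).sub (A4.const_mul_left ν')).congr_left fun d => ?_
  have hα : α = -(lam ^ (N + 1) * bF - lam * b - ν') * e ^ (N + 1) := by linear_combination heq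
  have hs : ∑ k ∈ Finset.Icc 1 N, ν k * ((x d + b * x d ^ (N + 1)) ^ k - x d ^ k)
      = ∑ k ∈ Finset.Icc 1 N, ν k * (x d + b * x d ^ (N + 1)) ^ k
        - ∑ k ∈ Finset.Icc 1 N, ν k * x d ^ k := by
    rw [← Finset.sum_sub_distrib]
    exact Finset.sum_congr rfl fun k _ => by ring
  rw [hs, hα, mul_pow, mul_pow, mul_pow]
  ring

end BigO

/-! ### Normal forms of skew systems to any finite order. -/

section Normalization

/-- A holomorphic family of local skew products `(d, (a, v)) ↦ (W, (a, V))` near an invariant fibred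
contraction `{d = 0}`, with dynamics `F` on it; `W` is the coordinate `base` of the image, and `u`
linearizes the multiplier in the transverse direction. -/
structure SkewSystem (lam : ℂ) (δ R ε : ℝ) (β₀ : ℂ) (base : ℂ → ℂ) (W V : ℂ × (ℂ × ℂ) → ℂ)
    (F u : ℂ × ℂ → ℂ) : Prop where
  δ_pos : 0 < δ
  R_pos : 0 < R
  ε_pos : 0 < ε
  base_diff : DifferentiableOn ℂ base (ball 0 ε)
  base_zero : base 0 = 0
  base_deriv : HasDerivAt base β₀ 0
  β₀_ne : β₀ ≠ 0
  W_diff : DifferentiableOn ℂ W (ball 0 ε ×ˢ (ball (0 : ℂ) δ ×ˢ ball (0 : ℂ) R))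
  W_zero : ∀ p ∈ ball (0 : ℂ) δ ×ˢ ball (0 : ℂ) R, W (0, p) = 0
  W_deriv : ∀ p ∈ ball (0 : ℂ) δ ×ˢ ball (0 : ℂ) R, ∃ w, HasDerivAt (fun d => W (d, p)) w 0 ∧
    u (p.1, F p) * w = lam * u p * β₀
  V_diff : DifferentiableOn ℂ V (ball 0 ε ×ˢ (ball (0 : ℂ) δ ×ˢ ball (0 : ℂ) R))
  V_lt : ∀ x ∈ ball (0 : ℂ) ε ×ˢ (ball (0 : ℂ) δ ×ˢ ball (0 : ℂ) R), ‖V x‖ < R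
  V_zero : ∀ p ∈ ball (0 : ℂ) δ ×ˢ ball (0 : ℂ) R, V (0, p) = F p
  F_le : ∀ p ∈ ball (0 : ℂ) δ ×ˢ ball (0 : ℂ) R, ‖F p‖ ≤ ‖p.2‖ / 2
  u_diff : DifferentiableOn ℂ u (ball (0 : ℂ) δ ×ˢ ball (0 : ℂ) R)
  u_ne : ∀ p, u p ≠ 0

/-- `P(base d, a, v)` conjugates the skew system to `∑_{k ≤ N} ν_k(a) X ^ k` up to
`O(d ^ (N + 1))`, where only resonant `ν_k` occur. -/
structure IsNormalizing (lam : ℂ) (q : ℕ) (δ R : ℝ) (base : ℂ → ℂ) (W V : ℂ × (ℂ × ℂ) → ℂ)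
    (u : ℂ × ℂ → ℂ) (N : ℕ) (P : ℂ × (ℂ × ℂ) → ℂ) (ν : ℕ → ℂ → ℂ) : Prop where
  P_diff : DifferentiableOn ℂ P (univ ×ˢ (ball (0 : ℂ) δ ×ˢ ball (0 : ℂ) R))
  P_zero : ∀ p ∈ ball (0 : ℂ) δ ×ˢ ball (0 : ℂ) R, P (0, p) = 0
  P_deriv : ∀ p ∈ ball (0 : ℂ) δ ×ˢ ball (0 : ℂ) R, HasDerivAt (fun w => P (w, p)) (u p) 0
  ν_diff : ∀ k, DifferentiableOn ℂ (ν k) (ball (0 : ℂ) δ)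
  ν_one : ∀ a, ν 1 a = lam
  ν_eq_zero : ∀ k, 1 ≤ k → ¬ q ∣ k - 1 → ∀ a, ν k a = 0
  conj : ∀ p ∈ ball (0 : ℂ) δ ×ˢ ball (0 : ℂ) R,
    (fun d => P (W (d, p), (p.1, V (d, p)))
      - ∑ k ∈ Finset.Icc 1 N, ν k p.1 * P (base d, p) ^ k) =O[𝓝 0] fun d => d ^ (N + 1)

namespace SkewSystem

variable {lam : ℂ} {δ R ε : ℝ} {β₀ : ℂ} {base : ℂ → ℂ} {W V : ℂ × (ℂ × ℂ) → ℂ} {F u : ℂ × ℂ → ℂ}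

theorem differentiableOn_F (S : SkewSystem lam δ R ε β₀ base W V F u) :
    DifferentiableOn ℂ F (ball (0 : ℂ) δ ×ˢ ball (0 : ℂ) R) := by
  refine (S.V_diff.comp (f := fun p : ℂ × ℂ => ((0 : ℂ), p)) (by fun_prop)
    fun p hp => ⟨mem_ball_self S.ε_pos, hp⟩).congr fun p hp => (S.V_zero p hp).symm

theorem W_slice (S : SkewSystem lam δ R ε β₀ base W V F u) {p : ℂ × ℂ}
    (hp : p ∈ ball (0 : ℂ) δ ×ˢ ball (0 : ℂ) R) :
    DifferentiableOn ℂ (fun d => W (d, p)) (ball 0 ε) :=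
  S.W_diff.comp (f := fun d : ℂ => (d, p)) (by fun_prop) fun _ hd => ⟨hd, hp⟩

theorem V_slice (S : SkewSystem lam δ R ε β₀ base W V F u) {p : ℂ × ℂ}
    (hp : p ∈ ball (0 : ℂ) δ ×ˢ ball (0 : ℂ) R) :
    DifferentiableOn ℂ (fun d => V (d, p)) (ball 0 ε) :=
  S.V_diff.comp (f := fun d : ℂ => (d, p)) (by fun_prop) fun _ hd => ⟨hd, hp⟩

theorem mapsTo_V (S : SkewSystem lam δ R ε β₀ base W V F u) :
    MapsTo (fun x : ℂ × (ℂ × ℂ) => (x.2.1, V x)) (ball 0 ε ×ˢ (ball (0 : ℂ) δ ×ˢ ball (0 : ℂ) R))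
      (ball (0 : ℂ) δ ×ˢ ball (0 : ℂ) R) :=
  fun x hx => ⟨hx.2.1, mem_ball_zero_iff.2 (S.V_lt x hx)⟩

theorem eventually_mem_ball (S : SkewSystem lam δ R ε β₀ base W V F u) :
    ∀ᶠ d in 𝓝 (0 : ℂ), d ∈ ball (0 : ℂ) ε := ball_mem_nhds _ S.ε_pos

variable {q N : ℕ} {P : ℂ × (ℂ × ℂ) → ℂ} {ν : ℕ → ℂ → ℂ}

/-- The coordinate `P` along a fibre is `u β₀ d + O(d²)`. -/
theorem fibre_linear (S : SkewSystem lam δ R ε β₀ base W V F u)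
    (hP : IsNormalizing lam q δ R base W V u N P ν) {p : ℂ × ℂ}
    (hp : p ∈ ball (0 : ℂ) δ ×ˢ ball (0 : ℂ) R) :
    (fun d => P (base d, p) - u p * β₀ * d) =O[𝓝 0] fun d => d ^ 2 := by
  refine isBigO_sub_linear (f := fun d => P (base d, p)) ?_ ?_ ?_
  · filter_upwards [S.eventually_mem_ball] with d hd
    have h : DifferentiableOn ℂ (fun d => P (base d, p)) (ball 0 ε) :=
      hP.P_diff.comp (f := fun d : ℂ => (base d, p))
        (S.base_diff.prodMk (differentiableOn_const _)) fun _ _ => ⟨mem_univ _, hp⟩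
    exact h.differentiableAt (isOpen_ball.mem_nhds hd)
  · simp only [S.base_zero, hP.P_zero p hp]
  · have h : HasDerivAt (fun w => P (w, p)) (u p) (base 0) := by
      rw [S.base_zero]; exact hP.P_deriv p hp
    exact h.comp (0 : ℂ) S.base_deriv

theorem differentiableOn_image (S : SkewSystem lam δ R ε β₀ base W V F u)
    (hP : DifferentiableOn ℂ P (univ ×ˢ (ball (0 : ℂ) δ ×ˢ ball (0 : ℂ) R))) :
    DifferentiableOn ℂ (fun x : ℂ × (ℂ × ℂ) => P (W x, (x.2.1, V x)))
      (ball 0 ε ×ˢ (ball (0 : ℂ) δ ×ˢ ball (0 : ℂ) R)) :=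
  hP.comp (f := fun x : ℂ × (ℂ × ℂ) => (W x, (x.2.1, V x)))
    (S.W_diff.prodMk (DifferentiableOn.prodMk (by fun_prop) S.V_diff))
    fun _ hx => ⟨mem_univ _, S.mapsTo_V hx⟩

theorem differentiableOn_base (S : SkewSystem lam δ R ε β₀ base W V F u)
    (hP : DifferentiableOn ℂ P (univ ×ˢ (ball (0 : ℂ) δ ×ˢ ball (0 : ℂ) R))) :
    DifferentiableOn ℂ (fun x : ℂ × (ℂ × ℂ) => P (base x.1, x.2))
      (ball 0 ε ×ˢ (ball (0 : ℂ) δ ×ˢ ball (0 : ℂ) R)) :=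
  hP.comp (f := fun x : ℂ × (ℂ × ℂ) => (base x.1, x.2))
    ((S.base_diff.comp differentiableOn_fst fun _ hx => hx.1).prodMk differentiableOn_snd)
    fun _ hx => ⟨mem_univ _, hx.2⟩

/-- The next coefficient of a conjugacy depends holomorphically on the parameters. -/
theorem exists_next_coeff (S : SkewSystem lam δ R ε β₀ base W V F u)
    (hP : IsNormalizing lam q δ R base W V u N P ν) :
    ∃ α : ℂ × ℂ → ℂ, DifferentiableOn ℂ α (ball (0 : ℂ) δ ×ˢ ball (0 : ℂ) R) ∧
      ∀ p ∈ ball (0 : ℂ) δ ×ˢ ball (0 : ℂ) R,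
        (fun d => P (W (d, p), (p.1, V (d, p))) - ∑ k ∈ Finset.Icc 1 N, ν k p.1 * P (base d, p) ^ k
          - α p * d ^ (N + 1)) =O[𝓝 0] fun d => d ^ (N + 2) := by
  set Δ := ball (0 : ℂ) δ ×ˢ ball (0 : ℂ) R with hΔ
  have hΩ : IsOpen (ball (0 : ℂ) ε ×ˢ Δ) := isOpen_ball.prod (isOpen_ball.prod isOpen_ball)
  have hGd : DifferentiableOn ℂ (fun x : ℂ × (ℂ × ℂ) => P (W x, (x.2.1, V x))
      - ∑ k ∈ Finset.Icc 1 N, ν k x.2.1 * P (base x.1, x.2) ^ k) (ball (0 : ℂ) ε ×ˢ Δ) := by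
    refine (S.differentiableOn_image hP.P_diff).sub (DifferentiableOn.fun_sum fun k _ => ?_)
    refine DifferentiableOn.mul ?_ ((S.differentiableOn_base hP.P_diff).pow k)
    exact (hP.ν_diff k).comp (f := fun x : ℂ × (ℂ × ℂ) => x.2.1) (by fun_prop) fun x hx => hx.2.1
  obtain ⟨Q, hQ, hQe⟩ := exists_eq_pow_mul hΩ hGd (N + 1) fun p hp => hP.conj p hp.2
  refine ⟨fun p => Q (0, p), hQ.comp (f := fun p : ℂ × ℂ => ((0 : ℂ), p)) (by fun_prop)
    fun p hp => ⟨mem_ball_self S.ε_pos, hp⟩, fun p hp => ?_⟩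
  have hQp : DifferentiableAt ℂ (fun d => Q (d, p)) 0 :=
    (hQ.comp (f := fun d : ℂ => (d, p)) (by fun_prop) fun d hd => ⟨hd, hp⟩
      : DifferentiableOn ℂ (fun d => Q (d, p)) (ball 0 ε)).differentiableAt
      (ball_mem_nhds _ S.ε_pos)
  have h1 := (isBigO_refl (fun d : ℂ => d ^ (N + 1)) (𝓝 0)).mul hQp.isBigO_sub
  refine h1.congr' ?_ ?_
  · filter_upwards [S.eventually_mem_ball] with d hd
    have := hQe (d, p) ⟨hd, hp⟩
    simp only at this
    rw [this]
    ring
  · filter_upwards with d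
    ring

/-- The starting coordinate is `u` times the base coordinate. The relation in `W_deriv` makes the
first derivative of the conjugacy error vanish, which leaves O(d²). -/
theorem isNormalizing_one (S : SkewSystem lam δ R ε β₀ base W V F u) (q : ℕ) :
    IsNormalizing lam q δ R base W V u 1 (fun x => u x.2 * x.1)
      (fun k _ => if k = 1 then lam else 0) where
  P_diff := DifferentiableOn.mul (S.u_diff.comp (f := fun x : ℂ × (ℂ × ℂ) => x.2) (by fun_prop)
    fun x hx => hx.2) (by fun_prop)
  P_zero p _ := by simp
  P_deriv p _ := by simpa using (hasDerivAt_id (0 : ℂ)).const_mul (u p)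
  ν_diff k := differentiableOn_const _
  ν_one a := by simp
  ν_eq_zero k hk hq a := by
    have : k ≠ 1 := by rintro rfl; simp at hq
    simp [this]
  conj p hp := by
    obtain ⟨w, hw, hwe⟩ := S.W_deriv p hp
    have h0 : (0 : ℂ) ∈ ball (0 : ℂ) ε := mem_ball_self S.ε_pos
    have hVp : HasDerivAt (fun d => V (d, p)) (deriv (fun d => V (d, p)) 0) 0 :=
      ((S.V_slice hp).differentiableAt (isOpen_ball.mem_nhds h0)).hasDerivAt
    have hud : DifferentiableOn ℂ (fun d => u (p.1, V (d, p))) (ball 0 ε) :=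
      S.u_diff.comp (f := fun d : ℂ => (p.1, V (d, p)))
        ((differentiableOn_const _).prodMk (S.V_slice hp)) fun d hd =>
          S.mapsTo_V (x := (d, p)) ⟨hd, hp⟩
    have hud0 := (hud.differentiableAt (isOpen_ball.mem_nhds h0)).hasDerivAt
    have hder := (hud0.mul hw).sub ((S.base_deriv.const_mul (u p)).const_mul lam)
    have hres := isBigO_sub_linear (f := fun d => u (p.1, V (d, p)) * W (d, p)
      - lam * (u p * base d)) (c := 0) ?_ ?_ ?_
    · simpa using hres
    · filter_upwards [S.eventually_mem_ball] with d hd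
      have hdn := isOpen_ball.mem_nhds hd
      have h1 := hud.differentiableAt hdn
      have h2 := (S.W_slice hp).differentiableAt hdn
      have h3 := S.base_diff.differentiableAt hdn
      exact (h1.mul h2).sub ((h3.const_mul _).const_mul _)
    · simp [S.W_zero p hp, S.base_zero]
    · refine hder.congr_deriv ?_
      rw [S.W_zero p hp, S.V_zero p hp, hwe]
      ring

/-- Induction step of the normalization. The last clause tracks the fibres over `a = 0` when the
system is already normalized there. -/
theorem isNormalizing_succ (S : SkewSystem lam δ R ε β₀ base W V F u) (hlam : ‖lam‖ = 1)
    (hq : ∀ n, lam ^ n = 1 ↔ q ∣ n) (hN : 1 ≤ N) (hP : IsNormalizing lam q δ R base W V u N P ν) :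
    ∃ P' ν', IsNormalizing lam q δ R base W V u (N + 1) P' ν' ∧ (∀ k ≤ N, ν' k = ν k) ∧
      ∀ c : ℂ, (∀ v ∈ ball (0 : ℂ) R, u (0, v) = 1) → (¬ q ∣ N → c = 0) →
        (∀ v ∈ ball (0 : ℂ) R, (fun d => P (W (d, (0, v)), (0, V (d, (0, v))))
          - ∑ k ∈ Finset.Icc 1 N, ν k 0 * P (base d, (0, v)) ^ k - c * (base d) ^ (N + 1))
            =O[𝓝 0] fun d => d ^ (N + 2)) →
        ν' (N + 1) 0 = c ∧ ∀ w, ∀ v ∈ ball (0 : ℂ) R, P' (w, (0, v)) = P (w, (0, v)) := by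
  set Δ := ball (0 : ℂ) δ ×ˢ ball (0 : ℂ) R with hΔ
  have hlam0 : lam ≠ 0 := by rintro rfl; simp at hlam
  have h0R : (0 : ℂ) ∈ ball (0 : ℂ) R := mem_ball_self S.R_pos
  have h0δ : (0 : ℂ) ∈ ball (0 : ℂ) δ := mem_ball_self S.δ_pos
  obtain ⟨α, hα, hαO⟩ := S.exists_next_coeff hP
  -- The next coefficient measured in powers of the coordinate `P` instead of d; to first order `P`
  -- is u β₀ d.
  set γ : ℂ × ℂ → ℂ := fun p => α p * ((u p * β₀) ^ (N + 1))⁻¹ with hγ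
  have hune : ∀ p, (u p * β₀) ^ (N + 1) ≠ 0 := fun p =>
    pow_ne_zero _ (mul_ne_zero (S.u_ne p) S.β₀_ne)
  have hγd : DifferentiableOn ℂ γ Δ :=
    hα.mul (((S.u_diff.mul_const _).pow _).inv fun p _ => hune p)
  have hγ0d : DifferentiableOn ℂ (fun a : ℂ => γ (a, 0)) (ball 0 δ) :=
    hγd.comp (f := fun a : ℂ => (a, (0 : ℂ))) (by fun_prop) fun a ha => ⟨ha, h0R⟩
  -- This part of the correction replaces γ(a, v) by γ(a, 0). The factor λ^N comes from comparing
  -- λ^(N+1) b∘F with λ b, and the right-hand side vanishes at v = 0 as the cohomological equation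
  -- requires.
  obtain ⟨b, hb, hbe, hb0, hb1⟩ := exists_cohomological_solution (F := F)
    (β := fun p => (γ p - γ (p.1, 0)) * lam⁻¹)
    (κ := lam ^ N) S.δ_pos S.R_pos (by rw [norm_pow, hlam, one_pow]) S.differentiableOn_F S.F_le
    ((hγd.sub (hγ0d.comp (f := fun p : ℂ × ℂ => p.1) (by fun_prop) fun p hp => hp.1)).mul_const _)
    (fun a _ => by simp)
  -- constant part of the correction and the new coefficient
  obtain ⟨κ₀, ν₁, hκd, hνd, hκν, hνz, hκz⟩ : ∃ κ₀ ν₁ : ℂ → ℂ, DifferentiableOn ℂ κ₀ (ball 0 δ) ∧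
      DifferentiableOn ℂ ν₁ (ball 0 δ) ∧
      (∀ a, ν₁ a = γ (a, 0) + (lam ^ (N + 1) - lam) * κ₀ a) ∧
      (¬ q ∣ N → ∀ a, ν₁ a = 0) ∧ ((¬ q ∣ N → γ (0, 0) = 0) → κ₀ 0 = 0) := by
    -- In a resonant degree γ(a, 0) is kept as the new coefficient. Otherwise λ^(N+1) ≠ λ and a
    -- correction depending on `a` alone removes it.
    by_cases hdvd : q ∣ N
    · exact ⟨fun _ => 0, fun a => γ (a, 0), differentiableOn_const _, hγ0d, fun a => by simp,
        fun h => absurd hdvd h, fun _ => rfl⟩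
    · have hne : lam ^ (N + 1) - lam ≠ 0 := by
        intro h
        apply hdvd
        rw [← hq]
        have : lam * (lam ^ N - 1) = 0 := by rw [← h]; ring
        rcases mul_eq_zero.1 this with h | h
        · exact absurd h hlam0
        · exact sub_eq_zero.1 h
      refine ⟨fun a => -γ (a, 0) * (lam ^ (N + 1) - lam)⁻¹, fun _ => 0, hγ0d.neg.mul_const _,
        differentiableOn_const _, fun a => ?_, fun _ _ => rfl, fun h => ?_⟩
      · field_simp
        ring
      · simp [h hdvd]
  set B : ℂ × ℂ → ℂ := fun p => b p + κ₀ p.1 with hB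
  have hBd : DifferentiableOn ℂ B Δ :=
    hb.add (hκd.comp (f := fun p : ℂ × ℂ => p.1) (by fun_prop) fun p hp => hp.1)
  refine ⟨fun x => P x + B x.2 * P x ^ (N + 1), fun k => if k = N + 1 then ν₁ else ν k,
    ?_, fun k hk => ?_, ?_⟩
  · constructor
    · refine hP.P_diff.add (DifferentiableOn.mul ?_ (hP.P_diff.pow _))
      exact hBd.comp (f := fun x : ℂ × (ℂ × ℂ) => x.2) (by fun_prop) fun x hx => hx.2
    · intro p hp
      simp [hP.P_zero p hp]
    · intro p hp
      have h1 := (hP.P_deriv p hp)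
      have h2 := h1.add ((h1.pow (N + 1)).const_mul (B p))
      refine h2.congr_deriv ?_
      simp [hP.P_zero p hp, show N ≠ 0 by omega]
    · intro k
      by_cases hk : k = N + 1
      · simpa [hk] using hνd
      · simpa [hk] using hP.ν_diff k
    · intro a
      rw [if_neg (by omega)]
      exact hP.ν_one a
    · intro k hk1 hkq a
      by_cases hk : k = N + 1
      · subst hk
        simpa using hνz (by simpa using hkq) a
      · simpa [hk] using hP.ν_eq_zero k hk1 hkq a
    · intro p hp
      have hVd : (fun d => B (p.1, V (d, p)) - B (p.1, F p)) =O[𝓝 0] fun d : ℂ => d := by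
        have h : DifferentiableOn ℂ (fun d => B (p.1, V (d, p))) (ball 0 ε) :=
          hBd.comp (f := fun d : ℂ => (p.1, V (d, p)))
            ((differentiableOn_const _).prodMk (S.V_slice hp)) fun d hd =>
          S.mapsTo_V (x := (d, p)) ⟨hd, hp⟩
        have h2 := (h.differentiableAt (ball_mem_nhds _ S.ε_pos)).isBigO_sub
        simpa [S.V_zero p hp] using h2
      have hstep := normalization_step (b := B p) (ν' := ν₁ p.1) hN (hP.ν_one p.1)
        (S.fibre_linear hP hp) (hαO p hp) hVd ?_
      · refine hstep.congr_left fun d => ?_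
        rw [Finset.sum_Icc_succ_top (by omega)]
        congr 1
        simp only [if_true]
        congr 1
        refine Finset.sum_congr rfl fun k hk => ?_
        have : k ≠ N + 1 := by have := (Finset.mem_Icc.1 hk).2; omega
        simp [this]
      · have h1 := hbe p hp
        have h2 := hκν p.1
        have h3 : α p = γ p * (u p * β₀) ^ (N + 1) := by
          simp only [hγ]
          have := hune p
          field_simp
        have h4 : γ p + (lam ^ (N + 1) * B (p.1, F p) - lam * B p - ν₁ p.1) = 0 := by
          simp only [hB]
          have h5 : lam * (b p - lam ^ N * b (p.1, F p)) = γ p - γ (p.1, 0) := by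
            rw [h1]; field_simp
          rw [h2]
          linear_combination -h5
        rw [h3]
        linear_combination (u p * β₀) ^ (N + 1) * h4
  · have : k ≠ N + 1 := by omega
    simp [this]
  · intro c hu1 hc hO
    have hbase : (fun d => base d - β₀ * d) =O[𝓝 0] fun d => d ^ 2 := by
      refine isBigO_sub_linear ?_ S.base_zero S.base_deriv
      filter_upwards [S.eventually_mem_ball] with d hd
      exact S.base_diff.differentiableAt (isOpen_ball.mem_nhds hd)
    have hbpow := isBigO_pow_sub_pow (isBigO_id_of_isBigO_sub hbase)
      (isBigO_const_mul_self β₀ _ _) hbase N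
    -- Over a = 0 the coefficient is already the constant c, by uniqueness of leading coefficients;
    -- hence both parts of the correction vanish there and `P` is unchanged.
    have hγc : ∀ v ∈ ball (0 : ℂ) R, γ (0, v) = c := by
      intro v hv
      have h1 := hO v hv
      have h2 := hαO (0, v) ⟨h0δ, hv⟩
      have h3 : (fun d : ℂ => (α (0, v) - c * β₀ ^ (N + 1)) * d ^ (N + 1)) =O[𝓝 0]
          fun d => d ^ (N + 2) := by
        have h4 : (fun d => c * (base d ^ (N + 1) - (β₀ * d) ^ (N + 1))) =O[𝓝 0]
          fun d : ℂ => d ^ (N + 2) := (hbpow.const_mul_left c).congr_right fun d => by ring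
        refine ((h1.sub h2).add h4).congr_left fun d => ?_
        simp only
        ring
      have h5 : α (0, v) - c * β₀ ^ (N + 1) = 0 := by
        by_contra hne
        have h6 : (fun d : ℂ => d ^ (N + 1)) =O[𝓝 0] fun d => d ^ (N + 2) := by
          refine (h3.const_mul_left (α (0, v) - c * β₀ ^ (N + 1))⁻¹).congr_left fun d => ?_
          field_simp
        have h7 := iteratedDeriv_eq_zero_of_isBigO (f := fun d : ℂ => d ^ (N + 1))
          (by fun_prop) h6 (i := N + 1) (by omega)
        rw [iteratedDeriv_eq_iterate, iter_deriv_pow] at h7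
        simp [Finset.prod_eq_zero_iff] at h7
        obtain ⟨x, hx, h8⟩ := h7
        have h9 : ((N + 1 : ℕ) : ℂ) = x := by push_cast; linear_combination h8
        have : N + 1 = x := by exact_mod_cast h9
        omega
      simp only [hγ, hu1 v hv, one_mul]
      rw [sub_eq_zero.1 h5]
      have := pow_ne_zero (N + 1) S.β₀_ne
      field_simp
    have hκ0 : κ₀ 0 = 0 := hκz fun hnd => by rw [hγc 0 h0R, hc hnd]
    refine ⟨?_, fun w v hv => ?_⟩
    · simp [hκν, hκ0, hγc 0 h0R]
    · have : b (0, v) = 0 := hb1 (fun v hv => by simp [hγc v hv, hγc 0 h0R]) v hv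
      simp [hB, this, hκ0]

/-- Normalization up to any order. -/
theorem exists_isNormalizing (S : SkewSystem lam δ R ε β₀ base W V F u) (hlam : ‖lam‖ = 1)
    (hq : ∀ n, lam ^ n = 1 ↔ q ∣ n) (c : ℕ → ℂ) (hN : 1 ≤ N) :
    ∃ P ν, IsNormalizing lam q δ R base W V u N P ν ∧
      ((∀ v ∈ ball (0 : ℂ) R, u (0, v) = 1) → c 1 = lam → (∀ k, 1 ≤ k → ¬ q ∣ k - 1 → c k = 0) →
        (∀ M ≤ N, ∀ v ∈ ball (0 : ℂ) R, (fun d => W (d, (0, v))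
          - ∑ k ∈ Finset.Icc 1 M, c k * (base d) ^ k) =O[𝓝 0] fun d => d ^ (M + 1)) →
        (∀ k, 1 ≤ k → k ≤ N → ν k 0 = c k) ∧
          ∀ w, ∀ v ∈ ball (0 : ℂ) R, P (w, (0, v)) = w) := by
  induction N, hN using Nat.le_induction with
  | base =>
    refine ⟨_, _, S.isNormalizing_one q, fun hu hc1 _ _ => ⟨fun k hk hk1 => ?_, fun w v hv => ?_⟩⟩
    · obtain rfl : k = 1 := by omega
      simp [hc1]
    · simp [hu v hv]
  | succ N hN ih =>
    obtain ⟨P, ν, hP, h0⟩ := ih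
    obtain ⟨P', ν', hP', hνν', h0'⟩ := S.isNormalizing_succ hlam hq hN hP
    refine ⟨P', ν', hP', fun hu hc1 hcz hO => ?_⟩
    obtain ⟨hνc, hPw⟩ := h0 hu hc1 hcz fun M hM => hO M (by omega)
    have hnext : ∀ v ∈ ball (0 : ℂ) R, (fun d => P (W (d, (0, v)), (0, V (d, (0, v))))
        - ∑ k ∈ Finset.Icc 1 N, ν k 0 * P (base d, (0, v)) ^ k - c (N + 1) * (base d) ^ (N + 1))
          =O[𝓝 0] fun d => d ^ (N + 2) := by
      intro v hv
      refine (hO (N + 1) le_rfl v hv).congr' ?_ EventuallyEq.rfl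
      filter_upwards [S.eventually_mem_ball] with d hd
      have hVm : V (d, (0, v)) ∈ ball (0 : ℂ) R :=
        (S.mapsTo_V (x := (d, (0, v))) ⟨hd, mem_ball_self S.δ_pos, hv⟩).2
      rw [hPw _ _ hVm, hPw _ _ hv, Finset.sum_Icc_succ_top (by omega), sub_sub]
      congr 2
      refine Finset.sum_congr rfl fun k hk => ?_
      rw [hνc k (Finset.mem_Icc.1 hk).1 (Finset.mem_Icc.1 hk).2]
    obtain ⟨h1, h2⟩ := h0' (c (N + 1)) hu (fun h => hcz _ (by omega) (by simpa using h)) hnext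
    refine ⟨fun k hk hkN => ?_, fun w v hv => by rw [h2 w v hv, hPw w v hv]⟩
    rcases Nat.lt_or_ge k (N + 1) with h | h
    · rw [hνν' k (by omega), hνc k hk (by omega)]
    · obtain rfl : k = N + 1 := by omega
      exact h1

end SkewSystem

end Normalization

end SemiParabolicHenon

namespace SemiParabolicHenon

/-! ### Attracting petals of a parabolic point and the critical orbit. -/

section Fatou

/-- The polynomial `λ d + d²`, which is `p` in the coordinate `d = x - q₀`. -/
def quad (lam d : ℂ) : ℂ := lam * d + d ^ 2

/-- A nonvanishing holomorphic function on a disk has a holomorphic square root. -/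
theorem exists_sqrt_on_ball {g : ℂ → ℂ} {c : ℂ} {ρ : ℝ} (hg : DifferentiableOn ℂ g (ball c ρ))
    (h0 : ∀ z ∈ ball c ρ, g z ≠ 0) :
    ∃ s : ℂ → ℂ, DifferentiableOn ℂ s (ball c ρ) ∧ ∀ z ∈ ball c ρ, s z ^ 2 = g z := by
  rcases le_or_gt ρ 0 with hρ | hρ
  · exact ⟨g, hg, by simp [ball_eq_empty.2 hρ]⟩
  have hg' : DifferentiableOn ℂ (deriv g) (ball c ρ) := hg.deriv isOpen_ball
  -- G is a logarithm of g up to a constant: g · exp(-G) has zero derivative.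
  obtain ⟨G, hG⟩ := (hg'.div hg h0).isExactOn_ball
  have hGd : DifferentiableOn ℂ G (ball c ρ) := fun z hz =>
    (hG z hz).differentiableAt.differentiableWithinAt
  have hconst : ∀ z ∈ ball c ρ, g z * Complex.exp (-G z) = g c * Complex.exp (-G c) := by
    intro z hz
    refine (convex_ball c ρ).is_const_of_fderivWithin_eq_zero (𝕜 := ℂ)
      (f := fun z => g z * Complex.exp (-G z)) (hg.mul hGd.neg.cexp) (fun x hx => ?_) hz
      (mem_ball_self hρ)
    rw [fderivWithin_of_isOpen isOpen_ball hx]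
    have h1 := (hg.differentiableAt (isOpen_ball.mem_nhds hx)).hasDerivAt
    have h2 := h1.mul ((hG x hx).neg.cexp)
    have h3 : HasDerivAt (fun z => g z * Complex.exp (-G z)) 0 x := by
      refine h2.congr_deriv ?_
      have := h0 x hx
      simp only [Pi.div_apply, Pi.neg_apply]
      field_simp
      ring
    ext
    simpa using h3.deriv
  obtain ⟨b, hb⟩ := IsAlgClosed.exists_pow_nat_eq (g c * Complex.exp (-G c)) (n := 2) (by norm_num)
  refine ⟨fun z => b * Complex.exp (G z / 2), (hGd.div_const 2).cexp.const_mul b, fun z hz => ?_⟩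
  rw [mul_pow, hb, ← hconst z hz, ← Complex.exp_nat_mul, mul_assoc, ← Complex.exp_add]
  have : -G z + ((2 : ℕ) : ℂ) * (G z / 2) = 0 := by push_cast; ring
  rw [this, Complex.exp_zero, mul_one]

/-- Inverse branches of iterates of `λ d + d²` on a disk that avoids the critical orbit, prescribed
along a connected set. -/
theorem exists_inverse_branch {lam : ℂ} {c : ℂ} {ρ : ℝ} {k : ℂ → ℂ}
    (hk : DifferentiableOn ℂ k (ball c ρ)) {T : Set ℂ} (hT : IsPreconnected T) {j : ℂ → ℂ}
    (hj : ContinuousOn j T) (hjm : MapsTo j T (ball c ρ)) (N : ℕ) :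
    ∀ {y : ℂ → ℂ}, ContinuousOn y T → (∀ Z ∈ T, (quad lam)^[N] (y Z) = k (j Z)) →
      (∀ x ∈ ball c ρ, ∀ i < N, k x ≠ (quad lam)^[i] (-lam ^ 2 / 4)) →
      ∃ h : ℂ → ℂ, DifferentiableOn ℂ h (ball c ρ) ∧
        (∀ x ∈ ball c ρ, (quad lam)^[N] (h x) = k x) ∧ ∀ Z ∈ T, h (j Z) = y Z := by
  induction N with
  | zero => exact fun {y} _ hyk _ => ⟨k, hk, fun x _ => rfl, fun Z hZ => (hyk Z hZ).symm⟩
  | succ N ih =>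
    intro y hy hyk hcv
    obtain ⟨h', hd', hh', hj'⟩ := ih (y := fun Z => quad lam (y Z))
      (by unfold quad; fun_prop) (fun Z hZ => by
        rw [← hyk Z hZ, Function.iterate_succ_apply]) fun x hx i hi => hcv x hx i (by omega)
    -- Since λd + d² = (d + λ/2)² - λ²/4, pulling back once more means extracting a square root of
    -- h' + λ²/4. This vanishes only where h' takes the critical value, which would put `k x` on the
    -- critical orbit.
    have hne : ∀ x ∈ ball c ρ, h' x + lam ^ 2 / 4 ≠ 0 := by
      intro x hx h0
      have : h' x = -lam ^ 2 / 4 := by linear_combination h0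
      exact hcv x hx N (by omega) (by rw [← hh' x hx, this])
    obtain ⟨s, hs, hs2⟩ := exists_sqrt_on_ball (hd'.add_const (lam ^ 2 / 4)) hne
    have hsq : ∀ Z ∈ T, s (j Z) ^ 2 = (y Z + lam / 2) ^ 2 := by
      intro Z hZ
      rw [hs2 _ (hjm hZ), hj' Z hZ, quad]
      ring
    have hfin : ∀ t : ℂ → ℂ, DifferentiableOn ℂ t (ball c ρ) →
        (∀ x ∈ ball c ρ, t x ^ 2 = h' x + lam ^ 2 / 4) → (∀ Z ∈ T, t (j Z) = y Z + lam / 2) →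
        ∃ h : ℂ → ℂ, DifferentiableOn ℂ h (ball c ρ) ∧
          (∀ x ∈ ball c ρ, (quad lam)^[N + 1] (h x) = k x) ∧ ∀ Z ∈ T, h (j Z) = y Z := by
      intro t ht ht2 htj
      refine ⟨fun x => t x - lam / 2, ht.sub_const _, fun x hx => ?_, fun Z hZ => ?_⟩
      · have : quad lam (t x - lam / 2) = h' x := by
          rw [quad]
          linear_combination ht2 x hx
        rw [Function.iterate_succ_apply, this, hh' x hx]
      · beta_reduce
        rw [htj Z hZ]
        ring
    have hcs : ContinuousOn (fun Z => s (j Z)) T := hs.continuousOn.comp hj hjm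
    have hcy : ContinuousOn (fun Z => y Z + lam / 2) T := by fun_prop
    -- Two continuous nonvanishing functions with equal squares on a connected set agree up to one
    -- global sign; the sign selects the branch that continues `y`.
    rcases hT.eq_or_eq_neg_of_sq_eq hcs hcy (fun Z hZ => hsq Z hZ) (fun {Z} hZ h0 => by
      have h1 := hsq Z hZ
      rw [hs2 _ (hjm hZ), h0] at h1
      exact hne _ (hjm hZ) (by simpa using h1)) with h | h
    · exact hfin s hs (fun x hx => hs2 x hx) fun Z hZ => h hZ
    · refine hfin (fun x => -s x) hs.neg (fun x hx => by rw [neg_sq]; exact hs2 x hx) fun Z hZ => ?_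
      have := h hZ
      simp only [Pi.neg_apply] at this
      rw [this, neg_neg]

/-- Points outside the disk of radius `4` do not return to it. -/
theorem four_lt_norm_quad_iterate {lam : ℂ} (hlam : ‖lam‖ = 1) {z : ℂ} (hz : 4 < ‖z‖) (N : ℕ) :
    4 < ‖(quad lam)^[N] z‖ := by
  induction N generalizing z with
  | zero => exact hz
  | succ N ih =>
    rw [Function.iterate_succ_apply]
    apply ih
    have h1 := norm_sub_le (quad lam z) (lam * z)
    have h2 : quad lam z - lam * z = z ^ 2 := by rw [quad]; ring
    rw [h2, norm_pow, norm_mul, hlam] at h1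
    nlinarith

/-- The approximate Fatou coordinate `A z^{-κ}`. -/
noncomputable def fatouCoord (A : ℂ) (κ : ℕ) (z : ℂ) : ℂ := A * (z ^ κ)⁻¹

/-- The principal branch of `Z ^ (1/κ)`. -/
noncomputable def rootBranch (κ : ℕ) (Z : ℂ) : ℂ := Complex.exp (Complex.log Z / κ)

theorem rootBranch_pow {κ : ℕ} (hκ : κ ≠ 0) {Z : ℂ} (hZ : Z ≠ 0) : rootBranch κ Z ^ κ = Z := by
  rw [rootBranch, ← Complex.exp_nat_mul, mul_div_cancel₀ _ (by exact_mod_cast hκ),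
    Complex.exp_log hZ]

theorem rootBranch_ne_zero (κ : ℕ) (Z : ℂ) : rootBranch κ Z ≠ 0 := Complex.exp_ne_zero _

/-- The attracting petal of label `ζ`, where `ζ ^ κ = A`. -/
def petal (A : ℂ) (κ : ℕ) (L : ℝ) (ζ : ℂ) : Set ℂ :=
  {z | z ≠ 0 ∧ L < (fatouCoord A κ z).re ∧ z * rootBranch κ (fatouCoord A κ z) = ζ}

/-- The point of the petal of label `ζ` with Fatou coordinate `Z`. -/
noncomputable def petalPoint (κ : ℕ) (ζ Z : ℂ) : ℂ := ζ * (rootBranch κ Z)⁻¹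

variable {A : ℂ} {κ : ℕ} {L : ℝ} {ζ : ℂ}

theorem fatouCoord_petalPoint (hκ : κ ≠ 0) (hA : A ≠ 0) (hζ : ζ ^ κ = A) {Z : ℂ} (hZ : Z ≠ 0) :
    fatouCoord A κ (petalPoint κ ζ Z) = Z := by
  rw [fatouCoord, petalPoint, mul_pow, inv_pow, rootBranch_pow hκ hZ, hζ]
  field_simp

theorem petalPoint_mem (hκ : κ ≠ 0) (hA : A ≠ 0) (hζ : ζ ^ κ = A) (hL : 0 ≤ L) {Z : ℂ}
    (hZ : L < Z.re) : petalPoint κ ζ Z ∈ petal A κ L ζ := by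
  have hZ0 : Z ≠ 0 := by rintro rfl; simp at hZ; linarith
  have hζ0 : ζ ≠ 0 := by rintro rfl; rw [zero_pow hκ] at hζ; exact hA hζ.symm
  refine ⟨mul_ne_zero hζ0 (inv_ne_zero (rootBranch_ne_zero _ _)), ?_, ?_⟩
  · rwa [fatouCoord_petalPoint hκ hA hζ hZ0]
  · rw [fatouCoord_petalPoint hκ hA hζ hZ0, petalPoint,
      inv_mul_cancel_right₀ (rootBranch_ne_zero _ _)]

theorem petalPoint_fatouCoord {z : ℂ} (hz : z ∈ petal A κ L ζ) :
    petalPoint κ ζ (fatouCoord A κ z) = z := by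
  rw [petalPoint, ← hz.2.2, mul_inv_cancel_right₀ (rootBranch_ne_zero _ _)]

theorem differentiableAt_petalPoint {Z : ℂ} (hZ : 0 < Z.re) :
    DifferentiableAt ℂ (petalPoint κ ζ) Z := by
  unfold petalPoint rootBranch
  have h1 : DifferentiableAt ℂ Complex.log Z :=
    (Complex.hasDerivAt_log (Or.inl hZ)).differentiableAt
  exact ((h1.div_const _).cexp.inv (Complex.exp_ne_zero _)).const_mul _

/-- The fundamental estimate: in the coordinate `A z^{-κ}`, a map tangent to the identity is close
to the unit translation. -/
theorem tendsto_fatouCoord_sub {f : ℂ → ℂ} {C : ℂ} (hκ : κ ≠ 0) (hC : C ≠ 0)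
    (hf : (fun z => f z - z - C * z ^ (κ + 1)) =O[𝓝 0] fun z => z ^ (κ + 2)) :
    Tendsto (fun z => f z / z) (𝓝[≠] 0) (𝓝 1) ∧
    Tendsto (fun z => fatouCoord (-1 / (κ * C)) κ (f z) - fatouCoord (-1 / (κ * C)) κ z)
      (𝓝[≠] 0) (𝓝 1) := by
  have hκC : (κ : ℂ) ≠ 0 := by exact_mod_cast hκ
  set t : ℂ → ℂ := fun z => (f z - z) / z with ht
  have hself : ∀ᶠ z : ℂ in 𝓝[≠] 0, z ≠ 0 := self_mem_nhdsWithin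
  have hid : Tendsto (fun z : ℂ => z) (𝓝[≠] 0) (𝓝 0) := nhdsWithin_le_nhds
  have htκ : Tendsto (fun z => t z / z ^ κ) (𝓝[≠] 0) (𝓝 C) := by
    have h1 : (fun z => t z / z ^ κ - C) =O[𝓝[≠] 0] fun z : ℂ => z := by
      have h2 := (hf.mono (nhdsWithin_le_nhds (s := {0}ᶜ))).mul
        (isBigO_refl (fun z : ℂ => (z ^ (κ + 1))⁻¹) (𝓝[≠] 0))
      refine h2.congr' ?_ ?_
      · filter_upwards [hself] with z hz
        simp only [ht]
        field_simp
        ring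
      · filter_upwards [hself] with z hz
        field_simp
        ring
    have h3 := h1.trans_tendsto hid
    simpa using h3.add_const C
  have ht0 : Tendsto t (𝓝[≠] 0) (𝓝 0) := by
    have h1 : Tendsto (fun z : ℂ => z ^ κ) (𝓝[≠] 0) (𝓝 0) := by
      simpa [hκ] using hid.pow κ
    have h2 := htκ.mul h1
    rw [mul_zero] at h2
    refine h2.congr' ?_
    filter_upwards [hself] with z hz
    field_simp
  have hfz : ∀ z : ℂ, z ≠ 0 → f z = z * (1 + t z) := fun z hz => by
    simp only [ht]; field_simp; ring
  refine ⟨?_, ?_⟩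
  · have : Tendsto (fun z => 1 + t z) (𝓝[≠] 0) (𝓝 1) := by simpa using ht0.const_add 1
    refine this.congr' ?_
    filter_upwards [hself] with z hz
    rw [hfz z hz]
    field_simp
  · set g : ℂ → ℂ := fun s => ((1 + s) ^ κ)⁻¹ with hg
    have hgd : HasDerivAt g (-κ) 0 := by
      have h1 : HasDerivAt (fun s : ℂ => (1 + s) ^ κ) (κ * (1 + 0) ^ (κ - 1) * 1) 0 :=
        ((hasDerivAt_id (0 : ℂ)).const_add 1).pow κ
      have h2 := h1.inv (by simp)
      refine h2.congr_deriv ?_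
      simp
    have hds : Tendsto (fun z => dslope g 0 (t z)) (𝓝[≠] 0) (𝓝 (-κ)) := by
      have h1 : ContinuousAt (dslope g 0) 0 := continuousAt_dslope_same.2 hgd.differentiableAt
      have h2 := h1.tendsto.comp ht0
      rwa [dslope_same, hgd.deriv] at h2
    have h1 := ((htκ.mul hds).const_mul (-1 / (κ * C)))
    have h2 : -1 / (κ * C) * (C * -κ) = 1 := by field_simp
    rw [h2] at h1
    refine h1.congr' ?_
    filter_upwards [hself] with z hz
    have h3 := sub_smul_dslope g 0 (t z)
    simp only [sub_zero, smul_eq_mul] at h3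
    have h4 : g 0 = 1 := by simp [hg]
    have h5 : ((f z) ^ κ)⁻¹ = (z ^ κ)⁻¹ * g (t z) := by
      rw [hfz z hz, mul_pow, mul_inv]
    rw [fatouCoord, fatouCoord, h5]
    rw [h4] at h3
    have h6 : g (t z) = 1 + t z * dslope g 0 (t z) := by rw [h3]; ring
    rw [h6]
    field_simp
    ring

/-- For large `L` the petals are invariant. -/
theorem exists_petal_invariant {f : ℂ → ℂ} {C : ℂ} (hκ : κ ≠ 0) (hC : C ≠ 0)
    (hf : (fun z => f z - z - C * z ^ (κ + 1)) =O[𝓝 0] fun z => z ^ (κ + 2))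
    (hA : A = -1 / (κ * C)) :
    ∃ L : ℝ, 1 ≤ L ∧ ∀ ζ, ∀ z ∈ petal A κ L ζ, ‖z‖ < 1 ∧ f z ∈ petal A κ L ζ ∧
      ‖fatouCoord A κ (f z) - fatouCoord A κ z - 1‖ ≤ 1 / 8 := by
  obtain ⟨h1, h2⟩ := tendsto_fatouCoord_sub hκ hC hf
  rw [← hA] at h2
  have hκC : (κ : ℂ) ≠ 0 := by exact_mod_cast hκ
  have hA0 : A ≠ 0 := by rw [hA]; exact div_ne_zero (by norm_num) (mul_ne_zero hκC hC)
  -- 1 is isolated among the κ-th roots of unity. Labels of petals are κ-th roots of A, so a label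
  -- that changes by a factor near 1 does not change.
  have hroot : ∀ᶠ ω : ℂ in 𝓝 1, ω ^ κ = 1 → ω = 1 := by
    have hc : Continuous fun ω : ℂ => ∑ i ∈ Finset.range κ, ω ^ i := by fun_prop
    have h3 : ∀ᶠ ω : ℂ in 𝓝 1, ∑ i ∈ Finset.range κ, ω ^ i ≠ 0 :=
      hc.continuousAt.eventually_ne (by simpa using hκC)
    filter_upwards [h3] with ω hω hω1
    have := mul_geom_sum ω κ
    rw [hω1, sub_self] at this
    rcases mul_eq_zero.1 this with h | h
    · exact sub_eq_zero.1 h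
    · exact absurd h hω
  -- the ratio of labels is close to one
  have hmul : Tendsto (fun p : ℂ × ℂ => p.1 * Complex.exp (p.2 / κ)) (𝓝 (1, 0)) (𝓝 1) := by
    have : Continuous fun p : ℂ × ℂ => p.1 * Complex.exp (p.2 / κ) := by fun_prop
    simpa using this.tendsto (1, 0)
  obtain ⟨η, hη, hηr⟩ := Metric.eventually_nhds_iff.1 (hmul.eventually hroot)
  have hev : ∀ᶠ z : ℂ in 𝓝[≠] 0, ‖f z / z - 1‖ < η ∧
      ‖fatouCoord A κ (f z) - fatouCoord A κ z - 1‖ < 1 / 8 ∧ ‖z‖ < 1 := by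
    have e1 := (tendsto_order.1 (tendsto_iff_norm_sub_tendsto_zero.1 h1)).2 η hη
    have e2 := (tendsto_order.1 (tendsto_iff_norm_sub_tendsto_zero.1 h2)).2 (1 / 8) (by norm_num)
    have e3 : ∀ᶠ z : ℂ in 𝓝[≠] 0, ‖z‖ < 1 := by
      have : ∀ᶠ z : ℂ in 𝓝 0, ‖z‖ < 1 := by
        filter_upwards [ball_mem_nhds (0 : ℂ) one_pos] with z hz
        simpa using hz
      exact this.filter_mono nhdsWithin_le_nhds
    filter_upwards [e1, e2, e3] with z a b c using ⟨a, b, c⟩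
  obtain ⟨r, hr, hr'⟩ := Metric.mem_nhdsWithin_iff.1 hev
  -- The bound ‖A‖/r^κ forces |z| < r, where the local estimates hold. The bound 2/η makes the
  -- logarithm of the Fatou coordinate move by at most (9/8)/L < η, since the coordinate itself
  -- moves by at most 9/8.
  obtain ⟨L, hL⟩ : ∃ L : ℝ, L = max (max 1 (‖A‖ / r ^ κ)) (2 / η) := ⟨_, rfl⟩
  have hL1 : 1 ≤ L := by rw [hL]; exact (le_max_left _ _).trans (le_max_left _ _)
  have hL2 : ‖A‖ / r ^ κ ≤ L := by rw [hL]; exact (le_max_right _ _).trans (le_max_left _ _)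
  have hL3 : 2 / η ≤ L := by rw [hL]; exact le_max_right _ _
  refine ⟨L, hL1, fun ζ z hz => ?_⟩
  obtain ⟨hz0, hzL, hzζ⟩ := hz
  have hzr : ‖z‖ < r := by
    by_contra hge
    rw [not_lt] at hge
    have h3 : L < ‖fatouCoord A κ z‖ := hzL.trans_le (Complex.re_le_norm _)
    rw [fatouCoord, norm_mul, norm_inv, norm_pow] at h3
    have h4 : ‖A‖ * (‖z‖ ^ κ)⁻¹ ≤ ‖A‖ / r ^ κ := by
      rw [div_eq_mul_inv]; gcongr
    linarith
  obtain ⟨e1, e2, e3⟩ := hr' ⟨by simpa using hzr, hz0⟩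
  set U := fatouCoord A κ z with hU
  set U' := fatouCoord A κ (f z) with hU'
  have hre : |(U' - U - 1).re| ≤ 1 / 8 := (Complex.abs_re_le_norm _).trans e2.le
  have hre' := abs_le.1 hre
  simp only [Complex.sub_re, Complex.one_re] at hre'
  have hU'L : L < U'.re := by linarith
  have hfz0 : f z ≠ 0 := by
    intro h
    have : U' = 0 := by rw [hU', h, fatouCoord, zero_pow hκ, inv_zero, mul_zero]
    rw [this] at hU'L
    simp at hU'L
    linarith
  refine ⟨e3, ⟨hfz0, hU'L, ?_⟩, e2.le⟩
  have hU0 : U ≠ 0 := by intro h; rw [h] at hzL; simp at hzL; linarith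
  have hU'0 : U' ≠ 0 := by intro h; rw [h] at hU'L; simp at hU'L; linarith
  have hlog : ‖Complex.log U' - Complex.log U‖ < η := by
    have hconv : Convex ℝ {Z : ℂ | L < Z.re} := convex_halfSpace_re_gt L
    have h3 := hconv.norm_image_sub_le_of_norm_deriv_le (f := Complex.log) (C := 1 / L) (𝕜 := ℂ)
      (fun Z hZ => (Complex.hasDerivAt_log (Or.inl (by
        have : L < Z.re := hZ
        linarith))).differentiableAt) (fun Z hZ => ?_) hzL hU'L
    · have h4 : ‖U' - U‖ ≤ 9 / 8 := by
        have : U' - U = (U' - U - 1) + 1 := by ring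
        rw [this]
        refine (norm_add_le _ _).trans ?_
        rw [norm_one]
        linarith
      have hL0 : 0 < L := by linarith
      refine h3.trans_lt ?_
      have h5 : 2 ≤ L * η := by rwa [div_le_iff₀ hη] at hL3
      calc 1 / L * ‖U' - U‖ ≤ 1 / L * (9 / 8) := by gcongr
        _ < η := by rw [div_mul_eq_mul_div, div_lt_iff₀ hL0]; linarith
    · have hZ' : L < Z.re := hZ
      rw [(Complex.hasDerivAt_log (Or.inl (by linarith))).deriv, norm_inv, ← one_div]
      exact one_div_le_one_div_of_le (by linarith) (hZ'.le.trans (Complex.re_le_norm _))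
  have hratio := @hηr (f z / z, Complex.log U' - Complex.log U) (by
    rw [Prod.dist_eq, max_lt_iff, dist_eq_norm, dist_eq_norm, sub_zero]
    exact ⟨e1, hlog⟩)
  have hrb : rootBranch κ U' = rootBranch κ U *
      Complex.exp ((Complex.log U' - Complex.log U) / κ) := by
    rw [rootBranch, rootBranch, ← Complex.exp_add]
    congr 1
    ring
  have hlab : f z * rootBranch κ U' = ζ *
      (f z / z * Complex.exp ((Complex.log U' - Complex.log U) / κ)) := by
    rw [hrb, ← hzζ]
    field_simp
  rw [hlab, hratio, mul_one]
  have p1 : (f z * rootBranch κ U') ^ κ = A := by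
    rw [mul_pow, rootBranch_pow hκ hU'0, hU', fatouCoord]
    field_simp
  have p2 : ζ ^ κ = A := by
    rw [← hzζ, mul_pow, rootBranch_pow hκ hU0, hU, fatouCoord]
    field_simp
  rw [hlab, mul_pow, p2] at p1
  exact mul_left_cancel₀ hA0 (p1.trans (mul_one A).symm)

/-- Every petal contains a point of the critical orbit. -/
theorem exists_critical_mem_petal {lam : ℂ} (hlam : ‖lam‖ = 1) {q : ℕ} {f : ℂ → ℂ}
    (hfq : f = (quad lam)^[q]) (hκ : κ ≠ 0) (hA : A ≠ 0) (hζ : ζ ^ κ = A) (hL : 1 ≤ L)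
    (hinv : ∀ z ∈ petal A κ L ζ, ‖z‖ < 1 ∧ f z ∈ petal A κ L ζ ∧
      ‖fatouCoord A κ (f z) - fatouCoord A κ z - 1‖ ≤ 1 / 8) :
    ∃ m, (quad lam)^[m] (-lam ^ 2 / 4) ∈ petal A κ L ζ := by
  by_contra! hcv
  -- A reference point deep in the half plane. The disk `T` of radius 2 around it stays inside the
  -- half plane and contains the Fatou coordinate of the next orbit point, at distance at most 9/8.
  set Z₀ : ℂ := ((L + 100 : ℝ) : ℂ) with hZ₀
  set T := ball Z₀ 2 with hTdef
  have hTre : ∀ Z ∈ T, L < Z.re := by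
    intro Z hZ
    have h1 := (Complex.abs_re_le_norm (Z - Z₀)).trans_lt (mem_ball_iff_norm.1 hZ)
    have h2 := (abs_lt.1 h1).1
    rw [hZ₀, Complex.sub_re, Complex.ofReal_re] at h2
    linarith
  have hit : ∀ n : ℕ, ∀ z ∈ petal A κ L ζ, f^[n] z ∈ petal A κ L ζ ∧
      ‖fatouCoord A κ (f^[n] z) - fatouCoord A κ z - n‖ ≤ n / 8 := by
    intro n z hz
    induction n with
    | zero => simpa using hz
    | succ n ih =>
      obtain ⟨i1, i2⟩ := ih
      obtain ⟨-, j1, j2⟩ := hinv _ i1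
      rw [Function.iterate_succ_apply']
      refine ⟨j1, ?_⟩
      have := norm_add_le (fatouCoord A κ (f (f^[n] z)) - fatouCoord A κ (f^[n] z) - 1)
        (fatouCoord A κ (f^[n] z) - fatouCoord A κ z - n)
      have e : fatouCoord A κ (f (f^[n] z)) - fatouCoord A κ (f^[n] z) - 1
          + (fatouCoord A κ (f^[n] z) - fatouCoord A κ z - n)
          = fatouCoord A κ (f (f^[n] z)) - fatouCoord A κ z - ((n + 1 : ℕ) : ℂ) := by
        push_cast; ring
      rw [e] at this
      push_cast at this ⊢
      linarith
  have hmem : ∀ Z : ℂ, L < Z.re → petalPoint κ ζ Z ∈ petal A κ L ζ := fun Z hZ =>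
    petalPoint_mem hκ hA hζ (by linarith) hZ
  have hUk : ∀ Z : ℂ, L < Z.re → fatouCoord A κ (petalPoint κ ζ Z) = Z := fun Z hZ =>
    fatouCoord_petalPoint hκ hA hζ (by rintro rfl; simp at hZ; linarith)
  have hZ₀T : Z₀ ∈ T := mem_ball_self two_pos
  have hz₀ := hmem Z₀ (hTre Z₀ hZ₀T)
  set z₀ := petalPoint κ ζ Z₀ with hz₀def
  obtain ⟨-, hz₁, hz₁U⟩ := hinv _ hz₀
  rw [hUk Z₀ (hTre Z₀ hZ₀T)] at hz₁U
  set Z₁ := fatouCoord A κ (f z₀) with hZ₁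
  have h98 : ∀ w : ℂ, ‖w - 1‖ ≤ 1 / 8 → ‖w‖ ≤ 9 / 8 := by
    intro w hw
    have := norm_add_le (w - 1) 1
    rw [sub_add_cancel, norm_one] at this
    linarith
  have hZ₁T : Z₁ ∈ T := by
    rw [hTdef, mem_ball_iff_norm]
    have := h98 _ hz₁U
    linarith
  have hkZ₁ : petalPoint κ ζ Z₁ = f z₀ := petalPoint_fatouCoord hz₁
  -- Without critical orbit points in the petal, f^n has an inverse branch on a disk of radius n/2
  -- in the Fatou coordinate, bounded by 4. It sends two points at distance at most 9/8 to z₀ and f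
  -- z₀, so Schwarz gives |f z₀ - z₀| ≤ 18/n. Hence z₀ would be fixed, although its Fatou coordinate
  -- moves by about 1. The condition n > 8 is what n/4 + 2 < n/2 requires, so that `Φ` maps `T` into
  -- that disk.
  have key : ∀ n : ℕ, 8 < n → ‖f z₀ - z₀‖ * n ≤ 18 := by
    intro n hn
    have hn' : (8 : ℝ) < n := by exact_mod_cast hn
    set Φ : ℂ → ℂ := fun Z => fatouCoord A κ (f^[n] (petalPoint κ ζ Z)) with hΦ
    have hΦb : ∀ Z ∈ T, ‖Φ Z - Z - n‖ ≤ n / 8 := by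
      intro Z hZ
      have := (hit n _ (hmem Z (hTre Z hZ))).2
      rwa [hUk Z (hTre Z hZ)] at this
    have hkT : ContinuousOn (petalPoint κ ζ) T := fun Z hZ =>
      (differentiableAt_petalPoint (by have := hTre Z hZ; linarith)).continuousAt.continuousWithinAt
    have hfc : Continuous f^[n] := by
      apply Continuous.iterate
      rw [hfq]
      apply Continuous.iterate
      unfold quad
      fun_prop
    have hΦc : ContinuousOn Φ T := by
      intro Z hZ
      have h1 : ContinuousWithinAt (fun Z => f^[n] (petalPoint κ ζ Z)) T Z :=
        hfc.continuousAt.comp_continuousWithinAt (hkT Z hZ)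
      exact ((h1.pow κ).inv₀ (pow_ne_zero _ (hit n _ (hmem Z (hTre Z hZ))).1.1)).const_mul A
        |>.congr (fun _ _ => rfl) rfl
    have hball : ∀ x ∈ ball (Φ Z₀) (n / 2), L < x.re := by
      intro x hx
      have h1 := (abs_lt.1 ((Complex.abs_re_le_norm _).trans_lt (mem_ball_iff_norm.1 hx))).1
      have h2 := (abs_le.1 ((Complex.abs_re_le_norm _).trans (hΦb Z₀ hZ₀T))).1
      have h3 : Z₀.re = L + 100 := by rw [hZ₀, Complex.ofReal_re]
      simp only [Complex.sub_re, Complex.natCast_re, h3] at h1 h2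
      linarith
    have hΦm : MapsTo Φ T (ball (Φ Z₀) (n / 2)) := by
      intro Z hZ
      rw [mem_ball_iff_norm]
      have e : Φ Z - Φ Z₀ = (Φ Z - Z - n) - (Φ Z₀ - Z₀ - n) + (Z - Z₀) := by ring
      have h1 := norm_add_le ((Φ Z - Z - n) - (Φ Z₀ - Z₀ - n)) (Z - Z₀)
      have h2 := norm_sub_le (Φ Z - Z - n) (Φ Z₀ - Z₀ - n)
      rw [← e] at h1
      have h3 := hΦb Z hZ
      have h4 := hΦb Z₀ hZ₀T
      have h5 := mem_ball_iff_norm.1 hZ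
      linarith
    have hfn : f^[n] = (quad lam)^[q * n] := by rw [Function.iterate_mul, hfq]
    obtain ⟨h, hd, hh, hhj⟩ := exists_inverse_branch (lam := lam) (c := Φ Z₀) (ρ := n / 2)
      (k := petalPoint κ ζ)
      (fun x hx => (differentiableAt_petalPoint
        (by have := hball x hx; linarith)).differentiableWithinAt)
      (convex_ball Z₀ 2).isPreconnected hΦc hΦm (q * n) (y := petalPoint κ ζ) hkT
      (fun Z hZ => by
        rw [← hfn, hΦ]
        exact (petalPoint_fatouCoord (hit n _ (hmem Z (hTre Z hZ))).1).symm)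
      fun x hx i _ hxi => hcv i (hxi ▸ hmem x (hball x hx))
    -- A preimage outside the disk of radius 4 could never reach the petal, which lies in the unit
    -- disk.
    have hb : ∀ x ∈ ball (Φ Z₀) (n / 2 : ℝ), ‖h x‖ ≤ 4 := by
      intro x hx
      by_contra! h4
      have h5 := four_lt_norm_quad_iterate hlam h4 (q * n)
      rw [hh x hx] at h5
      have := (hinv _ (hmem x (hball x hx))).1
      linarith
    have hS := norm_sub_le_of_bounded (by linarith : (0 : ℝ) < n / 2) hd hb (hb _ (hΦm hZ₁T))
    rw [hhj _ hZ₁T, hhj _ hZ₀T, hkZ₁] at hS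
    have hΦ₁ : Φ Z₁ = fatouCoord A κ (f (f^[n] z₀)) := by
      rw [hΦ]
      beta_reduce
      rw [hkZ₁, ← Function.iterate_succ_apply, Function.iterate_succ_apply']
    have hdist := h98 _ (hinv _ (hit n _ hz₀).1).2.2
    rw [hΦ₁] at hS
    have hS2 : ‖f z₀ - z₀‖ ≤ 2 * 4 / (n / 2) * (9 / 8) := by
      refine hS.trans ?_
      gcongr
    have e : 2 * 4 / ((n : ℝ) / 2) * (9 / 8) = 18 / n := by field_simp; norm_num
    rw [e, le_div_iff₀ (by linarith)] at hS2
    exact hS2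
  have hzero : f z₀ - z₀ = 0 := by
    by_contra hne
    have hpos : 0 < ‖f z₀ - z₀‖ := norm_pos_iff.2 hne
    obtain ⟨n, hn⟩ := exists_nat_gt (max 8 (18 / ‖f z₀ - z₀‖))
    have h1 := key n (by exact_mod_cast (le_max_left _ _).trans_lt hn)
    have h2 := (le_max_right _ _).trans_lt hn
    rw [div_lt_iff₀ hpos] at h2
    linarith
  rw [hZ₁, sub_eq_zero.1 hzero, hUk Z₀ (hTre Z₀ hZ₀T)] at hz₁U
  norm_num at hz₁U

/-- The multiplicity of the parabolic point `0` of the iterate `p ^ q` is at most `q + 1`: the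
single critical orbit visits at most `q` petals. -/
theorem parabolic_multiplicity_le {lam : ℂ} (hlam : ‖lam‖ = 1) {q : ℕ} (hq : 0 < q) {C : ℂ}
    (hκ : κ ≠ 0) (hC : C ≠ 0)
    (hf : (fun z => (quad lam)^[q] z - z - C * z ^ (κ + 1)) =O[𝓝 0] fun z => z ^ (κ + 2)) :
    κ ≤ q := by
  obtain ⟨A, hA⟩ : ∃ A : ℂ, A = -1 / (κ * C) := ⟨_, rfl⟩
  have hκC : (κ : ℂ) ≠ 0 := by exact_mod_cast hκ
  have hA0 : A ≠ 0 := by rw [hA]; exact div_ne_zero (by norm_num) (mul_ne_zero hκC hC)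
  obtain ⟨L, hL, hinv⟩ := exists_petal_invariant hκ hC hf hA
  obtain ⟨ζ₀, hζ₀⟩ := IsAlgClosed.exists_pow_nat_eq A (n := κ) (Nat.pos_of_ne_zero hκ)
  have hζ₀0 : ζ₀ ≠ 0 := by rintro rfl; rw [zero_pow hκ] at hζ₀; exact hA0 hζ₀.symm
  have hω := Complex.isPrimitiveRoot_exp κ hκ
  set ω := Complex.exp (2 * Real.pi * Complex.I / κ)
  have hvis : ∀ i : Fin κ, ∃ m, (quad lam)^[m] (-lam ^ 2 / 4) ∈ petal A κ L (ζ₀ * ω ^ (i : ℕ)) :=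
    fun i => exists_critical_mem_petal hlam rfl hκ hA0 (by
      rw [mul_pow, ← pow_mul, mul_comm (i : ℕ), pow_mul, hω.pow_eq_one, one_pow, mul_one, hζ₀]) hL
      (hinv _)
  choose m hm using hvis
  have hstep : ∀ ζ, ∀ z ∈ petal A κ L ζ, ∀ n, (quad lam)^[q * n] z ∈ petal A κ L ζ := by
    intro ζ z hz n
    rw [Function.iterate_mul]
    induction n with
    | zero => exact hz
    | succ n ih => rw [Function.iterate_succ_apply']; exact (hinv _ _ ih).2.1
  -- Two visits of the critical orbit whose times agree mod q are related by an iterate of the q-th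
  -- power of the map, which preserves each petal; the two labels therefore coincide.
  have hwlog : ∀ i i' : Fin κ, m i % q = m i' % q → m i ≤ m i' → i = i' := by
    intro i i' hmod hle
    obtain ⟨n, hn⟩ : ∃ n, m i' = q * n + m i := by
      obtain ⟨n, hn⟩ := (Nat.modEq_iff_dvd' hle).1 hmod
      exact ⟨n, by omega⟩
    have h1 := hstep _ _ (hm i) n
    rw [← Function.iterate_add_apply, ← hn] at h1
    have h2 := (h1.2.2.symm.trans (hm i').2.2)
    exact Fin.ext (hω.pow_inj i.2 i'.2 (mul_left_cancel₀ hζ₀0 h2))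
  have hinj : Function.Injective fun i : Fin κ => (⟨m i % q, Nat.mod_lt _ hq⟩ : Fin q) := by
    intro i i' h
    have h' : m i % q = m i' % q := by simpa using h
    rcases le_total (m i) (m i') with hle | hle
    · exact hwlog i i' h' hle
    · exact (hwlog i' i h'.symm hle).symm
  simpa using Fintype.card_le_of_injective _ hinj

end Fatou

end SemiParabolicHenon

namespace SemiParabolicHenon

/-! ### Existence of normalizing coordinates for the polynomial. -/

section Existence

theorem parabolicPoly_sub (lam z : ℂ) :
    parabolicPoly lam z - q₀ lam = quad lam (z - q₀ lam) := by
  unfold parabolicPoly q₀ quad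
  ring

theorem isPrimitiveRoot_lam {p : ℤ} {q : ℕ} (hq : 0 < q) (hpq : IsCoprime p (q : ℤ)) {lam : ℂ}
    (hlam : lam = Complex.exp (2 * Real.pi * Complex.I * (p / q))) : IsPrimitiveRoot lam q := by
  have h1 := (Complex.isPrimitiveRoot_exp q hq.ne').zpow_of_gcd_eq_one p
    (Int.isCoprime_iff_gcd_eq_one.1 hpq)
  rw [← Complex.exp_int_mul] at h1
  rwa [hlam, show 2 * Real.pi * Complex.I * ((p : ℂ) / q)
    = p * (2 * Real.pi * Complex.I / q) by ring]

theorem hasDerivAt_quad_zero (lam : ℂ) : HasDerivAt (quad lam) lam 0 := by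
  have h := ((hasDerivAt_id (0 : ℂ)).const_mul lam).add (hasDerivAt_pow 2 (0 : ℂ))
  refine (h.congr_deriv (by simp)).congr_of_eventuallyEq (Eventually.of_forall fun d => ?_)
  simp [quad]

theorem differentiable_quad (lam : ℂ) : Differentiable ℂ (quad lam) := by
  unfold quad
  fun_prop

/-- Only the resonant exponents `1`, `q + 1`, `2 q + 1` occur up to order `2 q + 1`. -/
theorem sum_resonant {q : ℕ} (hq : 0 < q) (ν : ℕ → ℂ)
    (hν : ∀ k, 1 ≤ k → ¬ q ∣ k - 1 → ν k = 0) (x : ℂ) :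
    ∑ k ∈ Finset.Icc 1 (2 * q + 1), ν k * x ^ k =
      ν 1 * x + ν (q + 1) * x ^ (q + 1) + ν (2 * q + 1) * x ^ (2 * q + 1) := by
  have hsub : ({1, q + 1, 2 * q + 1} : Finset ℕ) ⊆ Finset.Icc 1 (2 * q + 1) := by
    intro k hk
    simp only [Finset.mem_insert, Finset.mem_singleton] at hk
    rw [Finset.mem_Icc]
    omega
  rw [← Finset.sum_subset hsub, Finset.sum_insert, Finset.sum_insert, Finset.sum_singleton]
  · ring
  · simp only [Finset.mem_singleton]; omega
  · simp only [Finset.mem_insert, Finset.mem_singleton]; omega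
  · intro k hk hk'
    rw [Finset.mem_Icc] at hk
    simp only [Finset.mem_insert, Finset.mem_singleton, not_or] at hk'
    rw [hν k hk.1, zero_mul]
    rintro ⟨m, hm⟩
    have hm3 : m < 3 := by
      by_contra! h
      have := Nat.mul_le_mul_left q h
      omega
    interval_cases m <;> omega

/-- A strict derivative equal to 1 lets ψ shrink small differences by at most the factor 1/2, so
estimates pass from ψ∘f - ψ∘g back to f - g without inverting ψ. -/
theorem isBigO_sub_of_hasStrictDerivAt {ψ f g : ℂ → ℂ} {l : Filter ℂ}
    (hψ : HasStrictDerivAt ψ 1 0) (hf : Tendsto f l (𝓝 0)) (hg : Tendsto g l (𝓝 0)) :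
    (fun z => f z - g z) =O[l] fun z => ψ (f z) - ψ (g z) := by
  have h1 := hψ.hasStrictFDerivAt.isLittleO.def (c := 1 / 2) (by norm_num)
  have h2 : Tendsto (fun z => (f z, g z)) l (𝓝 ((0 : ℂ), (0 : ℂ))) := hf.prodMk_nhds hg
  refine IsBigO.of_bound 2 ?_
  filter_upwards [h2.eventually h1] with z hz
  have h3 := norm_sub_norm_le (f z - g z) (ψ (f z) - ψ (g z))
  rw [norm_sub_rev (f z - g z)] at h3
  simp only [ContinuousLinearMap.toSpanSingleton_apply, smul_eq_mul, mul_one] at hz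
  linarith

/-- An entire function vanishing at `0` to order at least `N` but not identically has a leading
term. -/
theorem exists_leading_term {g : ℂ → ℂ} (hg : Differentiable ℂ g) (h0 : ∃ z, g z ≠ 0) {N : ℕ}
    (hO : g =O[𝓝 0] fun d => d ^ N) :
    ∃ n, N ≤ n ∧ ∃ C : ℂ, C ≠ 0 ∧ (fun d => g d - C * d ^ n) =O[𝓝 0] fun d => d ^ (n + 1) := by
  have han : AnalyticOnNhd ℂ g univ := fun z _ => hg.analyticAt z
  have hne : ¬ ∀ᶠ z in 𝓝 (0 : ℂ), g z = 0 := by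
    intro h
    obtain ⟨z, hz⟩ := h0
    exact hz (han.eqOn_zero_of_preconnected_of_eventuallyEq_zero isPreconnected_univ
      (mem_univ 0) h (mem_univ z))
  obtain ⟨n, G, hG, hG0, hGe⟩ :=
    ((hg.analyticAt 0).exists_eventuallyEq_pow_smul_nonzero_iff).2 hne
  simp only [sub_zero, smul_eq_mul] at hGe
  refine ⟨n, ?_, G 0, hG0, ?_⟩
  · by_contra! hlt
    have h1 : (fun d : ℂ => d ^ n * G d) =O[𝓝[≠] 0] fun d => d ^ (n + 1) :=
      ((hO.congr' hGe EventuallyEq.rfl).trans (isBigO_pow_of_le hlt)).mono nhdsWithin_le_nhds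
    have h2 : G =O[𝓝[≠] 0] fun d : ℂ => d := by
      refine (h1.mul (isBigO_refl (fun d : ℂ => (d ^ n)⁻¹) _)).congr' ?_ ?_
      · filter_upwards [self_mem_nhdsWithin] with d hd
        have : d ≠ 0 := hd
        field_simp
      · filter_upwards [self_mem_nhdsWithin] with d hd
        have : d ≠ 0 := hd
        field_simp
        ring
    have h3 : Tendsto G (𝓝[≠] 0) (𝓝 0) := h2.trans_tendsto nhdsWithin_le_nhds
    exact hG0 (tendsto_nhds_unique (hG.continuousAt.tendsto.mono_left nhdsWithin_le_nhds) h3)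
  · have h1 := hG.differentiableAt.isBigO_sub
    have h2 := (isBigO_refl (fun d : ℂ => d ^ n) (𝓝 0)).mul h1
    refine h2.congr' ?_ (Eventually.of_forall fun d => by ring)
    filter_upwards [hGe] with d hd
    rw [hd]
    ring

/-- For |z| ≥ 5 one has |λz + z²| ≥ 4|z|, so the point 5 escapes. It certifies that the q-th iterate
is not the identity and so has a leading term at 0. -/
theorem exists_quad_iterate_ne {lam : ℂ} (hlam : ‖lam‖ = 1) {q : ℕ} (hq : 0 < q) :
    (quad lam)^[q] 5 ≠ 5 := by
  have h : ∀ n, 5 ≤ ‖(quad lam)^[n] 5‖ ∧ (0 < n → 5 < ‖(quad lam)^[n] 5‖) := by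
    intro n
    induction n with
    | zero => simp
    | succ n ih =>
      have h5 : 5 < ‖(quad lam)^[n + 1] 5‖ := by
        rw [Function.iterate_succ_apply']
        set z := (quad lam)^[n] 5
        have h1 := norm_sub_le (quad lam z) (lam * z)
        have h2 : quad lam z - lam * z = z ^ 2 := by rw [quad]; ring
        rw [h2, norm_pow, norm_mul, hlam] at h1
        nlinarith [ih.1]
      exact ⟨h5.le, fun _ => h5⟩
  intro h0
  have := (h q).2 hq
  rw [h0] at this
  norm_num at this

/-- The first resonant coefficient of `p` does not vanish. -/
theorem resonant_ne_zero {lam : ℂ} (hlam : ‖lam‖ = 1) {q : ℕ} (hq : 0 < q) (hlq : lam ^ q = 1)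
    {ψ : ℂ → ℂ} (hψ : HasStrictDerivAt ψ 1 0)
    (hO : (fun d => ψ (quad lam d) - lam * ψ d) =O[𝓝 0] fun d => d ^ (q + 2)) : False := by
  have hq0 : quad lam 0 = 0 := by simp [quad]
  have hit : ∀ n, (quad lam)^[n] 0 = 0 := fun n => Function.iterate_fixed hq0 n
  have hdiff : ∀ n, Differentiable ℂ ((quad lam)^[n]) := fun n => (differentiable_quad lam).iterate n
  have htend : ∀ n, Tendsto ((quad lam)^[n]) (𝓝 0) (𝓝 0) := fun n => by
    simpa [hit n] using (hdiff n).continuous.tendsto 0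
  have hord : ∀ n, (quad lam)^[n] =O[𝓝 0] fun d : ℂ => d := fun n => by
    simpa [hit n] using (hdiff n 0).isBigO_sub
  -- Linearization up to O(d^(q+2)) is inherited by iterates. At time q, where λ^q = 1, the iterate
  -- is the identity up to that order, so its multiplicity exceeds what the critical orbit allows.
  have hiter : ∀ n, (fun d => ψ ((quad lam)^[n] d) - lam ^ n * ψ d) =O[𝓝 0]
      fun d => d ^ (q + 2) := by
    intro n
    induction n with
    | zero => simpa using isBigO_zero _ _
    | succ n ih =>
      have h1 := (hO.comp_tendsto (htend n)).trans ((hord n).pow (q + 2))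
      refine (h1.add (ih.const_mul_left lam)).congr_left fun d => ?_
      simp only [Function.comp_apply, Function.iterate_succ_apply']
      ring
  have h1 := hiter q
  simp only [hlq, one_mul] at h1
  have h2 : (fun d => (quad lam)^[q] d - d) =O[𝓝 0] fun d => d ^ (q + 2) :=
    (isBigO_sub_of_hasStrictDerivAt hψ (htend q) tendsto_id).trans h1
  obtain ⟨n, hn, C, hC, hCO⟩ := exists_leading_term ((hdiff q).sub differentiable_id)
    ⟨5, sub_ne_zero.2 (exists_quad_iterate_ne hlam hq)⟩ h2
  obtain ⟨κ, rfl⟩ : ∃ κ, n = κ + 1 := ⟨n - 1, by omega⟩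
  have := parabolic_multiplicity_le hlam hq (κ := κ) (by omega) hC hCO
  omega

/-- The polynomial alone, with `a` and `v` as dummy parameters and the fibre collapsing to 0 in one
step. Thus the general normalization also covers one variable. -/
theorem skewSystem_quad {lam : ℂ} :
    SkewSystem lam 1 1 1 1 (fun d => d) (fun x => quad lam x.1) (fun _ => 0) (fun _ => 0)
      (fun _ => 1) where
  δ_pos := one_pos
  R_pos := one_pos
  ε_pos := one_pos
  base_diff := differentiableOn_id
  base_zero := rfl
  base_deriv := hasDerivAt_id 0
  β₀_ne := one_ne_zero
  W_diff := ((differentiable_quad lam).comp differentiable_fst).differentiableOn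
  W_zero := fun p _ => by simp [quad]
  W_deriv := fun p _ => ⟨lam, hasDerivAt_quad_zero lam, by ring⟩
  V_diff := differentiableOn_const _
  V_lt := fun x _ => by simp
  V_zero := fun p _ => rfl
  F_le := fun p _ => by rw [norm_zero]; positivity
  u_diff := differentiableOn_const _
  u_ne := fun p => one_ne_zero

/-- Normalizing coordinates for `p` exist. -/
theorem exists_isNormalizingCoordinate {lam : ℂ} (hlam : ‖lam‖ = 1) {q : ℕ} (hq : 0 < q)
    (hlq : ∀ n, lam ^ n = 1 ↔ q ∣ n) :
    ∃ (V₀ : Set ℂ) (ρ : ℝ) (φ₀ : ℂ → ℂ), IsNormalizingCoordinate lam q V₀ ρ φ₀ := by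
  have hlam0 : lam ≠ 0 := by rintro rfl; simp at hlam
  obtain ⟨P, ν, hP, -⟩ := (skewSystem_quad (lam := lam)).exists_isNormalizing hlam hlq
    (fun _ => 0) (N := 2 * q + 1) (by omega)
  have h0 : ((0 : ℂ), (0 : ℂ)) ∈ ball (0 : ℂ) 1 ×ˢ ball (0 : ℂ) 1 := by simp
  set ψ : ℂ → ℂ := fun d => P (d, (0, 0)) with hψdef
  have hψd : Differentiable ℂ ψ := by
    have h1 : DifferentiableOn ℂ ψ univ :=
      hP.P_diff.comp (f := fun d : ℂ => (d, ((0 : ℂ), (0 : ℂ)))) (by fun_prop)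
        fun d _ => ⟨mem_univ _, h0⟩
    exact differentiableOn_univ.1 h1
  have hψ0 : ψ 0 = 0 := hP.P_zero _ h0
  have hψ1 : HasStrictDerivAt ψ 1 0 := by
    have h1 := (hψd.analyticAt 0).hasStrictDerivAt
    rwa [(hP.P_deriv _ h0).deriv] at h1
  set b := ν (q + 1) 0 with hb
  set b' := ν (2 * q + 1) 0 with hb'
  have hconj : (fun d => ψ (quad lam d) - (lam * ψ d + b * ψ d ^ (q + 1) +
      b' * ψ d ^ (2 * q + 1))) =O[𝓝 0] fun d => d ^ (2 * q + 2) := by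
    refine (hP.conj _ h0).congr_left fun d => ?_
    rw [sum_resonant hq (fun k => ν k 0) (fun k h1 h2 => hP.ν_eq_zero k h1 h2 0), hP.ν_one]
  have hψO : ψ =O[𝓝 0] fun d : ℂ => d := by
    simpa [hψ0] using (hψd 0).isBigO_sub
  have hb0 : b ≠ 0 := by
    intro hbz
    refine resonant_ne_zero hlam hq ((hlq q).2 dvd_rfl) hψ1 ?_
    have h1 := hconj.trans (isBigO_pow_of_le (show q + 2 ≤ 2 * q + 2 by omega))
    have h2 := ((hψO.pow (2 * q + 1)).trans
      (isBigO_pow_of_le (show q + 2 ≤ 2 * q + 1 by omega))).const_mul_left b'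
    refine (h1.add h2).congr_left fun d => ?_
    rw [hbz]
    ring
  -- Rescaling by A divides the coefficient of degree q+1 by A^q, so this choice turns b into λ.
  obtain ⟨A, hA⟩ := IsAlgClosed.exists_pow_nat_eq (b / lam) hq
  have hA0 : A ≠ 0 := by
    rintro rfl
    rw [zero_pow hq.ne'] at hA
    exact div_ne_zero hb0 hlam0 hA.symm
  have hφ : HasStrictDerivAt (fun d => A * ψ d) A 0 := by simpa using hψ1.const_mul A
  set e := (hφ.hasStrictFDerivAt_equiv hA0).toOpenPartialHomeomorph (fun d => A * ψ d) with he
  have hecoe : ∀ d, e d = A * ψ d := fun d => rfl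
  have h0s : (0 : ℂ) ∈ e.source :=
    HasStrictFDerivAt.mem_toOpenPartialHomeomorph_source _
  have h0t : (0 : ℂ) ∈ e.target := by
    have := e.map_source h0s
    rwa [hecoe, hψ0, mul_zero] at this
  obtain ⟨ρ, hρ, hρt⟩ := Metric.isOpen_iff.1 e.open_target 0 h0t
  have hcont : Continuous fun z : ℂ => z - q₀ lam := by fun_prop
  refine ⟨(fun z => z - q₀ lam) ⁻¹' (e.source ∩ e ⁻¹' ball 0 ρ), ρ,
    fun z => A * ψ (z - q₀ lam), ?_⟩
  have htend : Tendsto (fun z : ℂ => z - q₀ lam) (𝓝 (q₀ lam)) (𝓝 0) := by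
    simpa using hcont.tendsto (q₀ lam)
  constructor
  · exact (e.isOpen_inter_preimage isOpen_ball).preimage hcont
  · simp [h0s, hecoe, hψ0, hρ]
  · exact hρ
  · have : Differentiable ℂ fun z => A * ψ (z - q₀ lam) := by fun_prop
    exact this.differentiableOn
  · refine ⟨fun z hz => hz.2, fun z hz z' hz' h => ?_, fun w hw => ?_⟩
    · exact sub_left_injective (e.injOn hz.1 hz'.1 h)
    · have hwt := hρt hw
      refine ⟨e.symm w + q₀ lam, ?_, ?_⟩
      · simp only [mem_preimage, add_sub_cancel_right, mem_inter_iff]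
        exact ⟨e.map_target hwt, by rwa [e.right_inv hwt]⟩
      · simp only [add_sub_cancel_right]
        exact e.right_inv hwt
  · simp [hψ0]
  · refine ⟨b' / (lam * A ^ (2 * q)), ?_⟩
    have h1 : (fun d : ℂ => d) =O[𝓝 0] fun d => A * ψ d := by
      have := isBigO_sub_of_hasStrictDerivAt hψ1 (f := fun d => d) (g := fun _ => 0) tendsto_id
        tendsto_const_nhds
      simp only [sub_zero, hψ0] at this
      exact this.trans (isBigO_self_const_mul hA0 _ _)
    have h2 := ((hconj.const_mul_left A).trans (h1.pow (2 * q + 2))).comp_tendsto htend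
    refine h2.congr_left fun z => ?_
    simp only [Function.comp_apply, parabolicPoly_sub]
    have hb2 : b = lam * A ^ q := by rw [hA]; field_simp
    rw [hb2]
    have hAq : A ^ (2 * q) ≠ 0 := pow_ne_zero _ hA0
    field_simp
    ring

end Existence

end SemiParabolicHenon

namespace SemiParabolicHenon

/-! ### The Hénon map in coordinates adapted to the stable manifold. -/

section Coordinates

/-- `θ` is a slope function of the local stable manifolds on `𝔻_δ × 𝔻_R`: the curves
`x = X + a v θ(a, v)`, `y = a X + v` are invariant. -/
structure IsStableSlope (lam : ℂ) (δ R : ℝ) (θ : ℂ × ℂ → ℂ) : Prop where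
  norm_lam : ‖lam‖ = 1
  δ_pos : 0 < δ
  one_le_R : 1 ≤ R
  δR_le : δ * R ≤ 1 / 64
  diff : DifferentiableOn ℂ θ (ball (0 : ℂ) δ ×ˢ ball (0 : ℂ) R)
  norm_le : ∀ p ∈ ball (0 : ℂ) δ ×ˢ ball (0 : ℂ) R, ‖θ p‖ ≤ 2
  invariance : ∀ p ∈ ball (0 : ℂ) δ ×ˢ ball (0 : ℂ) R,
    p.1 ^ 2 * θ p * θ (p.1, p.1 ^ 2 * p.2 * θ p)
      = (lam + eigenMu lam p.1) * θ p + p.1 * p.2 * θ p ^ 2 + 1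
  zero_left : ∀ v ∈ ball (0 : ℂ) R, θ (0, v) = -1 / lam
  zero_right : ∀ a ∈ ball (0 : ℂ) δ, θ (a, 0) = -1 / lam

/-- The displacement `σ(a, v) = a v θ(a, v)` of the stable manifold. -/
def stableGraph (θ : ℂ × ℂ → ℂ) (p : ℂ × ℂ) : ℂ := p.1 * p.2 * θ p

/-- The dynamics `v ↦ a σ(a, v)` on the stable manifold. -/
def stableMap (θ : ℂ × ℂ → ℂ) (p : ℂ × ℂ) : ℂ := p.1 * stableGraph θ p

/-- The coordinate `v = y - a X` along the stable manifold. -/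
noncomputable def fibreCoord (lam a : ℂ) (z : ℂ × ℂ) : ℂ := z.2 - a * fixedPointX lam a

/-- The coordinate `d = x - X - σ(a, v)` transversal to the stable manifold. -/
noncomputable def transCoord (lam : ℂ) (θ : ℂ × ℂ → ℂ) (a : ℂ) (z : ℂ × ℂ) : ℂ :=
  z.1 - fixedPointX lam a - stableGraph θ (a, fibreCoord lam a z)

/-- The second component of the Hénon map in the coordinates `(d, v)`. -/
def skewV (θ : ℂ × ℂ → ℂ) (x : ℂ × (ℂ × ℂ)) : ℂ :=
  x.2.1 * stableGraph θ x.2 + x.2.1 * x.1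

/-- The first component of the Hénon map in the coordinates `(d, v)`. -/
noncomputable def skewD (lam : ℂ) (θ : ℂ × ℂ → ℂ) (x : ℂ × (ℂ × ℂ)) : ℂ :=
  x.1 * (lam + eigenMu lam x.2.1 + 2 * stableGraph θ x.2 + x.1)
    - (stableGraph θ (x.2.1, skewV θ x) - stableGraph θ (x.2.1, stableMap θ x.2))

theorem two_mul_fixedPointX (lam a : ℂ) : 2 * fixedPointX lam a = lam + eigenMu lam a := by
  unfold fixedPointX eigenMu
  rcases eq_or_ne lam 0 with rfl | h
  · simp
  · field_simp
    ring

variable {lam c a : ℂ} {δ R : ℝ} {θ : ℂ × ℂ → ℂ}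

theorem fibreCoord_henon (lam c a : ℂ) (θ : ℂ × ℂ → ℂ) (z : ℂ × ℂ) :
    fibreCoord lam a (henon c a z) =
      skewV θ (transCoord lam θ a z, (a, fibreCoord lam a z)) := by
  simp only [fibreCoord, henon, skewV, transCoord]
  ring

namespace IsStableSlope

variable (S : IsStableSlope lam δ R θ)
include S

theorem δ_le : δ ≤ 1 / 64 := by nlinarith [S.one_le_R, S.δR_le, S.δ_pos]

theorem norm_stableGraph_le {p : ℂ × ℂ} (hp : p ∈ ball (0 : ℂ) δ ×ˢ ball (0 : ℂ) R) :
    ‖stableGraph θ p‖ ≤ 2 * ‖p.1‖ * ‖p.2‖ := by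
  rw [stableGraph, norm_mul, norm_mul]
  have := S.norm_le p hp
  nlinarith [mul_nonneg (norm_nonneg p.1) (norm_nonneg p.2)]

theorem norm_stableGraph_le' {p : ℂ × ℂ} (hp : p ∈ ball (0 : ℂ) δ ×ˢ ball (0 : ℂ) R) :
    ‖stableGraph θ p‖ ≤ 1 / 32 := by
  refine (S.norm_stableGraph_le hp).trans ?_
  have h1 : ‖p.1‖ < δ := mem_ball_zero_iff.1 hp.1
  have h2 : ‖p.2‖ < R := mem_ball_zero_iff.1 hp.2
  calc 2 * ‖p.1‖ * ‖p.2‖ = 2 * (‖p.1‖ * ‖p.2‖) := by ring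
    _ ≤ 2 * (δ * R) := by gcongr; exact S.δ_pos.le
    _ ≤ 1 / 32 := by linarith [S.δR_le]

theorem norm_stableMap_le {p : ℂ × ℂ} (hp : p ∈ ball (0 : ℂ) δ ×ˢ ball (0 : ℂ) R) :
    ‖stableMap θ p‖ ≤ ‖p.2‖ / 2 := by
  have h1 : ‖p.1‖ < δ := mem_ball_zero_iff.1 hp.1
  have := S.norm_stableGraph_le hp
  rw [stableMap, norm_mul]
  have h2 := S.δ_le
  calc ‖p.1‖ * ‖stableGraph θ p‖ ≤ ‖p.1‖ * (2 * ‖p.1‖ * ‖p.2‖) := by gcongr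
    _ = (2 * ‖p.1‖ ^ 2) * ‖p.2‖ := by ring
    _ ≤ (1 / 2) * ‖p.2‖ := by
      gcongr
      nlinarith [norm_nonneg p.1]
    _ = ‖p.2‖ / 2 := by ring

theorem stableMap_mem {p : ℂ × ℂ} (hp : p ∈ ball (0 : ℂ) δ ×ˢ ball (0 : ℂ) R) :
    (p.1, stableMap θ p) ∈ ball (0 : ℂ) δ ×ˢ ball (0 : ℂ) R := by
  refine ⟨hp.1, mem_ball_zero_iff.2 ((S.norm_stableMap_le hp).trans_lt ?_)⟩
  have h2 : ‖p.2‖ < R := mem_ball_zero_iff.1 hp.2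
  linarith [norm_nonneg p.2]

theorem differentiableOn_stableGraph :
    DifferentiableOn ℂ (stableGraph θ) (ball (0 : ℂ) δ ×ˢ ball (0 : ℂ) R) := by
  have := S.diff
  unfold stableGraph
  fun_prop

theorem differentiableOn_stableMap :
    DifferentiableOn ℂ (stableMap θ) (ball (0 : ℂ) δ ×ˢ ball (0 : ℂ) R) := by
  have := S.differentiableOn_stableGraph
  unfold stableMap
  fun_prop

/-- Invariance of the stable manifold. -/
theorem stableGraph_stableMap {p : ℂ × ℂ} (hp : p ∈ ball (0 : ℂ) δ ×ˢ ball (0 : ℂ) R) :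
    stableGraph θ (p.1, stableMap θ p) =
      (lam + eigenMu lam p.1) * stableGraph θ p + stableGraph θ p ^ 2 + p.1 * p.2 := by
  have h := S.invariance p hp
  have e : stableMap θ p = p.1 ^ 2 * p.2 * θ p := by rw [stableMap, stableGraph]; ring
  rw [e, stableGraph, stableGraph]
  linear_combination (p.1 * p.2) * h

/-- Substitute x = d + X + σ and y = v + aX. The equation of the parameter curve cancels the
constants, and by invariance the terms free of d add up to σ(a, F); subtracting σ at the image point
leaves the formula for D. -/
theorem transCoord_henon (hca : (c, a) ∈ paramCurve lam) {z : ℂ × ℂ}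
    (hz : (a, fibreCoord lam a z) ∈ ball (0 : ℂ) δ ×ˢ ball (0 : ℂ) R) :
    transCoord lam θ a (henon c a z) =
      skewD lam θ (transCoord lam θ a z, (a, fibreCoord lam a z)) := by
  have h := S.stableGraph_stableMap hz
  rw [transCoord, fibreCoord_henon lam c a θ, skewD]
  dsimp only
  rw [h, ← two_mul_fixedPointX]
  have hc : c = (1 - a ^ 2) * fixedPointX lam a - fixedPointX lam a ^ 2 := hca
  have e : z.1 = transCoord lam θ a z + fixedPointX lam a
      + stableGraph θ (a, fibreCoord lam a z) := by rw [transCoord]; ring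
  have e2 : z.2 = fibreCoord lam a z + a * fixedPointX lam a := by rw [fibreCoord]; ring
  set d := transCoord lam θ a z
  set v := fibreCoord lam a z
  rw [henon, hc, e, e2]
  dsimp only
  ring

/-- The displacement is Lipschitz along the fibres. -/
theorem norm_stableGraph_sub_le {a v w : ℂ} (ha : ‖a‖ < δ) (hv : ‖v‖ ≤ R / 2) (hw : ‖w‖ < R) :
    ‖stableGraph θ (a, w) - stableGraph θ (a, v)‖ ≤ 8 * ‖a‖ * ‖w - v‖ := by
  have hR : 0 < R := by linarith [S.one_le_R]
  have hb : ∀ x ∈ ball (0 : ℂ) R, ‖stableGraph θ (a, x)‖ ≤ 2 * ‖a‖ * R := by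
    intro x hx
    have h1 := S.norm_stableGraph_le (p := (a, x)) ⟨mem_ball_zero_iff.2 ha, hx⟩
    have h2 : ‖x‖ < R := mem_ball_zero_iff.1 hx
    refine h1.trans ?_
    dsimp only
    gcongr
  have hsub : ball v (R / 2) ⊆ ball 0 R := ball_subset_ball' (by
    rw [dist_zero_right]; linarith)
  have hd : DifferentiableOn ℂ (fun x => stableGraph θ (a, x)) (ball v (R / 2)) :=
    S.differentiableOn_stableGraph.comp (f := fun x : ℂ => (a, x)) (by fun_prop)
      fun x hx => ⟨mem_ball_zero_iff.2 ha, hsub hx⟩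
  have h := norm_sub_le_of_bounded (half_pos hR) hd (fun x hx => hb x (hsub hx))
    (hb w (mem_ball_zero_iff.2 hw))
  have e : 2 * (2 * ‖a‖ * R) / (R / 2) = 8 * ‖a‖ := by field_simp; ring
  rwa [e] at h

theorem norm_skewV_le {d : ℂ} {p : ℂ × ℂ} (hp : p ∈ ball (0 : ℂ) δ ×ˢ ball (0 : ℂ) R) :
    ‖skewV θ (d, p)‖ ≤ ‖p.1‖ * (1 / 32 + ‖d‖) := by
  rw [skewV]
  dsimp only
  rw [← mul_add, norm_mul]
  gcongr
  exact (norm_add_le _ _).trans (by gcongr; exact S.norm_stableGraph_le' hp)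

/-- `D` is close to `(λ + μ) d`. -/
theorem norm_skewD_sub_le {d : ℂ} {p : ℂ × ℂ} (hp : p ∈ ball (0 : ℂ) δ ×ˢ ball (0 : ℂ) R)
    (hV : ‖skewV θ (d, p)‖ < R) :
    ‖skewD lam θ (d, p) - (lam + eigenMu lam p.1) * d‖ ≤ (1 / 8 + ‖d‖) * ‖d‖ := by
  have h1 : ‖p.1‖ < δ := mem_ball_zero_iff.1 hp.1
  have h2 : ‖p.2‖ < R := mem_ball_zero_iff.1 hp.2
  have hδ := S.δ_le
  have hmap := S.norm_stableMap_le hp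
  have hL := S.norm_stableGraph_sub_le h1 (v := stableMap θ p) (w := skewV θ (d, p))
    (by linarith) hV
  have e1 : skewV θ (d, p) - stableMap θ p = p.1 * d := by
    rw [skewV, stableMap]; ring
  rw [e1, norm_mul] at hL
  have e2 : skewD lam θ (d, p) - (lam + eigenMu lam p.1) * d =
      (2 * stableGraph θ p + d) * d
        - (stableGraph θ (p.1, skewV θ (d, p)) - stableGraph θ (p.1, stableMap θ p)) := by
    rw [skewD]; ring
  rw [e2]
  refine (norm_sub_le _ _).trans ?_
  have h3 : ‖2 * stableGraph θ p + d‖ ≤ 1 / 16 + ‖d‖ := by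
    refine (norm_add_le _ _).trans ?_
    rw [norm_mul, Complex.norm_two]
    linarith [S.norm_stableGraph_le' hp]
  rw [norm_mul]
  calc ‖2 * stableGraph θ p + d‖ * ‖d‖ + _ ≤ (1 / 16 + ‖d‖) * ‖d‖ + 8 * ‖p.1‖ * (‖p.1‖ * ‖d‖) := by
        gcongr
    _ = (1 / 16 + 8 * ‖p.1‖ ^ 2 + ‖d‖) * ‖d‖ := by ring
    _ ≤ (1 / 8 + ‖d‖) * ‖d‖ := by
      gcongr
      nlinarith [norm_nonneg p.1]

/-- Transversally to the stable manifold the contraction is at most by the factor `1/2`. -/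
theorem half_norm_le_skewD {d : ℂ} {p : ℂ × ℂ} (hp : p ∈ ball (0 : ℂ) δ ×ˢ ball (0 : ℂ) R)
    (hd : ‖d‖ ≤ 1 / 8) : ‖d‖ / 2 ≤ ‖skewD lam θ (d, p)‖ := by
  have h1 : ‖p.1‖ < δ := mem_ball_zero_iff.1 hp.1
  have hδ := S.δ_le
  have hV : ‖skewV θ (d, p)‖ < R := by
    refine (S.norm_skewV_le hp).trans_lt ?_
    nlinarith [norm_nonneg p.1, norm_nonneg d, S.one_le_R]
  have h := S.norm_skewD_sub_le hp hV
  have h2 := lam_add_mu_bound S.norm_lam S.one_le_R S.δR_le hp.1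
  have h3 := norm_sub_norm_le ((lam + eigenMu lam p.1) * d) (skewD lam θ (d, p))
  rw [norm_sub_rev, norm_mul] at h3
  nlinarith [norm_nonneg d]

end IsStableSlope

theorem skewV_zero (θ : ℂ × ℂ → ℂ) (p : ℂ × ℂ) : skewV θ (0, p) = stableMap θ p := by
  rw [skewV, stableMap]; simp

theorem skewD_zero (lam : ℂ) (θ : ℂ × ℂ → ℂ) (p : ℂ × ℂ) : skewD lam θ (0, p) = 0 := by
  rw [skewD, skewV_zero]
  simp

end Coordinates

/-! ### The graph is the local stable manifold. -/

section LocalStableManifold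

variable {lam c a : ℂ} {δ R r : ℝ} {θ : ℂ × ℂ → ℂ}

theorem henon_fixedPoint (hca : (c, a) ∈ paramCurve lam) :
    henon c a (fixedPoint lam a) = fixedPoint lam a := by
  have hc : c = (1 - a ^ 2) * fixedPointX lam a - fixedPointX lam a ^ 2 := hca
  rw [henon, fixedPoint, hc]
  ext
  · dsimp only
    ring
  · rfl

/-- Points with bounded forward orbit stay in a bidisk that depends only on `|y|`. -/
theorem norm_iterate_le_of_bounded (ha : ‖a‖ ≤ 1) {B : ℝ} (hB : 3 + ‖c‖ ≤ B) {z : ℂ × ℂ}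
    (hy : ‖z.2‖ ≤ B) {M : ℝ} (hM : ∀ m, ‖(henon c a)^[m] z‖ ≤ M) (m : ℕ) :
    ‖(henon c a)^[m] z‖ ≤ B := by
  -- The region |x| > B, |y| ≤ |x| is forward invariant and |x| at least doubles in it: B ≥ 3 + |c|
  -- gives |x|² - |c| - |x| ≥ 2|x|.
  have hesc : ∀ w : ℂ × ℂ, B < ‖w.1‖ → ‖w.2‖ ≤ ‖w.1‖ → ∀ n : ℕ,
      B < ‖((henon c a)^[n] w).1‖ ∧ ‖((henon c a)^[n] w).2‖ ≤ ‖((henon c a)^[n] w).1‖ ∧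
        2 ^ n ≤ ‖((henon c a)^[n] w).1‖ := by
    intro w hw hw2 n
    induction n with
    | zero =>
      refine ⟨hw, hw2, ?_⟩
      simp only [pow_zero, Function.iterate_zero, id_eq]
      linarith [norm_nonneg c]
    | succ n ih =>
      rw [Function.iterate_succ_apply']
      obtain ⟨i1, i2, i3⟩ := ih
      set x := (henon c a)^[n] w
      have hc := norm_nonneg c
      have h1 : ‖x.1‖ ^ 2 - ‖c‖ - ‖x.2‖ ≤ ‖(henon c a x).1‖ := by
        have e : x.1 ^ 2 = (henon c a x).1 - c - a * x.2 := by rw [henon]; ring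
        have h2 := (norm_sub_le ((henon c a x).1 - c) (a * x.2)).trans
          (add_le_add_left (norm_sub_le _ _) _)
        rw [← e, norm_pow, norm_mul] at h2
        nlinarith [norm_nonneg x.2]
      have h2 : 2 * ‖x.1‖ ≤ ‖(henon c a x).1‖ := by nlinarith
      refine ⟨by linarith, ?_, ?_⟩
      · rw [henon] at h2 ⊢
        dsimp only at h2 ⊢
        rw [norm_mul]
        nlinarith [norm_nonneg x.1]
      · rw [pow_succ]; linarith
  have hx : ∀ n, ‖((henon c a)^[n] z).2‖ ≤ B → ‖((henon c a)^[n] z).1‖ ≤ B := by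
    intro n hn
    by_contra! h
    obtain ⟨k, hk⟩ := pow_unbounded_of_one_lt M (one_lt_two)
    have h1 := (hesc _ h (hn.trans h.le) k).2.2
    rw [← Function.iterate_add_apply] at h1
    have h2 := (norm_fst_le _).trans (hM (k + n))
    linarith
  have hall : ∀ n, ‖((henon c a)^[n] z).2‖ ≤ B := by
    intro n
    induction n with
    | zero => exact hy
    | succ n ih =>
      rw [Function.iterate_succ_apply', henon]
      dsimp only
      rw [norm_mul]
      have := hx n ih
      nlinarith [norm_nonneg ((henon c a)^[n] z).1]
  rw [Prod.norm_def]
  exact max_le (hx m (hall m)) (hall m)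

theorem differentiable_henon (c a : ℂ) : Differentiable ℂ (henon c a) := by
  unfold henon
  fun_prop

theorem norm_fixedPointX_le (hlam : ‖lam‖ = 1) (ha : ‖a‖ ≤ 1) : ‖fixedPointX lam a‖ ≤ 1 := by
  have h : 2 * fixedPointX lam a = lam + eigenMu lam a := two_mul_fixedPointX lam a
  have h1 : ‖2 * fixedPointX lam a‖ ≤ 2 := by
    rw [h]
    refine (norm_add_le _ _).trans ?_
    rw [norm_eigenMu hlam, hlam]
    nlinarith [norm_nonneg a]
  rw [norm_mul, Complex.norm_two] at h1
  linarith

namespace IsStableSlope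

variable (S : IsStableSlope lam δ R θ)
include S

theorem fibreCoord_mem (hrR : r + 1 ≤ R) (ha : ‖a‖ < δ) {z : ℂ × ℂ} (hz : ‖z.2‖ < r) :
    (a, fibreCoord lam a z) ∈ ball (0 : ℂ) δ ×ˢ ball (0 : ℂ) R := by
  have hδ := S.δ_le
  have ha1 : ‖a‖ ≤ 1 := by linarith
  refine ⟨mem_ball_zero_iff.2 ha, mem_ball_zero_iff.2 ?_⟩
  rw [fibreCoord]
  refine (norm_sub_le _ _).trans_lt ?_
  rw [norm_mul]
  have := norm_fixedPointX_le S.norm_lam ha1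
  nlinarith [norm_nonneg a, norm_nonneg (fixedPointX lam a)]

/-- Near the fixed point, the strong stable manifold lies on the graph `d = 0`. -/
theorem transCoord_eq_zero_of_near (hca : (c, a) ∈ paramCurve lam) (ha : ‖a‖ < δ) {z : ℂ × ℂ}
    (hz : z ∈ stableManifold lam c a)
    (hnear : ∀ m, ‖(henon c a)^[m] z - fixedPoint lam a‖ ≤ 1 / 16) :
    transCoord lam θ a z = 0 := by
  obtain ⟨M, hM⟩ := hz
  have hδ := S.δ_le
  have hfib : ∀ w : ℂ × ℂ, ‖fibreCoord lam a w‖ ≤ ‖w - fixedPoint lam a‖ := fun w => by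
    have : fibreCoord lam a w = (w - fixedPoint lam a).2 := by
      rw [fibreCoord, Prod.snd_sub, fixedPoint]
    rw [this]
    exact norm_snd_le _
  have hmem : ∀ w : ℂ × ℂ, ‖w - fixedPoint lam a‖ ≤ 1 / 16 →
      (a, fibreCoord lam a w) ∈ ball (0 : ℂ) δ ×ˢ ball (0 : ℂ) R := fun w hw =>
    ⟨mem_ball_zero_iff.2 ha, mem_ball_zero_iff.2 (by linarith [hfib w, S.one_le_R])⟩
  have htr : ∀ w : ℂ × ℂ, ‖w - fixedPoint lam a‖ ≤ 1 / 16 →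
      ‖transCoord lam θ a w‖ ≤ 2 * ‖w - fixedPoint lam a‖ := by
    intro w hw
    have e : transCoord lam θ a w =
        (w - fixedPoint lam a).1 - stableGraph θ (a, fibreCoord lam a w) := by
      rw [transCoord, Prod.fst_sub, fixedPoint]
    rw [e]
    refine (norm_sub_le _ _).trans ?_
    have h1 := S.norm_stableGraph_le (hmem w hw)
    have h2 := hfib w
    have h3 := norm_fst_le (w - fixedPoint lam a)
    dsimp only at h1
    nlinarith [norm_nonneg a, norm_nonneg (fibreCoord lam a w)]
  -- Near the fixed point d loses at most a factor 2 per step, while the orbit converges at rate |μ|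
  -- = |a|² < 1/2. Both hold for all times only if d = 0.
  have hgrow : ∀ m : ℕ, ‖transCoord lam θ a z‖ * (1 / 2) ^ m
      ≤ ‖transCoord lam θ a ((henon c a)^[m] z)‖ := by
    intro m
    induction m with
    | zero => simp
    | succ m ih =>
      rw [Function.iterate_succ_apply']
      have h0 := hnear m
      set w := (henon c a)^[m] z
      have h1 := S.half_norm_le_skewD (d := transCoord lam θ a w) (hmem w h0)
        (by linarith [htr w h0])
      rw [← S.transCoord_henon hca (hmem w h0)] at h1
      rw [pow_succ]
      linarith
  have hup : ∀ m : ℕ, ‖transCoord lam θ a z‖ ≤ 2 * M * (2 * ‖eigenMu lam a‖) ^ m := by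
    intro m
    have h1 := (hgrow m).trans ((htr _ (hnear m)).trans
      (mul_le_mul_of_nonneg_left (hM m) zero_le_two))
    have h2 : (0 : ℝ) < (1 / 2) ^ m := by positivity
    have h3 : (2 : ℝ) ^ m * (1 / 2) ^ m = 1 := by rw [← mul_pow]; norm_num
    calc ‖transCoord lam θ a z‖ = ‖transCoord lam θ a z‖ * (1 / 2) ^ m * 2 ^ m := by
          rw [mul_assoc, mul_comm ((1 / 2 : ℝ) ^ m), h3, mul_one]
      _ ≤ 2 * (M * ‖eigenMu lam a‖ ^ m) * 2 ^ m := by gcongr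
      _ = 2 * M * (2 * ‖eigenMu lam a‖) ^ m := by rw [mul_pow]; ring
  have hlt : 2 * ‖eigenMu lam a‖ < 1 := by
    rw [norm_eigenMu S.norm_lam]
    nlinarith [norm_nonneg a]
  have hlim : Tendsto (fun m : ℕ => 2 * M * (2 * ‖eigenMu lam a‖) ^ m) atTop (𝓝 0) := by
    simpa using (tendsto_pow_atTop_nhds_zero_of_lt_one (by positivity) hlt).const_mul (2 * M)
  exact norm_le_zero_iff.1 (ge_of_tendsto' hlim hup)

theorem differentiableOn_transCoord_comp (hrR : r + 1 ≤ R) (ha : ‖a‖ < δ) {U : Set ℂ}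
    {u : ℂ → ℂ × ℂ} (hu : DifferentiableOn ℂ u U) (hmaps : ∀ s ∈ U, ‖(u s).2‖ < r) :
    DifferentiableOn ℂ (fun s => transCoord lam θ a (u s)) U := by
  have h1 : DifferentiableOn ℂ (fun s => stableGraph θ (a, fibreCoord lam a (u s))) U :=
    S.differentiableOn_stableGraph.comp (f := fun s => (a, fibreCoord lam a (u s)))
      (by unfold fibreCoord; fun_prop) fun s hs => S.fibreCoord_mem hrR ha (hmaps s hs)
  unfold transCoord
  fun_prop

/-- Orbits of points on the curve obey a common bound, although the constants in the definition of
the stable manifold may vary from point to point. By Schwarz the iterates of the curve are then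
equi-Lipschitz at the parameter of the fixed point, so nearby points keep within 1/16 of it forever
and have d = 0. The identity theorem carries d = 0 along the connected parameter domain. -/
theorem localStableManifold_subset (hrR : r + 1 ≤ R) (hr : 0 < r) (hca : (c, a) ∈ paramCurve lam)
    (ha : ‖a‖ < δ) :
    localStableManifold lam c a r ⊆ {z | ‖z.2‖ < r ∧ transCoord lam θ a z = 0} := by
  rintro z ⟨U, u, hU, hUc, hu, hmaps, s, hs, t, ht, hus, rfl⟩
  have hδ := S.δ_le
  have hdiff := S.differentiableOn_transCoord_comp hrR ha hu fun s hs => (hmaps hs).2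
  refine ⟨(hmaps ht).2, ?_⟩
  suffices hnear : ∀ᶠ s' in 𝓝 s, transCoord lam θ a (u s') = 0 from
    (hdiff.analyticOnNhd hU).eqOn_zero_of_preconnected_of_eventuallyEq_zero
      hUc.isPreconnected hs hnear ht
  obtain ⟨η, hη, hηU⟩ := Metric.isOpen_iff.1 hU s hs
  obtain ⟨B, hB⟩ : ∃ B, B = max r (3 + ‖c‖) := ⟨_, rfl⟩
  have hBr : r ≤ B := hB ▸ le_max_left _ _
  have hBc : 3 + ‖c‖ ≤ B := hB ▸ le_max_right _ _
  have hB0 : 0 < B := by linarith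
  have hbd : ∀ s' ∈ U, ∀ m, ‖(henon c a)^[m] (u s')‖ ≤ B := by
    intro s' hs' m
    obtain ⟨⟨M, hM⟩, hy⟩ := hmaps hs'
    refine norm_iterate_le_of_bounded (by linarith) hBc (le_trans (le_of_lt hy) hBr)
      (M := |M| + ‖fixedPoint lam a‖) (fun m => ?_) m
    have h1 := norm_le_norm_sub_add ((henon c a)^[m] (u s')) (fixedPoint lam a)
    have h2 : M * ‖eigenMu lam a‖ ^ m ≤ |M| := by
      have h3 : ‖eigenMu lam a‖ ^ m ≤ 1 := pow_le_one₀ (norm_nonneg _) (by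
        rw [norm_eigenMu S.norm_lam]; nlinarith [norm_nonneg a])
      calc M * ‖eigenMu lam a‖ ^ m ≤ |M| * ‖eigenMu lam a‖ ^ m := by gcongr; exact le_abs_self M
        _ ≤ |M| * 1 := by gcongr
        _ = |M| := mul_one _
    linarith [hM m]
  have hball : ball s (min η (η / (32 * B))) ∈ 𝓝 s := ball_mem_nhds s (by positivity)
  filter_upwards [hball] with s' hs'
  have hs'η : s' ∈ ball s η := ball_subset_ball (min_le_left _ _) hs'
  refine S.transCoord_eq_zero_of_near hca ha (hmaps (hηU hs'η)).1 fun m => ?_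
  have hdm : DifferentiableOn ℂ (fun x => (henon c a)^[m] (u x)) (ball s η) :=
    ((differentiable_henon c a).iterate m).comp_differentiableOn (hu.mono hηU)
  have h := norm_sub_le_of_bounded hη hdm (fun x hx => hbd x (hηU hx) m)
    (hbd s' (hηU hs'η) m)
  rw [hus, Function.iterate_fixed (henon_fixedPoint hca)] at h
  refine h.trans ?_
  have h2 : ‖s' - s‖ ≤ η / (32 * B) :=
    ((mem_ball_iff_norm.1 hs').le).trans (min_le_right _ _)
  calc 2 * B / η * ‖s' - s‖ ≤ 2 * B / η * (η / (32 * B)) := by gcongr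
    _ = 1 / 16 := by field_simp; norm_num

/-- The graph `d = 0` lies in the strong stable manifold. -/
theorem mem_stableManifold {R' δ' : ℝ} (hR' : R' ≤ R) (hrR : r + 1 ≤ R') (hδ' : δ' ≤ δ)
    (ha : ‖a‖ < δ') (hca : (c, a) ∈ paramCurve lam) {u : ℂ × ℂ → ℂ}
    (hu : DifferentiableOn ℂ u (ball (0 : ℂ) δ' ×ˢ ball (0 : ℂ) R')) (hu0 : ∀ p, u p ≠ 0)
    (hinv : ∀ p ∈ ball (0 : ℂ) δ' ×ˢ ball (0 : ℂ) R',
      u (p.1, stableMap θ p) * (-lam * θ p) = u p)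
    {z : ℂ × ℂ} (hz : ‖z.2‖ < r) (hd : transCoord lam θ a z = 0) :
    z ∈ stableManifold lam c a := by
  have hδ := S.δ_le
  have haδ : ‖a‖ < δ := ha.trans_le hδ'
  have hlam0 : lam ≠ 0 := by
    rintro rfl
    simpa using S.norm_lam
  have hR'0 : 0 < R' := by linarith [norm_nonneg z.2]
  have hv0 : ‖fibreCoord lam a z‖ < R' := by
    have ha1 : ‖a‖ ≤ 1 := by linarith
    rw [fibreCoord]
    refine (norm_sub_le _ _).trans_lt ?_
    rw [norm_mul]
    have := norm_fixedPointX_le S.norm_lam ha1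
    nlinarith [norm_nonneg a, norm_nonneg (fixedPointX lam a)]
  set v : ℕ → ℂ := fun m => fibreCoord lam a ((henon c a)^[m] z) with hv
  -- Since F = a²vθ = μ v (-λθ), the equation for `u` makes v u(a, v) exactly linear: each step
  -- multiplies it by μ. As `u` is nonzero and continuous at the limit point, v itself decays like
  -- |μ|^m.
  have hmain : ∀ m, transCoord lam θ a ((henon c a)^[m] z) = 0 ∧ ‖v m‖ ≤ ‖v 0‖ * (1 / 2) ^ m ∧
      v m * u (a, v m) = eigenMu lam a ^ m * (v 0 * u (a, v 0)) := by
    intro m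
    induction m with
    | zero => simpa using hd
    | succ m ih =>
      obtain ⟨i1, i2, i3⟩ := ih
      have hvm : ‖v m‖ < R' := i2.trans_lt (lt_of_le_of_lt
        (mul_le_of_le_one_right (norm_nonneg _) (pow_le_one₀ (by norm_num) (by norm_num))) hv0)
      have hmem' : (a, v m) ∈ ball (0 : ℂ) δ' ×ˢ ball (0 : ℂ) R' :=
        ⟨mem_ball_zero_iff.2 ha, mem_ball_zero_iff.2 hvm⟩
      have hmem : (a, v m) ∈ ball (0 : ℂ) δ ×ˢ ball (0 : ℂ) R :=
        ⟨ball_subset_ball hδ' hmem'.1, ball_subset_ball hR' hmem'.2⟩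
      have hvs : v (m + 1) = stableMap θ (a, v m) := by
        simp only [hv]
        rw [Function.iterate_succ_apply', fibreCoord_henon lam c a θ, i1, skewV_zero]
      refine ⟨?_, ?_, ?_⟩
      · rw [Function.iterate_succ_apply', S.transCoord_henon hca hmem, i1, skewD_zero]
      · rw [hvs, pow_succ]
        have := S.norm_stableMap_le hmem
        dsimp only at this
        linarith
      · have h := hinv _ hmem'
        dsimp only at h
        rw [hvs, pow_succ, mul_assoc, mul_left_comm, ← i3]
        have e : stableMap θ (a, v m) = eigenMu lam a * (v m * (-lam * θ (a, v m))) := by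
          rw [stableMap, stableGraph, eigenMu]
          field_simp
        have e2 : stableMap θ (a, v m) * u (a, stableMap θ (a, v m)) =
            eigenMu lam a * (v m * (u (a, stableMap θ (a, v m)) * (-lam * θ (a, v m)))) := by
          conv_lhs => rw [mul_comm]; arg 2; rw [e]
          ring
        rw [e2, h]
  have hvlim : Tendsto v atTop (𝓝 0) := by
    refine squeeze_zero_norm (fun m => (hmain m).2.1) ?_
    simpa using (tendsto_pow_atTop_nhds_zero_of_lt_one (r := (1 / 2 : ℝ)) (by norm_num)
      (by norm_num)).const_mul ‖v 0‖
  have h0mem : ((a, 0) : ℂ × ℂ) ∈ ball (0 : ℂ) δ' ×ˢ ball (0 : ℂ) R' :=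
    ⟨mem_ball_zero_iff.2 ha, mem_ball_self hR'0⟩
  have hulim : Tendsto (fun m => (u (a, v m))⁻¹) atTop (𝓝 (u (a, 0))⁻¹) := by
    have hc : ContinuousAt u (a, 0) :=
      (hu.differentiableAt ((isOpen_ball.prod isOpen_ball).mem_nhds h0mem)).continuousAt
    exact (hc.tendsto.comp (tendsto_const_nhds.prodMk_nhds hvlim)).inv₀ (hu0 _)
  obtain ⟨M, hM⟩ := (hulim.norm.bddAbove_range)
  refine ⟨M * ‖v 0 * u (a, v 0)‖, fun m => ?_⟩
  obtain ⟨i1, i2, i3⟩ := hmain m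
  have hMm : ‖(u (a, v m))⁻¹‖ ≤ M := hM ⟨m, rfl⟩
  have hvm : ‖v m‖ ≤ M * ‖v 0 * u (a, v 0)‖ * ‖eigenMu lam a‖ ^ m := by
    have e : v m = (u (a, v m))⁻¹ * (eigenMu lam a ^ m * (v 0 * u (a, v 0))) := by
      rw [← i3]
      field_simp [hu0 (a, v m)]
    rw [e, norm_mul, norm_mul, norm_pow]
    calc ‖(u (a, v m))⁻¹‖ * (‖eigenMu lam a‖ ^ m * ‖v 0 * u (a, v 0)‖)
        ≤ M * (‖eigenMu lam a‖ ^ m * ‖v 0 * u (a, v 0)‖) := by gcongr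
      _ = _ := by ring
  have hvm' : ‖v m‖ < R := by
    refine (i2.trans_lt (lt_of_le_of_lt
      (mul_le_of_le_one_right (norm_nonneg _) (pow_le_one₀ (by norm_num) (by norm_num))) hv0)).trans_le hR'
  have hσ := S.norm_stableGraph_le (p := (a, v m))
    ⟨mem_ball_zero_iff.2 haδ, mem_ball_zero_iff.2 hvm'⟩
  refine le_trans ?_ hvm
  have e1 : ((henon c a)^[m] z - fixedPoint lam a).2 = v m := by
    simp only [hv]
    rw [fibreCoord, Prod.snd_sub, fixedPoint]
  have e2 : ((henon c a)^[m] z - fixedPoint lam a).1 = stableGraph θ (a, v m) := by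
    rw [Prod.fst_sub, fixedPoint]
    rw [transCoord] at i1
    linear_combination i1
  rw [Prod.norm_def, e1, e2]
  refine max_le ?_ le_rfl
  dsimp only at hσ
  nlinarith [norm_nonneg a, norm_nonneg (v m)]

/-- For the reverse inclusion the graph itself, parametrized by y in the disk of radius r, is a
curve of the required kind from the fixed point to z. -/
theorem localStableManifold_eq {R' δ' : ℝ} (hr : 1 ≤ r) (hR' : R' ≤ R) (hrR : r + 1 ≤ R')
    (hδ' : δ' ≤ δ) (ha : ‖a‖ < δ') (hca : (c, a) ∈ paramCurve lam) {u : ℂ × ℂ → ℂ}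
    (hu : DifferentiableOn ℂ u (ball (0 : ℂ) δ' ×ˢ ball (0 : ℂ) R')) (hu0 : ∀ p, u p ≠ 0)
    (hinv : ∀ p ∈ ball (0 : ℂ) δ' ×ˢ ball (0 : ℂ) R',
      u (p.1, stableMap θ p) * (-lam * θ p) = u p) :
    localStableManifold lam c a r = {z | ‖z.2‖ < r ∧ transCoord lam θ a z = 0} := by
  have haδ : ‖a‖ < δ := ha.trans_le hδ'
  have hδ := S.δ_le
  refine Subset.antisymm (S.localStableManifold_subset (hrR.trans hR') (by linarith) hca haδ) ?_
  rintro z ⟨hzr, hzd⟩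
  set s₀ := a * fixedPointX lam a
  have hs₀ : ‖s₀‖ < r := by
    have := norm_fixedPointX_le S.norm_lam (a := a) (by linarith)
    rw [norm_mul]
    nlinarith [norm_nonneg a, norm_nonneg (fixedPointX lam a)]
  set w : ℂ → ℂ × ℂ := fun s => (fixedPointX lam a + stableGraph θ (a, s - s₀), s) with hw
  have hfib : ∀ s, fibreCoord lam a (w s) = s - s₀ := fun s => rfl
  refine ⟨ball 0 r, w, isOpen_ball, (convex_ball 0 r).isConnected ⟨0, mem_ball_self (by linarith)⟩,
    ?_, fun s hs => ?_, s₀, mem_ball_zero_iff.2 hs₀, z.2, mem_ball_zero_iff.2 hzr, ?_, ?_⟩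
  · have h1 : DifferentiableOn ℂ (fun s => stableGraph θ (a, s - s₀)) (ball 0 r) :=
      S.differentiableOn_stableGraph.comp (f := fun s => (a, s - s₀)) (by fun_prop) fun s hs =>
        S.fibreCoord_mem (z := ((0 : ℂ), s)) (hrR.trans hR') haδ (mem_ball_zero_iff.1 hs)
    fun_prop
  · have hs' : ‖(w s).2‖ < r := mem_ball_zero_iff.1 hs
    refine ⟨S.mem_stableManifold hR' hrR hδ' ha hca hu hu0 hinv hs' ?_, hs'⟩
    rw [transCoord, hfib]
    simp only [hw]
    ring
  · simp [hw, s₀, stableGraph, fixedPoint]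
  · ext
    · rw [transCoord] at hzd
      simp only [hw]
      have : z.2 - s₀ = fibreCoord lam a z := rfl
      rw [this]
      linear_combination -hzd
    · rfl

end IsStableSlope

end LocalStableManifold

end SemiParabolicHenon

namespace SemiParabolicHenon

/-! ### The Hénon family as a skew system. -/

section HenonSkewSystem

variable {lam c a : ℂ} {δ R : ℝ} {θ : ℂ × ℂ → ℂ}

/-- The normalized multiplier of the Hénon map transversal to the stable manifold. -/
noncomputable def transFactor (lam : ℂ) (θ : ℂ × ℂ → ℂ) (p : ℂ × ℂ) : ℂ :=
  lam⁻¹ * (lam + eigenMu lam p.1 + 2 * stableGraph θ p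
    - p.1 * fderiv ℂ (stableGraph θ) (p.1, stableMap θ p) (0, 1))

theorem differentiable_eigenMu (lam : ℂ) : Differentiable ℂ (eigenMu lam) := by
  unfold eigenMu
  fun_prop

theorem differentiable_fixedPointX (lam : ℂ) : Differentiable ℂ (fixedPointX lam) := by
  unfold fixedPointX
  fun_prop

namespace IsStableSlope

variable (S : IsStableSlope lam δ R θ)
include S

theorem mono {δ' : ℝ} (hδ' : 0 < δ') (h : δ' ≤ δ) : IsStableSlope lam δ' R θ where
  norm_lam := S.norm_lam
  δ_pos := hδ'
  one_le_R := S.one_le_R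
  δR_le := le_trans (mul_le_mul_of_nonneg_right h (by linarith [S.one_le_R])) S.δR_le
  diff := S.diff.mono (prod_mono (ball_subset_ball h) subset_rfl)
  norm_le := fun p hp => S.norm_le p ⟨ball_subset_ball h hp.1, hp.2⟩
  invariance := fun p hp => S.invariance p ⟨ball_subset_ball h hp.1, hp.2⟩
  zero_left := S.zero_left
  zero_right := fun a ha => S.zero_right a (ball_subset_ball h ha)

theorem lam_ne_zero : lam ≠ 0 := by
  rintro rfl
  simpa using S.norm_lam

theorem differentiableOn_transFactor :
    DifferentiableOn ℂ (transFactor lam θ) (ball (0 : ℂ) δ ×ˢ ball (0 : ℂ) R) := by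
  have h1 := S.differentiableOn_stableGraph
  have h2 := S.differentiableOn_stableMap
  have h3 : DifferentiableOn ℂ
      (fun p : ℂ × ℂ => fderiv ℂ (stableGraph θ) (p.1, stableMap θ p) (0, 1))
      (ball (0 : ℂ) δ ×ˢ ball (0 : ℂ) R) :=
    (differentiableOn_fderiv_apply (isOpen_ball.prod isOpen_ball) h1 (0, 1)).comp
      (f := fun p : ℂ × ℂ => (p.1, stableMap θ p)) (by fun_prop) fun p hp => S.stableMap_mem hp
  have h4 : DifferentiableOn ℂ (fun p : ℂ × ℂ => eigenMu lam p.1)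
      (ball (0 : ℂ) δ ×ˢ ball (0 : ℂ) R) :=
    ((differentiable_eigenMu lam).comp differentiable_fst).differentiableOn
  unfold transFactor
  fun_prop

theorem hasFDerivAt_stableGraph {p : ℂ × ℂ} (hp : p ∈ ball (0 : ℂ) δ ×ˢ ball (0 : ℂ) R) :
    HasFDerivAt (stableGraph θ) (fderiv ℂ (stableGraph θ) p) p :=
  (S.differentiableOn_stableGraph.differentiableAt
    ((isOpen_ball.prod isOpen_ball).mem_nhds hp)).hasFDerivAt

theorem hasDerivAt_skewD {p : ℂ × ℂ} (hp : p ∈ ball (0 : ℂ) δ ×ˢ ball (0 : ℂ) R) :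
    HasDerivAt (fun d => skewD lam θ (d, p)) (lam * transFactor lam θ p) 0 := by
  have hV : HasDerivAt (fun d => skewV θ (d, p)) p.1 0 := by
    have := ((hasDerivAt_id (0 : ℂ)).const_mul p.1).const_add (p.1 * stableGraph θ p)
    simpa [skewV] using this
  have hin : HasDerivAt (fun d => (p.1, skewV θ (d, p))) ((0 : ℂ), p.1) 0 :=
    (hasDerivAt_const _ _).prodMk hV
  have hσ := S.hasFDerivAt_stableGraph (S.stableMap_mem hp)
  have h1 : HasDerivAt (fun d => stableGraph θ (p.1, skewV θ (d, p)))
      (fderiv ℂ (stableGraph θ) (p.1, skewV θ (0, p)) ((0 : ℂ), p.1)) 0 := by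
    rw [← skewV_zero] at hσ
    exact hσ.comp_hasDerivAt (0 : ℂ) hin
  have e : ((0 : ℂ), p.1) = p.1 • ((0 : ℂ), (1 : ℂ)) := by simp
  rw [e, map_smul, smul_eq_mul, skewV_zero] at h1
  have h2 : HasDerivAt (fun d : ℂ => d * (lam + eigenMu lam p.1 + 2 * stableGraph θ p + d))
      (1 * (lam + eigenMu lam p.1 + 2 * stableGraph θ p + 0) + 0 * 1) 0 :=
    (hasDerivAt_id (0 : ℂ)).mul ((hasDerivAt_id (0 : ℂ)).const_add _)
  have h3 := h2.sub (h1.sub_const (stableGraph θ (p.1, stableMap θ p)))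
  have hlam0 := S.lam_ne_zero
  refine h3.congr_deriv ?_
  rw [transFactor]
  field_simp
  ring

theorem transFactor_zero_left {v : ℂ} : transFactor lam θ (0, v) = 1 := by
  have := S.lam_ne_zero
  simp [transFactor, eigenMu, stableGraph, this]

/-- At the fixed point the transversal multiplier must be λ: with ∂σ/∂v = aθ(a, 0) = -a/λ, the term
-a ∂σ/∂v = a²/λ cancels μ. -/
theorem transFactor_zero_right {a : ℂ} (ha : a ∈ ball (0 : ℂ) δ) :
    transFactor lam θ (a, 0) = 1 := by
  have hR : 0 < R := by linarith [S.one_le_R]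
  have hlam0 := S.lam_ne_zero
  have hp : (a, (0 : ℂ)) ∈ ball (0 : ℂ) δ ×ˢ ball (0 : ℂ) R := ⟨ha, mem_ball_self hR⟩
  have hin : HasDerivAt (fun v : ℂ => (a, v)) ((0 : ℂ), (1 : ℂ)) 0 :=
    (hasDerivAt_const _ _).prodMk (hasDerivAt_id _)
  have h1 : HasDerivAt (fun v => stableGraph θ (a, v))
      (fderiv ℂ (stableGraph θ) (a, 0) ((0 : ℂ), (1 : ℂ))) 0 :=
    HasFDerivAt.comp_hasDerivAt (0 : ℂ) (S.hasFDerivAt_stableGraph hp) hin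
  have hθ : DifferentiableAt ℂ (fun v => θ (a, v)) 0 :=
    DifferentiableAt.comp (0 : ℂ) (f := fun v : ℂ => (a, v))
      (S.diff.differentiableAt ((isOpen_ball.prod isOpen_ball).mem_nhds hp)) hin.differentiableAt
  have h2 : HasDerivAt (fun v => a * v * θ (a, v))
      (a * 1 * θ (a, 0) + a * 0 * deriv (fun v => θ (a, v)) 0) 0 :=
    ((hasDerivAt_id (0 : ℂ)).const_mul a).mul hθ.hasDerivAt
  have h3 := h1.unique h2
  have e : stableMap θ (a, 0) = 0 := by simp [stableMap, stableGraph]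
  rw [transFactor]
  dsimp only
  rw [e, h3, S.zero_right a ha, eigenMu]
  simp only [stableGraph]
  field_simp
  ring

theorem differentiableOn_skewV :
    DifferentiableOn ℂ (skewV θ) (univ ×ˢ (ball (0 : ℂ) δ ×ˢ ball (0 : ℂ) R)) := by
  have h1 : DifferentiableOn ℂ (fun x : ℂ × (ℂ × ℂ) => stableGraph θ x.2)
      (univ ×ˢ (ball (0 : ℂ) δ ×ˢ ball (0 : ℂ) R)) :=
    S.differentiableOn_stableGraph.comp (by fun_prop) fun x hx => hx.2
  unfold skewV
  fun_prop

theorem differentiableOn_skewD {Ω : Set (ℂ × (ℂ × ℂ))}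
    (hΩ : Ω ⊆ univ ×ˢ (ball (0 : ℂ) δ ×ˢ ball (0 : ℂ) R)) (hV : ∀ x ∈ Ω, ‖skewV θ x‖ < R) :
    DifferentiableOn ℂ (skewD lam θ) Ω := by
  have h0 := S.differentiableOn_skewV.mono hΩ
  have h1 : DifferentiableOn ℂ (fun x : ℂ × (ℂ × ℂ) => stableGraph θ x.2) Ω :=
    S.differentiableOn_stableGraph.comp (by fun_prop) fun x hx => (hΩ hx).2
  have h2 : DifferentiableOn ℂ (fun x : ℂ × (ℂ × ℂ) => stableGraph θ (x.2.1, skewV θ x)) Ω :=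
    S.differentiableOn_stableGraph.comp (f := fun x : ℂ × (ℂ × ℂ) => (x.2.1, skewV θ x))
      (by fun_prop) fun x hx => ⟨(hΩ hx).2.1, mem_ball_zero_iff.2 (hV x hx)⟩
  have h2' : DifferentiableOn ℂ (fun x : ℂ × (ℂ × ℂ) => stableMap θ x.2) Ω :=
    S.differentiableOn_stableMap.comp (by fun_prop) fun x hx => (hΩ hx).2
  have h3 : DifferentiableOn ℂ (fun x : ℂ × (ℂ × ℂ) => stableGraph θ (x.2.1, stableMap θ x.2)) Ω :=
    S.differentiableOn_stableGraph.comp (f := fun x : ℂ × (ℂ × ℂ) => (x.2.1, stableMap θ x.2))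
      (by fun_prop) fun x hx => S.stableMap_mem (p := x.2) (hΩ hx).2
  have h4 : DifferentiableOn ℂ (fun x : ℂ × (ℂ × ℂ) => eigenMu lam x.2.1) Ω :=
    ((differentiable_eigenMu lam).comp
      (differentiable_fst.comp differentiable_snd)).differentiableOn
  unfold skewD
  fun_prop

/-- The size of ε keeps `base` applicable to D: |λ + μ| ≤ 5/4, and D differs from (λ + μ)d by at
most (1/8 + 1/2)|d|, so |D| ≤ (15/8)|d| < 2ε ≤ ρ₁. -/
theorem skewSystem {R' ε ρ₁ : ℝ} {base : ℂ → ℂ} {β₀ : ℂ} {u : ℂ × ℂ → ℂ} (hR1 : 1 ≤ R')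
    (hR' : R' ≤ R) (hε : 0 < ε) (hε2 : ε ≤ 1 / 2) (hερ : 2 * ε ≤ ρ₁)
    (hbase : DifferentiableOn ℂ base (ball 0 ρ₁)) (hb0 : base 0 = 0)
    (hb1 : HasDerivAt base β₀ 0) (hβ₀ : β₀ ≠ 0)
    (hu : DifferentiableOn ℂ u (ball (0 : ℂ) δ ×ˢ ball (0 : ℂ) R')) (hu0 : ∀ p, u p ≠ 0)
    (hinv : ∀ p ∈ ball (0 : ℂ) δ ×ˢ ball (0 : ℂ) R',
      u (p.1, stableMap θ p) * transFactor lam θ p = u p) :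
    SkewSystem lam δ R' ε β₀ base (fun x => base (skewD lam θ x)) (skewV θ) (stableMap θ) u := by
  have hδ := S.δ_le
  have hsub : ball (0 : ℂ) δ ×ˢ ball (0 : ℂ) R' ⊆ ball (0 : ℂ) δ ×ˢ ball (0 : ℂ) R :=
    prod_mono subset_rfl (ball_subset_ball hR')
  have hV : ∀ x ∈ ball (0 : ℂ) ε ×ˢ (ball (0 : ℂ) δ ×ˢ ball (0 : ℂ) R'), ‖skewV θ x‖ < R' := by
    rintro ⟨d, p⟩ ⟨hd, hp⟩
    have hd' : ‖d‖ < ε := mem_ball_zero_iff.1 hd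
    have hp1 : ‖p.1‖ < δ := mem_ball_zero_iff.1 hp.1
    refine (S.norm_skewV_le (hsub hp)).trans_lt ?_
    nlinarith [norm_nonneg p.1, norm_nonneg d]
  have hDm : MapsTo (skewD lam θ) (ball (0 : ℂ) ε ×ˢ (ball (0 : ℂ) δ ×ˢ ball (0 : ℂ) R'))
      (ball 0 ρ₁) := by
    rintro ⟨d, p⟩ hx
    have hd' : ‖d‖ < ε := mem_ball_zero_iff.1 hx.1
    have hp1 : ‖p.1‖ < δ := mem_ball_zero_iff.1 hx.2.1
    have h1 := S.norm_skewD_sub_le (hsub hx.2) ((hV _ hx).trans_le hR')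
    have h2 := norm_le_norm_sub_add (skewD lam θ (d, p)) ((lam + eigenMu lam p.1) * d)
    have h3 : ‖lam + eigenMu lam p.1‖ ≤ 1 + 1 / 4 := by
      refine (norm_add_le _ _).trans ?_
      rw [S.norm_lam, norm_eigenMu S.norm_lam]
      nlinarith [norm_nonneg p.1]
    rw [norm_mul] at h2
    rw [mem_ball_zero_iff]
    nlinarith [norm_nonneg d]
  refine ⟨S.δ_pos, by linarith, hε, hbase.mono (ball_subset_ball (by linarith)), hb0, hb1, hβ₀,
    ?_, fun p _ => ?_, fun p hp => ⟨β₀ * (lam * transFactor lam θ p), ?_, ?_⟩, ?_, hV,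
    fun p _ => skewV_zero θ p, fun p hp => S.norm_stableMap_le (hsub hp), hu, hu0⟩
  · exact hbase.comp (S.differentiableOn_skewD (prod_mono (subset_univ _) hsub)
      fun x hx => (hV x hx).trans_le hR') hDm
  · rw [skewD_zero, hb0]
  · refine HasDerivAt.comp (0 : ℂ) ?_ (S.hasDerivAt_skewD (hsub hp))
    rw [skewD_zero]
    exact hb1
  · linear_combination (lam * β₀) * hinv p hp
  · exact S.differentiableOn_skewV.mono (prod_mono (subset_univ _) hsub)

end IsStableSlope

end HenonSkewSystem

/-! ### Families of normalizing coordinates, and the expansion of a given one. -/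

section NormalFamily

/-- A holomorphic family of coordinates `φ_a`, defined on a bidisk containing the tube, in which the
local stable manifold `x = s_a(y)` is straight and the Hénon maps have the normal form to order
`2 q + 1`. -/
structure IsNormalFamily (lam : ℂ) (q : ℕ) (φ₀ : ℂ → ℂ) (ρ' r δ : ℝ) (s : ℂ → ℂ → ℂ)
    (φ : ℂ → ℂ × ℂ → ℂ × ℂ) (C : ℂ → ℂ) : Prop where
  δ_pos : 0 < δ
  diff : DifferentiableOn ℂ (fun w : ℂ × ℂ × ℂ => φ w.1 w.2)
    (ball 0 δ ×ˢ (ball (q₀ lam) (3 / 2 * ρ') ×ˢ ball 0 (r + 1)))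
  zero : ∀ z ∈ ball (q₀ lam) (3 / 2 * ρ') ×ˢ ball 0 (r + 1), φ 0 z = (φ₀ z.1, z.2)
  snd_eq : ∀ a : ℂ, ∀ z z' : ℂ × ℂ, z.2 = z'.2 → (φ a z).2 = (φ a z').2
  s_near : ∀ a y : ℂ, ‖a‖ < δ → ‖y‖ < r → ‖s a y - q₀ lam‖ < ρ'
  fst_s : ∀ a y : ℂ, ‖a‖ < δ → ‖y‖ < r → (φ a (s a y, y)).1 = 0
  fst_conj : ∀ c a y : ℂ, (c, a) ∈ paramCurve lam → ‖a‖ < δ → ‖y‖ < r →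
    (fun x => (φ a (henon c a (x, y))).1 - lam * ((φ a (x, y)).1 + (φ a (x, y)).1 ^ (q + 1)
      + C a * (φ a (x, y)).1 ^ (2 * q + 1))) =O[𝓝 (s a y)] fun x => (x - s a y) ^ (2 * q + 2)
  snd_conj : ∀ c a y : ℂ, (c, a) ∈ paramCurve lam → ‖a‖ < δ → ‖y‖ < r →
    (φ a (henon c a (s a y, y))).2 = eigenMu lam a * (φ a (s a y, y)).2
  stable : ∀ c a : ℂ, (c, a) ∈ paramCurve lam → ‖a‖ < δ →
    localStableManifold lam c a r = {z | ‖z.2‖ < r ∧ z.1 = s a z.2}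

variable {lam : ℂ} {q : ℕ} {V₀ : Set ℂ} {ρ : ℝ} {φ₀ : ℂ → ℂ}

/-- Normalizing coordinates have nonvanishing derivative at the fixed point. -/
theorem IsNormalizingCoordinate.deriv_ne_zero (h : IsNormalizingCoordinate lam q V₀ ρ φ₀) :
    deriv φ₀ (q₀ lam) ≠ 0 :=
  (deriv_ne_zero_and_hasDerivAt_inverse h.isOpen h.holomorphic
    (fun _ hz => h.bijOn.injOn.leftInvOn_invFunOn hz) h.mem).1

/-- The expansion of `φ₀ ∘ p` in powers of `φ₀`, in the coordinate `d = x - q₀`. -/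
theorem IsNormalizingCoordinate.exists_expansion (h : IsNormalizingCoordinate lam q V₀ ρ φ₀)
    (hq : 0 < q) : ∃ c : ℕ → ℂ, c 1 = lam ∧ c (q + 1) = lam ∧
      (∀ k, 1 ≤ k → ¬ q ∣ k - 1 → c k = 0) ∧
      ∀ M ≤ 2 * q + 1, (fun d => φ₀ (q₀ lam + quad lam d)
        - ∑ k ∈ Finset.Icc 1 M, c k * φ₀ (q₀ lam + d) ^ k) =O[𝓝 0] fun d => d ^ (M + 1) := by
  obtain ⟨C, hC⟩ := h.normalForm
  set c : ℕ → ℂ := fun k => if k = 1 ∨ k = q + 1 then lam else if k = 2 * q + 1 then lam * C else 0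
    with hc
  have hc0 : ∀ k, 1 ≤ k → ¬ q ∣ k - 1 → c k = 0 := by
    intro k hk hqk
    have h1 : k ≠ 1 := by rintro rfl; simp at hqk
    have h2 : k ≠ q + 1 := by rintro rfl; simp at hqk
    have h3 : k ≠ 2 * q + 1 := by rintro rfl; simp at hqk
    simp [hc, h1, h2, h3]
  have c1 : c 1 = lam := by simp [hc]
  have c2 : c (q + 1) = lam := by simp [hc]
  have c3 : c (2 * q + 1) = lam * C := by
    have h1 : q ≠ 0 := hq.ne'
    have h2 : 2 * q ≠ q := by omega
    simp [hc, h1, h2]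
  refine ⟨c, c1, c2, hc0, fun M hM => ?_⟩
  have hid : (fun d => φ₀ (q₀ lam + d)) =O[𝓝 0] fun d : ℂ => d := by
    have h1 := (h.holomorphic.differentiableAt (h.isOpen.mem_nhds h.mem)).isBigO_sub
    have ht : Tendsto (fun d : ℂ => q₀ lam + d) (𝓝 0) (𝓝 (q₀ lam)) := by
      simpa using (continuous_const.add continuous_id).tendsto (0 : ℂ)
        (f := fun d : ℂ => q₀ lam + d)
    refine (h1.comp_tendsto ht).congr (fun d => ?_) fun d => ?_
    · simp [h.map_fixed]
    · simp
  have hfull : (fun d => φ₀ (q₀ lam + quad lam d)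
      - ∑ k ∈ Finset.Icc 1 (2 * q + 1), c k * φ₀ (q₀ lam + d) ^ k) =O[𝓝 0]
      fun d => d ^ (2 * q + 2) := by
    have ht : Tendsto (fun d : ℂ => q₀ lam + d) (𝓝 0) (𝓝 (q₀ lam)) := by
      simpa using (continuous_const.add continuous_id).tendsto (0 : ℂ)
        (f := fun d : ℂ => q₀ lam + d)
    refine ((hC.comp_tendsto ht).trans (hid.pow (2 * q + 2))).congr_left fun d => ?_
    have hp : parabolicPoly lam (q₀ lam + d) = q₀ lam + quad lam d := by
      have := parabolicPoly_sub lam (q₀ lam + d)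
      rw [add_sub_cancel_left] at this
      linear_combination this
    simp only [Function.comp_apply]
    rw [sum_resonant hq c hc0, hp, c1, c2, c3]
    ring
  have hrest : (fun d => ∑ k ∈ Finset.Ioc M (2 * q + 1), c k * φ₀ (q₀ lam + d) ^ k) =O[𝓝 0]
      fun d : ℂ => d ^ (M + 1) := by
    refine IsBigO.fun_sum fun k hk => ((hid.pow k).trans (isBigO_pow_of_le ?_)).const_mul_left _
    exact (Finset.mem_Ioc.1 hk).1
  refine ((hfull.trans (isBigO_pow_of_le (by omega))).add hrest).congr_left fun d => ?_
  have hsplit : ∑ k ∈ Finset.Icc 1 (2 * q + 1), c k * φ₀ (q₀ lam + d) ^ k =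
      ∑ k ∈ Finset.Icc 1 M, c k * φ₀ (q₀ lam + d) ^ k +
        ∑ k ∈ Finset.Ioc M (2 * q + 1), c k * φ₀ (q₀ lam + d) ^ k := by
    rw [← Finset.sum_union]
    · congr 1
      ext k
      simp only [Finset.mem_union, Finset.mem_Icc, Finset.mem_Ioc]
      omega
    · rw [Finset.disjoint_left]
      intro k hk hk'
      have h1 := (Finset.mem_Icc.1 hk).2
      have h2 := (Finset.mem_Ioc.1 hk').1
      omega
  rw [hsplit]
  ring

end NormalFamily

end SemiParabolicHenon

namespace SemiParabolicHenon

/-! ### Construction of the family of coordinates. -/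

section ExistsNormalFamily

variable {lam : ℂ} {q : ℕ} {V₀ : Set ℂ} {ρ : ℝ} {φ₀ : ℂ → ℂ}

theorem fixedPointX_sub_q₀ (hlam : ‖lam‖ = 1) (a : ℂ) :
    ‖fixedPointX lam a - q₀ lam‖ = ‖a‖ ^ 2 / 2 := by
  have : fixedPointX lam a - q₀ lam = -(a ^ 2 / (2 * lam)) := by rw [fixedPointX, q₀]; ring
  rw [this, norm_neg, norm_div, norm_mul, hlam, Complex.norm_two, norm_pow, mul_one]

/-- The first component of φ_a is A(a) P(φ₀(q₀ + d), a, v), the second is v u₂(a, v). Here u₁ makes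
the transversal multiplier constant, P normalizes to order 2q+1, A fixes the coefficient of degree
q+1, and u₂ linearizes the dynamics along the stable manifold. At a = 0 all these factors are
trivial. -/
theorem exists_isNormalFamily (hlam : ‖lam‖ = 1) (hq0 : 0 < q) (hq : ∀ n, lam ^ n = 1 ↔ q ∣ n)
    (h : IsNormalizingCoordinate lam q V₀ ρ φ₀) {ρ' r : ℝ} (hρ' : 0 < ρ')
    (hsub : ball (q₀ lam) (2 * ρ') ⊆ V₀) (hr : 3 < r) :
    ∃ δ s φ C, IsNormalFamily lam q φ₀ ρ' r δ s φ C := by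
  have hlam0 : lam ≠ 0 := by rintro rfl; simp at hlam
  -- Room for two losses: solving for u₁ and u₂ shrinks the fibre radius to r + 2, and passing from
  -- v to y costs less than 1, so the coordinates live on |y| < r + 1.
  obtain ⟨R, hR⟩ : ∃ R : ℝ, R = r + 3 := ⟨_, rfl⟩
  obtain ⟨δ₀, hδ₀⟩ : ∃ δ₀ : ℝ, δ₀ = 1 / (64 * R) := ⟨_, rfl⟩
  have hR0 : 0 < R := by linarith
  have hδ₀0 : 0 < δ₀ := by rw [hδ₀]; positivity
  have hδR : δ₀ * R ≤ 1 / 64 := le_of_eq (by rw [hδ₀]; field_simp)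
  obtain ⟨θ, t1, t2, t3, t4, t5⟩ := exists_stable_slope hlam hδ₀0 (by linarith : 1 ≤ R) hδR
  have S₀ : IsStableSlope lam δ₀ R θ :=
    ⟨hlam, hδ₀0, by linarith, hδR, t1, t2, t3, t4, t5⟩
  obtain ⟨δ₁, hδ₁, hδ₁δ₀, u₁, hu₁, hu₁0, hu₁i, -, hu₁z⟩ := exists_multiplicative_solution
    (R' := r + 2) hδ₀0 (by linarith) (by linarith) S₀.differentiableOn_stableMap
    (fun p hp => S₀.norm_stableMap_le hp) S₀.differentiableOn_transFactor
    (fun a ha => S₀.transFactor_zero_right ha) fun v _ => S₀.transFactor_zero_left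
  obtain ⟨δ₂, hδ₂, hδ₂δ₀, u₂, hu₂, hu₂0, hu₂i, -, hu₂z⟩ := exists_multiplicative_solution
    (R' := r + 2) (m := fun p => -lam * θ p) hδ₀0 (by linarith) (by linarith)
    S₀.differentiableOn_stableMap (fun p hp => S₀.norm_stableMap_le hp)
    (S₀.diff.const_mul _) (fun a ha => by rw [t5 a ha]; field_simp)
    fun v hv => by rw [t4 v hv]; field_simp
  obtain ⟨δ₃, hδ₃⟩ : ∃ δ₃, δ₃ = min δ₁ δ₂ := ⟨_, rfl⟩
  have hδ₃0 : 0 < δ₃ := hδ₃ ▸ lt_min hδ₁ hδ₂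
  have hδ₃₁ : δ₃ ≤ δ₁ := hδ₃ ▸ min_le_left _ _
  have hδ₃₂ : δ₃ ≤ δ₂ := hδ₃ ▸ min_le_right _ _
  have S₃ := S₀.mono hδ₃0 (hδ₃₁.trans hδ₁δ₀)
  have hm₁ : ball (0 : ℂ) δ₃ ×ˢ ball (0 : ℂ) (r + 2) ⊆ ball (0 : ℂ) δ₁ ×ˢ ball (0 : ℂ) (r + 2) :=
    prod_mono (ball_subset_ball hδ₃₁) subset_rfl
  set base : ℂ → ℂ := fun d => φ₀ (q₀ lam + d) with hbase
  have hbased : DifferentiableOn ℂ base (ball 0 (2 * ρ')) :=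
    h.holomorphic.comp (by fun_prop) fun d hd => hsub (by simpa using hd)
  have hbase0 : base 0 = 0 := by simp [hbase, h.map_fixed]
  have hbase1 : HasDerivAt base (deriv φ₀ (q₀ lam)) 0 := by
    have h1 := (h.holomorphic.differentiableAt (h.isOpen.mem_nhds h.mem)).hasDerivAt
    exact HasDerivAt.comp_const_add (q₀ lam) 0 (by rwa [add_zero])
  have hsys := S₃.skewSystem (R' := r + 2) (ε := min (1 / 2) ρ') (ρ₁ := 2 * ρ') (by linarith)
    (by linarith) (lt_min (by norm_num) hρ') (min_le_left _ _)
    (mul_le_mul_of_nonneg_left (min_le_right _ _) zero_le_two) hbased hbase0 hbase1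
    h.deriv_ne_zero (hu₁.mono hm₁) hu₁0 fun p hp => hu₁i p (hm₁ hp)
  obtain ⟨c, hc1, hcq, hc0, hcO⟩ := h.exists_expansion hq0
  obtain ⟨P, ν, hP, hP0⟩ := hsys.exists_isNormalizing hlam hq c (N := 2 * q + 1) (by omega)
  -- For a = 0 the transversal map is the polynomial, and its expansion in the given coordinate is
  -- already resonant up to order 2q+1. The normalization therefore changes nothing there.
  obtain ⟨hν0, hPz⟩ := hP0 hu₁z hc1 hc0 fun M hM v hv => by
    refine (hcO M hM).congr_left fun d => ?_
    have : skewD lam θ (d, (0, v)) = quad lam d := by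
      simp [skewD, skewV, stableMap, stableGraph, eigenMu, quad]
      ring
    rw [this]
  have hνq : ν (q + 1) 0 = lam := (hν0 _ (by omega) (by omega)).trans hcq
  have hα : ∀ᶠ a in 𝓝 (0 : ℂ), ν (q + 1) a / lam ∈ Complex.slitPlane := by
    have hcont : ContinuousAt (fun a => ν (q + 1) a / lam) 0 :=
      (((hP.ν_diff (q + 1)).differentiableAt (isOpen_ball.mem_nhds
        (mem_ball_self hδ₃0))).div_const lam).continuousAt
    refine hcont.eventually (Complex.isOpen_slitPlane.mem_nhds ?_)
    beta_reduce
    rw [hνq, div_self hlam0]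
    exact Complex.one_mem_slitPlane
  obtain ⟨δ₄, hδ₄, hα'⟩ := Metric.eventually_nhds_iff.1 hα
  -- The last bound keeps the stable manifold within ρ'/2 of x = q₀. So d stays below 2ρ' on the
  -- bidisk of radius 3ρ'/2, where φ₀ is available.
  obtain ⟨δ, hδdef⟩ : ∃ δ, δ = min (min δ₃ δ₄) (ρ' / 2 / (1 + 2 * R)) := ⟨_, rfl⟩
  have hδ : 0 < δ := by rw [hδdef]; positivity
  have hδδ₃ : δ ≤ δ₃ := by rw [hδdef]; exact (min_le_left _ _).trans (min_le_left _ _)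
  have hδδ₄ : δ ≤ δ₄ := by rw [hδdef]; exact (min_le_left _ _).trans (min_le_right _ _)
  have hδρ : δ * (1 + 2 * R) ≤ ρ' / 2 := by
    rw [← le_div_iff₀ (by linarith), hδdef]
    exact min_le_right _ _
  have S := S₃.mono hδ hδδ₃
  have hδle := S.δ_le
  have hα4 : ∀ a ∈ ball (0 : ℂ) δ, ν (q + 1) a / lam ∈ Complex.slitPlane := fun a ha =>
    hα' (lt_of_lt_of_le ha hδδ₄)
  -- The principal q-th root of ν_{q+1}/λ: it is holomorphic while the quotient stays in the slit
  -- plane, and it equals 1 at a = 0.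
  set A : ℂ → ℂ := fun a => Complex.exp (Complex.log (ν (q + 1) a / lam) / q) with hA
  have hAq : ∀ a ∈ ball (0 : ℂ) δ, lam * A a ^ q = ν (q + 1) a := by
    intro a ha
    rw [hA]
    beta_reduce
    rw [← Complex.exp_nat_mul, mul_div_cancel₀ _ (by exact_mod_cast hq0.ne'),
      Complex.exp_log (Complex.slitPlane_ne_zero (hα4 a ha)), mul_div_cancel₀ _ hlam0]
  have hA0 : ∀ a, A a ≠ 0 := fun a => Complex.exp_ne_zero _
  have hA1 : A 0 = 1 := by
    rw [hA]
    beta_reduce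
    rw [hνq, div_self hlam0]
    simp
  have hAd : DifferentiableOn ℂ A (ball 0 δ) := by
    have h1 : DifferentiableOn ℂ (fun a => ν (q + 1) a / lam) (ball 0 δ) :=
      ((hP.ν_diff (q + 1)).mono (ball_subset_ball hδδ₃)).div_const lam
    exact ((h1.clog hα4).div_const _).cexp
  set U := ball (q₀ lam) (3 / 2 * ρ') ×ˢ ball (0 : ℂ) (r + 1) with hU
  have hfm : ∀ a y : ℂ, ‖a‖ < δ → ‖y‖ < r + 1 →
      (a, y - a * fixedPointX lam a) ∈ ball (0 : ℂ) δ ×ˢ ball (0 : ℂ) (r + 2) := fun a y ha hy =>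
    ⟨mem_ball_zero_iff.2 ha, mem_ball_zero_iff.2 (by
      refine (norm_sub_le _ _).trans_lt ?_
      rw [norm_mul]
      have := norm_fixedPointX_le hlam (a := a) (by linarith)
      nlinarith [norm_nonneg a, norm_nonneg (fixedPointX lam a)])⟩
  have hR2 : ball (0 : ℂ) δ ×ˢ ball (0 : ℂ) (r + 2) ⊆ ball (0 : ℂ) δ ×ˢ ball (0 : ℂ) R :=
    prod_mono subset_rfl (ball_subset_ball (by linarith))
  have hδ₃m : ball (0 : ℂ) δ ×ˢ ball (0 : ℂ) (r + 2) ⊆ ball (0 : ℂ) δ₃ ×ˢ ball (0 : ℂ) (r + 2) :=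
    prod_mono (ball_subset_ball hδδ₃) subset_rfl
  have hδ₂m : ball (0 : ℂ) δ ×ˢ ball (0 : ℂ) (r + 2) ⊆ ball (0 : ℂ) δ₂ ×ˢ ball (0 : ℂ) (r + 2) :=
    prod_mono (ball_subset_ball (hδδ₃.trans hδ₃₂)) subset_rfl
  set s : ℂ → ℂ → ℂ := fun a y =>
    fixedPointX lam a + stableGraph θ (a, y - a * fixedPointX lam a) with hs
  have hsn : ∀ a y : ℂ, ‖a‖ < δ → ‖y‖ < r + 1 → ‖s a y - q₀ lam‖ < ρ' / 2 := by
    intro a y ha hy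
    have h1 := hR2 (hfm a y ha hy)
    have h2 := S.norm_stableGraph_le h1
    have h3 := mem_ball_zero_iff.1 h1.2
    have e : s a y - q₀ lam = (fixedPointX lam a - q₀ lam)
        + stableGraph θ (a, y - a * fixedPointX lam a) := by rw [hs]; ring
    rw [e]
    refine (norm_add_le _ _).trans_lt ?_
    rw [fixedPointX_sub_q₀ hlam]
    dsimp only at h2 h3
    have ha1 : ‖a‖ ≤ 1 := by linarith
    have h4 : ‖a‖ * ‖y - a * fixedPointX lam a‖ ≤ ‖a‖ * R := by gcongr
    have h5 : ‖a‖ * (1 + 2 * R) < δ * (1 + 2 * R) := by gcongr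
    nlinarith [norm_nonneg a]
  have htc : ∀ a x y, transCoord lam θ a (x, y) = x - s a y := fun a x y => by
    simp only [transCoord, fibreCoord, hs]; ring
  set φ : ℂ → ℂ × ℂ → ℂ × ℂ := fun a z =>
    (A a * P (base (transCoord lam θ a z), (a, fibreCoord lam a z)),
      fibreCoord lam a z * u₂ (a, fibreCoord lam a z)) with hφ
  set C : ℂ → ℂ := fun a => ν (2 * q + 1) a / (lam * A a ^ (2 * q)) with hC
  refine ⟨δ, s, φ, C, hδ, ?_, ?_, ?_, ?_, ?_, ?_, ?_, ?_⟩
  · have hX : DifferentiableOn ℂ (fun w : ℂ × ℂ × ℂ => fixedPointX lam w.1) (ball 0 δ ×ˢ U) :=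
      ((differentiable_fixedPointX lam).comp differentiable_fst).differentiableOn
    have hv : DifferentiableOn ℂ (fun w : ℂ × ℂ × ℂ => fibreCoord lam w.1 w.2) (ball 0 δ ×ˢ U) := by
      unfold fibreCoord
      fun_prop
    have hvm : ∀ w ∈ ball (0 : ℂ) δ ×ˢ U,
        (w.1, fibreCoord lam w.1 w.2) ∈ ball (0 : ℂ) δ ×ˢ ball (0 : ℂ) (r + 2) := fun w hw =>
      hfm w.1 w.2.2 (mem_ball_zero_iff.1 hw.1) (mem_ball_zero_iff.1 hw.2.2)
    have hσ : DifferentiableOn ℂ (fun w : ℂ × ℂ × ℂ =>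
        stableGraph θ (w.1, fibreCoord lam w.1 w.2)) (ball 0 δ ×ˢ U) :=
      S.differentiableOn_stableGraph.comp
        (f := fun w : ℂ × ℂ × ℂ => (w.1, fibreCoord lam w.1 w.2)) (by fun_prop)
        fun w hw => hR2 (hvm w hw)
    have ht : DifferentiableOn ℂ (fun w : ℂ × ℂ × ℂ => transCoord lam θ w.1 w.2)
        (ball 0 δ ×ˢ U) := by
      unfold transCoord
      fun_prop
    have hb : DifferentiableOn ℂ (fun w : ℂ × ℂ × ℂ => base (transCoord lam θ w.1 w.2))
        (ball 0 δ ×ˢ U) := by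
      refine hbased.comp ht fun w hw => ?_
      have h1 := hsn w.1 w.2.2 (mem_ball_zero_iff.1 hw.1) (mem_ball_zero_iff.1 hw.2.2)
      have h2 : ‖w.2.1 - q₀ lam‖ < 3 / 2 * ρ' := mem_ball_iff_norm.1 hw.2.1
      rw [mem_ball_zero_iff]
      have e : transCoord lam θ w.1 w.2 = (w.2.1 - q₀ lam) - (s w.1 w.2.2 - q₀ lam) := by
        rw [sub_sub_sub_cancel_right]
        exact htc w.1 w.2.1 w.2.2
      rw [e]
      refine (norm_sub_le _ _).trans_lt (by linarith)
    have hA' : DifferentiableOn ℂ (fun w : ℂ × ℂ × ℂ => A w.1) (ball 0 δ ×ˢ U) :=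
      hAd.comp (by fun_prop) fun w hw => hw.1
    have hP' : DifferentiableOn ℂ (fun w : ℂ × ℂ × ℂ =>
        P (base (transCoord lam θ w.1 w.2), (w.1, fibreCoord lam w.1 w.2))) (ball 0 δ ×ˢ U) :=
      hP.P_diff.comp (f := fun w : ℂ × ℂ × ℂ =>
        (base (transCoord lam θ w.1 w.2), (w.1, fibreCoord lam w.1 w.2)))
        (hb.prodMk (differentiableOn_fst.prodMk hv)) fun w hw => ⟨mem_univ _, hδ₃m (hvm w hw)⟩
    have hu' : DifferentiableOn ℂ (fun w : ℂ × ℂ × ℂ => u₂ (w.1, fibreCoord lam w.1 w.2))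
        (ball 0 δ ×ˢ U) :=
      hu₂.comp (f := fun w : ℂ × ℂ × ℂ => (w.1, fibreCoord lam w.1 w.2))
        (by fun_prop) fun w hw => hδ₂m (hvm w hw)
    exact (hA'.mul hP').prodMk (hv.mul hu')
  · rintro ⟨x, y⟩ ⟨hx, hy⟩
    have hy' : y ∈ ball (0 : ℂ) (r + 2) := ball_subset_ball (by linarith) hy
    have e1 : fibreCoord lam 0 (x, y) = y := by simp [fibreCoord]
    have e2 : q₀ lam + transCoord lam θ 0 (x, y) = x := by
      simp [transCoord, stableGraph, fixedPointX, q₀]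
    simp only [hφ, hbase]
    rw [e1, e2, hA1, hPz _ y hy', hu₂z y hy', one_mul, mul_one]
  · intro a z z' hzz
    simp only [hφ, fibreCoord, hzz]
  · intro a y ha hy
    linarith [hsn a y ha (by linarith)]
  · intro a y ha hy
    have hv : fibreCoord lam a (s a y, y) = y - a * fixedPointX lam a := rfl
    simp only [hφ]
    rw [htc, sub_self, hbase0, hv, hP.P_zero _ (hδ₃m (hfm a y ha (by linarith))), mul_zero]
  · intro cc a y hca ha hy
    have hp := hfm a y ha (by linarith : ‖y‖ < r + 1)
    have ht : Tendsto (fun x => x - s a y) (𝓝 (s a y)) (𝓝 0) := by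
      simpa using (continuous_id.sub continuous_const).tendsto (s a y)
        (f := fun x : ℂ => x - s a y)
    refine ((hP.conj _ (hδ₃m hp)).const_mul_left (A a)).comp_tendsto ht |>.congr_left fun x => ?_
    have hv : fibreCoord lam a (x, y) = y - a * fixedPointX lam a := rfl
    have e1 := S.transCoord_henon hca (z := (x, y)) (hR2 hp)
    have e2 := fibreCoord_henon lam cc a θ (x, y)
    rw [htc a x y, hv] at e1 e2
    simp only [Function.comp_apply, hφ]
    rw [e1, e2, htc a x y, hv, sum_resonant hq0 (fun k => ν k a) (fun k h1 h2 => hP.ν_eq_zero k h1 h2 a),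
      hP.ν_one, ← hAq a (mem_ball_zero_iff.2 ha)]
    have h1 := hA0 a
    have h2 : A a ^ (2 * q) ≠ 0 := pow_ne_zero _ h1
    simp only [hC]
    field_simp
    ring
  · intro cc a y hca ha hy
    have hp := hfm a y ha (by linarith : ‖y‖ < r + 1)
    have e2 := fibreCoord_henon lam cc a θ (s a y, y)
    have hv : fibreCoord lam a (s a y, y) = y - a * fixedPointX lam a := rfl
    rw [htc, sub_self, skewV_zero, hv] at e2
    simp only [hφ]
    rw [e2, hv]
    have h1 := hu₂i _ (hδ₂m hp)
    dsimp only at h1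
    rw [← h1]
    have e : stableMap θ (a, y - a * fixedPointX lam a) = eigenMu lam a *
        ((y - a * fixedPointX lam a) * (-lam * θ (a, y - a * fixedPointX lam a))) := by
      rw [stableMap, stableGraph, eigenMu]
      field_simp
    linear_combination (u₂ (a, stableMap θ (a, y - a * fixedPointX lam a))) * e
  · intro cc a hca ha
    rw [S.localStableManifold_eq (R' := r + 2) (by linarith) (by linarith) (by linarith) le_rfl ha
      hca (hu₂.mono hδ₂m) hu₂0 fun p hp => hu₂i p (hδ₂m hp)]
    ext ⟨x, y⟩
    simp only [mem_ofPred_eq, htc, sub_eq_zero]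

end ExistsNormalFamily

end SemiParabolicHenon

namespace SemiParabolicHenon

/-! ### Perturbations of the identity. -/

section Perturbation

variable {E : Type*} [NormedAddCommGroup E] [NormedSpace ℂ E] [CompleteSpace E]

/-- A holomorphic map whose difference from the identity is `1/2`-Lipschitz on an open set is
biholomorphic onto an open image. -/
theorem exists_inverse_of_lipschitz {f : E → E} {S : Set E} (hS : IsOpen S)
    (hf : DifferentiableOn ℂ f S)
    (hL : ∀ e ∈ S, ∀ e' ∈ S, ‖(f e' - e') - (f e - e)‖ ≤ 1 / 2 * ‖e' - e‖) :
    IsOpen (f '' S) ∧ ∃ finv : E → E, DifferentiableOn ℂ finv (f '' S) ∧ LeftInvOn finv f S := by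
  rcases subsingleton_or_nontrivial E with hE | hE
  · exact ⟨isOpen_discrete _, id, differentiableOn_id, fun x _ => Subsingleton.elim _ _⟩
  have happ : ApproximatesLinearOn f
      ((ContinuousLinearEquiv.refl ℂ E : E ≃L[ℂ] E) : E →L[ℂ] E) S (1 / 2) := by
    intro x hx y hy
    have h := hL y hy x hx
    have e : f x - f y - ((ContinuousLinearEquiv.refl ℂ E : E ≃L[ℂ] E) : E →L[ℂ] E) (x - y) =
        (f x - x) - (f y - y) := by
      simp only [ContinuousLinearEquiv.coe_refl, ContinuousLinearMap.id_apply]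
      abel
    rw [e]
    simpa using h
  have hc : Subsingleton E ∨ (1 / 2 : NNReal) <
      ‖((ContinuousLinearEquiv.refl ℂ E).symm : E →L[ℂ] E)‖₊⁻¹ := by
    right
    have : ‖((ContinuousLinearEquiv.refl ℂ E).symm : E →L[ℂ] E)‖₊ = 1 := by
      rw [ContinuousLinearEquiv.refl_symm, ContinuousLinearEquiv.coe_refl]
      exact ContinuousLinearMap.nnnorm_id
    rw [this, inv_one]
    exact NNReal.half_lt_self one_ne_zero
  set e := happ.toOpenPartialHomeomorph f S hc hS with he
  have hsrc : e.source = S := rfl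
  have htgt : e.target = f '' S := rfl
  have hcoe : ∀ x, e x = f x := fun _ => rfl
  refine ⟨htgt ▸ e.open_target, e.symm, fun w hw => ?_, fun x hx => e.left_inv hx⟩
  have hw' : w ∈ e.target := hw
  have hx : e.symm w ∈ S := e.map_target hw'
  have hfd := (hf.differentiableAt (hS.mem_nhds hx)).hasFDerivAt
  set x := e.symm w
  set f' := fderiv ℂ f x
  have hnorm : ‖f' - 1‖ ≤ 1 / 2 := by
    have h1 : HasFDerivAt (fun y => f y - y) (f' - 1) x := hfd.sub (hasFDerivAt_id x)
    have h2 : LipschitzOnWith (1 / 2) (fun y => f y - y) S :=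
      LipschitzOnWith.of_dist_le_mul fun y hy z hz => by
        rw [dist_eq_norm, dist_eq_norm]
        simpa using hL z hz y hy
    simpa using h1.le_of_lipschitzOn (hS.mem_nhds hx) h2
  have hunit : IsUnit f' := by
    have h1 : IsUnit (1 - (1 - f')) := isUnit_one_sub_of_norm_lt_one (by
      rw [norm_sub_rev]; linarith)
    rwa [sub_sub_cancel] at h1
  obtain ⟨u, hu⟩ := hunit
  have hfd' : HasFDerivAt e
      ((ContinuousLinearEquiv.unitsEquiv ℂ E u : E ≃L[ℂ] E) : E →L[ℂ] E) x := by
    have : ((ContinuousLinearEquiv.unitsEquiv ℂ E u : E ≃L[ℂ] E) : E →L[ℂ] E) = f' := by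
      rw [← hu]; ext; rfl
    rw [this]
    exact hfd
  exact (e.hasFDerivAt_symm hw' hfd').differentiableAt.differentiableWithinAt

/-- A perturbation of the identity covers a disk. -/
theorem exists_eq_of_lipschitz {f : ℂ → ℂ} {η m : ℝ} (hη : 0 ≤ η)
    (hm : ∀ w ∈ closedBall (0 : ℂ) η, ‖f w - w‖ ≤ m)
    (hL : ∀ e ∈ closedBall (0 : ℂ) η, ∀ e' ∈ closedBall (0 : ℂ) η,
      ‖(f e' - e') - (f e - e)‖ ≤ 1 / 2 * ‖e' - e‖)
    {w₁ : ℂ} (hw₁ : ‖w₁‖ + m ≤ η) : ∃ w ∈ closedBall (0 : ℂ) η, f w = w₁ := by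
  -- Fixed points of T solve f w = w₁. T contracts by 1/2, and the bound on ‖w₁‖ + m keeps it inside
  -- the disk.
  set T : ℂ → ℂ := fun w => w₁ - (f w - w) with hT
  have hmaps : MapsTo T (closedBall 0 η) (closedBall 0 η) := fun w hw => by
    rw [mem_closedBall_zero_iff]
    exact (norm_sub_le _ _).trans (by linarith [hm w hw])
  have hcon : ContractingWith (1 / 2) (hmaps.restrict T _ _) := by
    refine ⟨NNReal.half_lt_self one_ne_zero, LipschitzWith.of_dist_le_mul fun x y => ?_⟩
    rw [Subtype.dist_eq, Subtype.dist_eq, dist_eq_norm, dist_eq_norm]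
    have h := hL y y.2 x x.2
    have e : (hmaps.restrict T _ _ x : ℂ) - (hmaps.restrict T _ _ y : ℂ) =
        -((f x - x) - (f y - y)) := by
      simp only [MapsTo.val_restrict_apply, hT]
      ring
    rw [e, norm_neg]
    simpa using h
  obtain ⟨y, hy, hfix, -⟩ := hcon.exists_fixedPoint' isClosed_closedBall.isComplete hmaps
    (mem_closedBall_self hη) (edist_ne_top _ _)
  refine ⟨y, hy, ?_⟩
  have h : w₁ - (f y - y) = y := hfix
  linear_combination -h

end Perturbation

/-! ### From order estimates to the holomorphic remainders g and h. -/

section NormalForm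

variable {lam : ℂ} {q : ℕ} {φ₀ : ℂ → ℂ} {ρ' r δ : ℝ} {s : ℂ → ℂ → ℂ} {φ : ℂ → ℂ × ℂ → ℂ × ℂ}
  {C : ℂ → ℂ}

theorem isOpen_tube (lam : ℂ) (ρ' r : ℝ) : IsOpen (tube lam ρ' r) :=
  isOpen_ball.prod isOpen_ball

namespace IsNormalFamily

variable (N : IsNormalFamily lam q φ₀ ρ' r δ s φ C)
include N

/-- The point of the stable manifold over the same y also lies in the tube and has the same image:
both first components are 0, and the second depends on y alone. Injectivity identifies the points.
-/
theorem eq_s_of_fst_eq_zero {a : ℂ} (ha : ‖a‖ < δ) (hinj : InjOn (φ a) (tube lam ρ' r))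
    {z : ℂ × ℂ} (hz : z ∈ tube lam ρ' r) (h0 : (φ a z).1 = 0) : z = (s a z.2, z.2) := by
  have hy : ‖z.2‖ < r := mem_ball_zero_iff.1 hz.2
  refine hinj hz ⟨mem_ball_iff_norm.2 (N.s_near a z.2 ha hy), hz.2⟩ (Prod.ext ?_ ?_)
  · rw [h0, N.fst_s a z.2 ha hy]
  · exact N.snd_eq a _ _ rfl

theorem localStableManifold_eq {c a : ℂ} (hca : (c, a) ∈ paramCurve lam) (ha : ‖a‖ < δ)
    (hinj : InjOn (φ a) (tube lam ρ' r)) :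
    localStableManifold lam c a r = {z ∈ tube lam ρ' r | (φ a z).1 = 0} := by
  rw [N.stable c a hca ha]
  ext ⟨x, y⟩
  constructor
  · rintro ⟨hy, hx⟩
    dsimp only at hx hy
    subst hx
    exact ⟨⟨mem_ball_iff_norm.2 (N.s_near a y ha hy), mem_ball_zero_iff.2 hy⟩, N.fst_s a y ha hy⟩
  · rintro ⟨hz, h0⟩
    exact ⟨mem_ball_zero_iff.1 hz.2,
      congrArg Prod.fst (N.eq_s_of_fst_eq_zero ha hinj hz h0)⟩

/-- The normal form of the Hénon map in the coordinate `φ_a`. -/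
theorem exists_hasNormalForm {c a : ℂ} {ε : ℝ} (hlam : lam ≠ 0) (hε : 0 < ε)
    (hca : (c, a) ∈ paramCurve lam) (ha : ‖a‖ < δ)
    (hφ : IsCoordinateChangeOn (φ a) (tube lam ρ' r))
    (hsnd : ∀ z ∈ tube lam ρ' r, ∀ z' ∈ tube lam ρ' r, (φ a z).2 = (φ a z').2 → z.2 = z'.2)
    (hpoly : ball (0 : ℂ) ε ×ˢ (Prod.snd '' (φ a '' tube lam ρ' r)) ⊆
      φ a '' (tube lam ρ' r ∩ henon c a ⁻¹' tube lam ρ' r)) :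
    ∃ (coeff : ℕ → ℂ → ℂ) (g h : ℂ × ℂ → ℂ), HasNormalForm lam (eigenMu lam a) (C a) q ε coeff g h
      (henon c a) (tube lam ρ' r) (φ a) := by
  obtain ⟨hφd, hφo, finv, hfd, hfl⟩ := hφ
  set B := tube lam ρ' r with hB
  set H := henon c a with hH
  have hHd : Differentiable ℂ H := differentiable_henon c a
  have hinj : InjOn (φ a) B := hfl.injOn
  set Ω := φ a '' (B ∩ H ⁻¹' B) with hΩ
  have hBH : IsOpen (B ∩ H ⁻¹' B) :=
    (isOpen_tube _ _ _).inter ((isOpen_tube _ _ _).preimage hHd.continuous)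
  have hΩo : IsOpen Ω := by
    have : Ω = φ a '' B ∩ finv ⁻¹' (B ∩ H ⁻¹' B) := by
      ext w
      constructor
      · rintro ⟨z, hz, rfl⟩
        refine ⟨⟨z, hz.1, rfl⟩, ?_⟩
        rw [mem_preimage, hfl hz.1]
        exact hz
      · rintro ⟨⟨z, hz, rfl⟩, hw⟩
        rw [mem_preimage, hfl hz] at hw
        exact ⟨z, hw, rfl⟩
    rw [this]
    exact hfd.continuousOn.isOpen_inter_preimage hφo hBH
  have hfm : ∀ w ∈ Ω, finv w ∈ B ∧ H (finv w) ∈ B ∧ φ a (finv w) = w := by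
    rintro _ ⟨z, hz, rfl⟩
    rw [hfl hz.1]
    exact ⟨hz.1, hz.2, rfl⟩
  have hfdΩ : DifferentiableOn ℂ finv Ω := hfd.mono (image_mono inter_subset_left)
  have hconj : DifferentiableOn ℂ (fun w => φ a (H (finv w))) Ω :=
    hφd.comp (hHd.comp_differentiableOn hfdΩ) fun w hw => (hfm w hw).2.1
  -- The two normal form errors, read in the new coordinates. Once they vanish to order 2q+2 and 1
  -- along x = 0, division by these powers gives `g` and `h`.
  set G₁ : ℂ × ℂ → ℂ := fun w =>
    lam⁻¹ * (φ a (H (finv w))).1 - (w.1 + w.1 ^ (q + 1) + C a * w.1 ^ (2 * q + 1)) with hG₁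
  set G₂ : ℂ × ℂ → ℂ := fun w => (φ a (H (finv w))).2 - eigenMu lam a * w.2 with hG₂
  have hG₁d : DifferentiableOn ℂ G₁ Ω := by
    have := hconj.fst
    fun_prop
  have hG₂d : DifferentiableOn ℂ G₂ Ω := by
    have := hconj.snd
    fun_prop
  have hbase : ∀ e, ((0 : ℂ), e) ∈ Ω → finv (0, e) = (s a (finv (0, e)).2, (finv (0, e)).2) := by
    intro e he
    obtain ⟨h1, -, h3⟩ := hfm _ he
    exact N.eq_s_of_fst_eq_zero ha hinj h1 (by rw [h3])
  have hslice : ∀ e : ℂ, ((0 : ℂ), e) ∈ Ω → ∀ᶠ w in 𝓝 (0 : ℂ), (w, e) ∈ Ω := fun e he =>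
    (hΩo.preimage (by fun_prop : Continuous fun w : ℂ => (w, e))).mem_nhds he
  -- A line of constant second coordinate comes from a line of constant y, by `hsnd`. So the
  -- estimate along x in `fst_conj` pulls back through the inverse, which is Lipschitz at w = 0.
  have hO₁ : ∀ e, ((0 : ℂ), e) ∈ Ω → (fun w => G₁ (w, e)) =O[𝓝 0] fun w => w ^ (2 * q + 2) := by
    intro e he
    have hy : ‖(finv (0, e)).2‖ < r := mem_ball_zero_iff.1 (hfm _ he).1.2
    have hb := hbase e he
    set y := (finv (0, e)).2
    have hfw : ∀ᶠ w in 𝓝 (0 : ℂ), finv (w, e) = ((finv (w, e)).1, y) ∧ φ a (finv (w, e)) = (w, e) := by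
      filter_upwards [hslice e he] with w hw
      have h1 := hfm _ hw
      have h2 : (finv (w, e)).2 = y := hsnd _ h1.1 _ (hfm _ he).1 (by rw [h1.2.2, (hfm _ he).2.2])
      exact ⟨Prod.ext rfl h2, h1.2.2⟩
    have hd : DifferentiableAt ℂ (fun w : ℂ => (finv (w, e)).1) 0 := by
      have h1 := hfdΩ.differentiableAt (hΩo.mem_nhds he)
      have h2 : DifferentiableAt ℂ (fun w : ℂ => finv (w, e)) 0 :=
        DifferentiableAt.comp (0 : ℂ) (f := fun w : ℂ => (w, e)) h1 (by fun_prop)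
      exact h2.fst
    have hx0 : (finv (0, e)).1 = s a y := congrArg Prod.fst hb
    have hxO : (fun w : ℂ => (finv (w, e)).1 - s a y) =O[𝓝 0] fun w : ℂ => w := by
      have := hd.isBigO_sub
      rw [hx0] at this
      simpa using this
    have hxt : Tendsto (fun w : ℂ => (finv (w, e)).1) (𝓝 0) (𝓝 (s a y)) := by
      have := hd.continuousAt.tendsto
      rwa [hx0] at this
    have h1 := ((N.fst_conj c a y hca ha hy).comp_tendsto hxt).trans (hxO.pow (2 * q + 2))
    refine (h1.const_mul_left lam⁻¹).congr' ?_ EventuallyEq.rfl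
    filter_upwards [hfw] with w hw
    simp only [Function.comp_apply, hG₁]
    rw [← hw.1, hw.2]
    field_simp
    rfl
  have hO₂ : ∀ e, ((0 : ℂ), e) ∈ Ω → (fun w => G₂ (w, e)) =O[𝓝 0] fun w => w ^ 1 := by
    intro e he
    have hy : ‖(finv (0, e)).2‖ < r := mem_ball_zero_iff.1 (hfm _ he).1.2
    have h0 : G₂ (0, e) = 0 := by
      have h1 := N.snd_conj c a _ hca ha hy
      rw [← hbase e he, (hfm _ he).2.2] at h1
      simp only [hG₂]
      rw [h1, sub_self]
    have hd : DifferentiableAt ℂ (fun w : ℂ => G₂ (w, e)) 0 :=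
      DifferentiableAt.comp (0 : ℂ) (f := fun w : ℂ => (w, e))
        (hG₂d.differentiableAt (hΩo.mem_nhds he)) (by fun_prop)
    simpa [h0] using hd.isBigO_sub
  obtain ⟨g, hg, hgG⟩ := exists_eq_pow_mul hΩo hG₁d (2 * q + 2) hO₁
  obtain ⟨h, hh, hhG⟩ := exists_eq_pow_mul hΩo hG₂d 1 hO₂
  refine ⟨taylorCoeff g, g, h, hg, hh, fun z hz => ?_, fun z hz => ?_, hpoly, fun k => ?_,
    fun x hx y hy => ?_⟩
  · have h1 := hgG (φ a z) ⟨z, hz, rfl⟩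
    simp only [hG₁] at h1
    rw [hfl hz.1] at h1
    rw [← h1]
    field_simp
    ring
  · have h1 := hhG (φ a z) ⟨z, hz, rfl⟩
    simp only [hG₂, pow_one] at h1
    rw [hfl hz.1] at h1
    rw [← h1]
    ring
  · exact differentiableOn_taylorCoeff hΩo hg k fun e he => hpoly ⟨mem_ball_self hε, he⟩
  · exact hasSum_taylorCoeff (hg.comp (f := fun w : ℂ => (w, y)) (by fun_prop)
      fun w hw => hpoly ⟨hw, hy⟩) hx

end IsNormalFamily

end NormalForm

end SemiParabolicHenon

namespace SemiParabolicHenon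

/-! ### Uniform conclusions for small parameters, and the theorem. -/

section Main

/-- The parameter `c` of the curve `𝒫_λ` over `a`. -/
noncomputable def paramC (lam a : ℂ) : ℂ :=
  (1 - a ^ 2) * fixedPointX lam a - fixedPointX lam a ^ 2

/-- Exhibits the first component of the Hénon map as the polynomial plus a term that tends to 0 with
`a`, uniformly for bounded y. -/
theorem henon_fst_sub (lam a : ℂ) (z : ℂ × ℂ) :
    (henon (paramC lam a) a z).1 - q₀ lam =
      quad lam (z.1 - q₀ lam) + ((paramC lam a - paramC lam 0) + a * z.2) := by
  have h0 : paramC lam 0 = lam / 2 - lam ^ 2 / 4 := by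
    simp only [paramC, fixedPointX]
    ring
  rw [h0, henon, quad, q₀]
  ring

theorem tendsto_paramC_sub (lam : ℂ) :
    Tendsto (fun a => ‖paramC lam a - paramC lam 0‖) (𝓝 0) (𝓝 0) := by
  have hd : Differentiable ℂ (paramC lam) := by
    have := differentiable_fixedPointX lam
    unfold paramC
    fun_prop
  have h := ((hd.continuous.sub continuous_const).norm).tendsto (0 : ℂ)
    (f := fun a => ‖paramC lam a - paramC lam 0‖)
  simpa using h

variable {lam : ℂ} {q : ℕ} {V₀ : Set ℂ} {ρ : ℝ} {φ₀ : ℂ → ℂ} {ρ' r δ : ℝ} {s : ℂ → ℂ → ℂ}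
  {φ : ℂ → ℂ × ℂ → ℂ × ℂ} {C : ℂ → ℂ}

/-- An injective holomorphic function is open, and its inverse is holomorphic. -/
theorem isOpen_image_and_differentiableOn_inverse {f g : ℂ → ℂ} {V : Set ℂ} (hV : IsOpen V)
    (hf : DifferentiableOn ℂ f V) (hg : ∀ z ∈ V, g (f z) = z) :
    IsOpen (f '' V) ∧ DifferentiableOn ℂ g (f '' V) := by
  constructor
  · rw [isOpen_iff_mem_nhds]
    rintro _ ⟨z, hz, rfl⟩
    exact (deriv_ne_zero_and_hasDerivAt_inverse hV hf hg hz).2.2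
  · rintro _ ⟨z, hz, rfl⟩
    exact (deriv_ne_zero_and_hasDerivAt_inverse hV hf hg hz).2.1.differentiableWithinAt

/-- The conclusions about a single coordinate change `φ_a`. -/
theorem IsNormalFamily.exists_conclusion (N : IsNormalFamily lam q φ₀ ρ' r δ s φ C)
    (hlam : ‖lam‖ = 1) (h : IsNormalizingCoordinate lam q V₀ ρ φ₀) (hρ' : 0 < ρ')
    (hsub : ball (q₀ lam) (2 * ρ') ⊆ V₀) (hr : 3 < r) :
    ∃ δ' > 0, δ' ≤ δ ∧ ∃ ε > 0, ∃ K M : ℝ,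
      (∀ a : ℂ, ‖a‖ < δ' → ∀ z ∈ tube lam ρ' r, ‖φ a z - (φ₀ z.1, z.2)‖ ≤ M * ‖a‖) ∧
      ∀ a : ℂ, ‖a‖ < δ' → ∃ (coeff : ℕ → ℂ → ℂ) (g h : ℂ × ℂ → ℂ),
        localStableManifold lam (paramC lam a) a r = {z ∈ tube lam ρ' r | (φ a z).1 = 0} ∧
        IsCoordinateChangeOn (φ a) (tube lam ρ' r) ∧
        MapsTo (φ a) (tube lam ρ' r) (ball 0 ρ ×ˢ ball 0 (r + K * ‖a‖)) ∧
        HasNormalForm lam (eigenMu lam a) (C a) q ε coeff g h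
          (henon (paramC lam a) a) (tube lam ρ' r) (φ a) ∧
        ∀ w ∈ φ a '' (tube lam ρ' r ∩ henon (paramC lam a) a ⁻¹' tube lam ρ' r),
          ‖w.1 * h w‖ ≤ K * ‖a‖ := by
  have hlam0 : lam ≠ 0 := by rintro rfl; simp at hlam
  set inv := Function.invFunOn φ₀ V₀
  have hinv : ∀ z ∈ V₀, inv (φ₀ z) = z := fun z hz => h.bijOn.injOn.leftInvOn_invFunOn hz
  have hopen : ∀ t ≤ 2 * ρ', IsOpen (φ₀ '' ball (q₀ lam) t) ∧
      DifferentiableOn ℂ inv (φ₀ '' ball (q₀ lam) t) := fun t ht =>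
    isOpen_image_and_differentiableOn_inverse isOpen_ball
      (h.holomorphic.mono ((ball_subset_ball ht).trans hsub))
      fun z hz => hinv z (hsub (ball_subset_ball ht hz))
  set K₁ := φ₀ '' closedBall (q₀ lam) ρ' with hK₁
  have hcb : closedBall (q₀ lam) ρ' ⊆ V₀ :=
    (closedBall_subset_ball (by linarith)).trans hsub
  have hK₁c : IsCompact K₁ :=
    (isCompact_closedBall _ _).image_of_continuousOn (h.holomorphic.continuousOn.mono hcb)
  have hK₁ρ : K₁ ⊆ ball 0 ρ := by
    rintro _ ⟨z, hz, rfl⟩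
    exact h.bijOn.mapsTo (hcb hz)
  set K₂ := K₁ ×ˢ closedBall (0 : ℂ) r with hK₂
  set U' := (φ₀ '' ball (q₀ lam) (3 / 2 * ρ')) ×ˢ ball (0 : ℂ) (r + 1) with hU'
  obtain ⟨hWo, hWd⟩ := hopen (3 / 2 * ρ') (by linarith)
  have hK₂U : K₂ ⊆ U' := prod_mono (image_mono (closedBall_subset_ball (by linarith)))
    (closedBall_subset_ball (by linarith))
  have hinvU : ∀ e ∈ U', (inv e.1, e.2) ∈ ball (q₀ lam) (3 / 2 * ρ') ×ˢ ball (0 : ℂ) (r + 1) ∧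
      φ₀ (inv e.1) = e.1 := by
    rintro ⟨w, y⟩ ⟨⟨x, hx, rfl⟩, hy⟩
    have := hinv x (hsub (ball_subset_ball (by linarith) hx))
    dsimp only
    rw [this]
    exact ⟨⟨hx, hy⟩, rfl⟩
  -- The coordinate φ_a read through (φ₀(x), y). It is the identity at a = 0, hence for small `a` an
  -- O(a)-perturbation of the identity with O(a) Lipschitz constant on the compact image of the
  -- closed tube; the larger bidisk of the family supplies the open neighbourhood needed for this.
  set f : ℂ → ℂ × ℂ → ℂ × ℂ := fun a e => φ a (inv e.1, e.2) with hf
  have hfd : DifferentiableOn ℂ (fun p : ℂ × ℂ × ℂ => f p.1 p.2) (ball 0 δ ×ˢ U') := by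
    have h1 : DifferentiableOn ℂ (fun p : ℂ × ℂ × ℂ => inv p.2.1) (ball 0 δ ×ˢ U') :=
      hWd.comp (by fun_prop) fun p hp => hp.2.1
    exact N.diff.comp (f := fun p : ℂ × ℂ × ℂ => (p.1, (inv p.2.1, p.2.2)))
      (differentiableOn_fst.prodMk (h1.prodMk (differentiableOn_snd.snd)))
      fun p hp => ⟨hp.1, (hinvU p.2 hp.2).1⟩
  obtain ⟨δ₁, hδ₁, hδ₁δ, M, hM, hMb⟩ := exists_norm_le_mul_of_zero (G := fun a e => f a e - e)
    N.δ_pos (hWo.prod isOpen_ball) (hfd.sub differentiableOn_snd)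
    (fun e he => by
      obtain ⟨h1, h2⟩ := hinvU e he
      simp only [hf]
      rw [N.zero _ h1]
      dsimp only
      rw [h2, sub_self]) (hK₁c.prod (isCompact_closedBall _ _)) hK₂U
  obtain ⟨ρ₁, hρ₁, hK₁ρ₁⟩ := exists_lt_subset_ball hK₁c.isClosed hK₁ρ
  -- With |x - q₀| < τ the polynomial moves x - q₀ to size at most τ + τ² ≤ 2τ ≤ ρ'/2, which leaves
  -- ρ'/2 for the perturbation.
  obtain ⟨τ, hτ⟩ : ∃ τ, τ = min 1 (ρ' / 4) := ⟨_, rfl⟩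
  have hτ0 : 0 < τ := by rw [hτ]; positivity
  have hτ1 : τ ≤ 1 := hτ ▸ min_le_left _ _
  have hτρ : τ ≤ ρ' / 4 := hτ ▸ min_le_right _ _
  obtain ⟨η, hη, hητ⟩ : ∃ η > 0, closedBall (0 : ℂ) η ⊆ φ₀ '' ball (q₀ lam) τ := by
    have h1 : (0 : ℂ) ∈ φ₀ '' ball (q₀ lam) τ := ⟨q₀ lam, mem_ball_self hτ0, h.map_fixed⟩
    exact nhds_basis_closedBall.mem_iff.1 ((hopen τ (by linarith)).1.mem_nhds h1)
  have hnorm : Tendsto (fun a : ℂ => ‖a‖) (𝓝 0) (𝓝 0) := tendsto_norm_zero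
  have hev : ∀ᶠ a : ℂ in 𝓝 0, M * ‖a‖ < 1 / 2 ∧ M * ‖a‖ < η / 2 ∧ M * ‖a‖ < ρ - ρ₁ ∧
      ‖paramC lam a - paramC lam 0‖ + ‖a‖ * r < ρ' / 2 ∧ ‖a‖ * (‖q₀ lam‖ + 1) < r ∧ ‖a‖ < 1 ∧
      ‖a‖ < δ₁ := by
    have hMt : Tendsto (fun a : ℂ => M * ‖a‖) (𝓝 0) (𝓝 0) := by
      simpa using hnorm.const_mul M
    have ht4 : Tendsto (fun a : ℂ => ‖paramC lam a - paramC lam 0‖ + ‖a‖ * r) (𝓝 0) (𝓝 0) := by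
      simpa using (tendsto_paramC_sub lam).add (hnorm.mul_const r)
    have ht5 : Tendsto (fun a : ℂ => ‖a‖ * (‖q₀ lam‖ + 1)) (𝓝 0) (𝓝 0) := by
      simpa using hnorm.mul_const (‖q₀ lam‖ + 1)
    filter_upwards [hMt.eventually_lt_const (by norm_num : (0 : ℝ) < 1 / 2),
      hMt.eventually_lt_const (half_pos hη), hMt.eventually_lt_const (sub_pos.2 hρ₁),
      ht4.eventually_lt_const (half_pos hρ'), ht5.eventually_lt_const (by linarith : 0 < r),
      hnorm.eventually_lt_const one_pos, hnorm.eventually_lt_const hδ₁]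
      with a h1 h2 h3 h4 h5 h6 h7 using ⟨h1, h2, h3, h4, h5, h6, h7⟩
  obtain ⟨δ₂, hδ₂, hδ₂e⟩ := Metric.eventually_nhds_iff.1 hev
  have htube : ∀ z ∈ tube lam ρ' r, (φ₀ z.1, z.2) ∈ K₂ ∧ inv (φ₀ z.1) = z.1 := fun z hz =>
    ⟨⟨⟨z.1, ball_subset_closedBall hz.1, rfl⟩, ball_subset_closedBall hz.2⟩,
      hinv _ (hcb (ball_subset_closedBall hz.1))⟩
  have hφf : ∀ a, ∀ z ∈ tube lam ρ' r, φ a z = f a (φ₀ z.1, z.2) := fun a z hz => by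
    simp only [hf]
    rw [(htube z hz).2]
  have hclose : ∀ a : ℂ, ‖a‖ < δ₁ → ∀ z ∈ tube lam ρ' r, ‖φ a z - (φ₀ z.1, z.2)‖ ≤ M * ‖a‖ :=
    fun a ha z hz => by
      rw [hφf a z hz]
      exact (hMb a ha).1 _ (htube z hz).1
  -- The radius η/2 is independent of `a`. The three parts of K bound, in units of ‖a‖, the distance
  -- of the second coordinate from y, the component ax of the Hénon map, and the term μ times the
  -- second coordinate; the last uses |μ| = |a|² ≤ |a|.
  refine ⟨min δ₁ δ₂, lt_min hδ₁ hδ₂, (min_le_left _ _).trans hδ₁δ, η / 2, half_pos hη,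
    M + (‖q₀ lam‖ + ρ') + (r + M), M,
    fun a ha => hclose a (ha.trans_le (min_le_left _ _)), fun a ha => ?_⟩
  obtain ⟨a1, a2, a3, a4, a5, a6, a7⟩ := hδ₂e (y := a)
    (by rw [dist_zero_right]; exact ha.trans_le (min_le_right _ _))
  have haδ : ‖a‖ < δ := a7.trans_le hδ₁δ
  have hca : (paramC lam a, a) ∈ paramCurve lam := rfl
  obtain ⟨hMa, hMl⟩ := hMb a a7
  have hlip : ∀ e ∈ K₂, ∀ e' ∈ K₂, ‖(f a e' - e') - (f a e - e)‖ ≤ 1 / 2 * ‖e' - e‖ :=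
    fun e he e' he' => (hMl e he e' he').trans (by gcongr)
  have htubeU : tube lam ρ' r ⊆ ball (q₀ lam) (3 / 2 * ρ') ×ˢ ball (0 : ℂ) (r + 1) :=
    prod_mono (ball_subset_ball (by linarith)) (ball_subset_ball (by linarith))
  have hφd : DifferentiableOn ℂ (φ a) (tube lam ρ' r) :=
    N.diff.comp (f := fun z : ℂ × ℂ => (a, z)) (by fun_prop)
      fun z hz => ⟨mem_ball_zero_iff.2 haδ, htubeU hz⟩
  have hchange : IsCoordinateChangeOn (φ a) (tube lam ρ' r) := by
    set S := (φ₀ '' ball (q₀ lam) ρ') ×ˢ ball (0 : ℂ) r with hS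
    obtain ⟨hSo, hSd⟩ := hopen ρ' (by linarith)
    have hSK : S ⊆ K₂ := prod_mono (image_mono ball_subset_closedBall) ball_subset_closedBall
    have hfS : DifferentiableOn ℂ (f a) S :=
      hfd.comp (f := fun e : ℂ × ℂ => (a, e)) (by fun_prop)
        fun e he => ⟨mem_ball_zero_iff.2 haδ, hK₂U (hSK he)⟩
    obtain ⟨ho, finv, hfi, hfl⟩ := exists_inverse_of_lipschitz (hSo.prod isOpen_ball) hfS
      fun e he e' he' => hlip e (hSK he) e' (hSK he')
    have hmem : ∀ z ∈ tube lam ρ' r, (φ₀ z.1, z.2) ∈ S := fun z hz => ⟨⟨z.1, hz.1, rfl⟩, hz.2⟩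
    have himg : φ a '' tube lam ρ' r = f a '' S := by
      ext w
      constructor
      · rintro ⟨z, hz, rfl⟩
        exact ⟨_, hmem z hz, (hφf a z hz).symm⟩
      · rintro ⟨⟨_, y⟩, ⟨⟨x, hx, rfl⟩, hy⟩, rfl⟩
        exact ⟨(x, y), ⟨hx, hy⟩, hφf a (x, y) ⟨hx, hy⟩⟩
    refine ⟨hφd, himg ▸ ho, fun w => (inv (finv w).1, (finv w).2), ?_, fun z hz => ?_⟩
    · rw [himg]
      have h1 : DifferentiableOn ℂ (fun w => inv (finv w).1) (f a '' S) := by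
        refine hSd.comp hfi.fst ?_
        rintro _ ⟨e, he, rfl⟩
        beta_reduce
        rw [hfl he]
        exact he.1
      exact h1.prodMk hfi.snd
    · beta_reduce
      rw [hφf a z hz, hfl (hmem z hz)]
      exact Prod.ext (htube z hz).2 rfl
  have hinj : InjOn (φ a) (tube lam ρ' r) := by
    obtain ⟨-, -, finv, -, hfl⟩ := hchange
    exact hfl.injOn
  have hsnd : ∀ z ∈ tube lam ρ' r, ∀ z' ∈ tube lam ρ' r, (φ a z).2 = (φ a z').2 → z.2 = z'.2 := by
    intro z hz z' hz' hzz
    have hz'' : (z.1, z'.2) ∈ tube lam ρ' r := ⟨hz.1, hz'.2⟩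
    have h1 := hlip _ (htube _ hz'').1 _ (htube z hz).1
    rw [← hφf a _ hz'', ← hφf a z hz] at h1
    have h2 : (φ a (z.1, z'.2)).2 = (φ a z).2 := by rw [hzz]; exact N.snd_eq a _ _ rfl
    have h3 := (norm_snd_le _).trans h1
    simp only [Prod.snd_sub, h2, Prod.mk_sub_mk, sub_self] at h3
    rw [Prod.norm_def, norm_zero, max_eq_right (norm_nonneg _)] at h3
    have e : (φ a z).2 - z.2 - ((φ a z).2 - z'.2) = -(z.2 - z'.2) := by ring
    rw [e, norm_neg] at h3
    exact sub_eq_zero.1 (norm_le_zero_iff.1 (by linarith))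
  -- For fixed y the first coordinate is a perturbation of size at most η/2 of the identity on the
  -- disk of radius η, so it covers the disk of radius η/2. The second coordinate depends on y only,
  -- so the same y serves for the whole line.
  have hpoly : ball (0 : ℂ) (η / 2) ×ˢ (Prod.snd '' (φ a '' tube lam ρ' r)) ⊆
      φ a '' (tube lam ρ' r ∩ henon (paramC lam a) a ⁻¹' tube lam ρ' r) := by
    rintro ⟨w₁, _⟩ ⟨hw₁, ⟨_, ⟨z₀, hz₀, rfl⟩, rfl⟩⟩
    have hw₁' : ‖w₁‖ < η / 2 := mem_ball_zero_iff.1 hw₁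
    have hηK : ∀ w ∈ closedBall (0 : ℂ) η, (w, z₀.2) ∈ K₂ := fun w hw => by
      obtain ⟨x, hx, rfl⟩ := hητ hw
      exact ⟨⟨x, ball_subset_closedBall (ball_subset_ball (by linarith) hx), rfl⟩,
        ball_subset_closedBall hz₀.2⟩
    obtain ⟨w, hw, hww⟩ := exists_eq_of_lipschitz (f := fun w => (f a (w, z₀.2)).1)
      (m := η / 2) hη.le
      (fun w hw => ((norm_fst_le _).trans (hMa _ (hηK w hw))).trans a2.le)
      (fun e he e' he' => by
        have h1 := (norm_fst_le _).trans (hlip _ (hηK e he) _ (hηK e' he'))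
        simp only [Prod.fst_sub, Prod.mk_sub_mk, sub_self] at h1
        rwa [Prod.norm_def, norm_zero, max_eq_left (norm_nonneg _)] at h1)
      (w₁ := w₁) (by linarith)
    obtain ⟨x, hx, rfl⟩ := hητ hw
    have hz : (x, z₀.2) ∈ tube lam ρ' r := ⟨ball_subset_ball (by linarith) hx, hz₀.2⟩
    have hxτ : ‖x - q₀ lam‖ < τ := mem_ball_iff_norm.1 hx
    have hy : ‖z₀.2‖ < r := mem_ball_zero_iff.1 hz₀.2
    refine ⟨(x, z₀.2), ⟨hz, ?_, ?_⟩, Prod.ext ?_ (N.snd_eq a _ _ rfl)⟩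
    · rw [mem_ball_iff_norm, henon_fst_sub]
      dsimp only
      have h1 : ‖quad lam (x - q₀ lam)‖ ≤ ρ' / 2 := by
        rw [quad]
        refine (norm_add_le _ _).trans ?_
        rw [norm_mul, hlam, one_mul, norm_pow]
        nlinarith [norm_nonneg (x - q₀ lam)]
      have h2 : ‖paramC lam a - paramC lam 0 + a * z₀.2‖ < ρ' / 2 := by
        refine lt_of_le_of_lt ((norm_add_le _ _).trans ?_) a4
        rw [norm_mul]
        gcongr
      exact (norm_add_le _ _).trans_lt (by linarith)
    · rw [mem_ball_zero_iff, henon]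
      dsimp only
      rw [norm_mul]
      have h1 := norm_le_norm_sub_add x (q₀ lam)
      refine lt_of_le_of_lt ?_ a5
      gcongr
      linarith
    · rw [hφf a _ hz]
      exact hww
  obtain ⟨coeff, g, hh, hnf⟩ := N.exists_hasNormalForm hlam0 (half_pos hη) hca haδ hchange hsnd hpoly
  refine ⟨coeff, g, hh, N.localStableManifold_eq hca haδ hinj, hchange, fun z hz => ?_, hnf, ?_⟩
  · have h1 := hclose a a7 z hz
    have h2 := (norm_fst_le _).trans h1
    have h3 := (norm_snd_le _).trans h1
    rw [Prod.fst_sub] at h2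
    rw [Prod.snd_sub] at h3
    have h4 : ‖φ₀ z.1‖ < ρ₁ :=
      mem_ball_zero_iff.1 (hK₁ρ₁ ⟨z.1, ball_subset_closedBall hz.1, rfl⟩)
    have h5 : ‖z.2‖ < r := mem_ball_zero_iff.1 hz.2
    refine ⟨mem_ball_zero_iff.2 ?_, mem_ball_zero_iff.2 ?_⟩
    · have := norm_le_norm_sub_add (φ a z).1 (φ₀ z.1)
      linarith
    · have := norm_le_norm_sub_add (φ a z).2 z.2
      nlinarith [norm_nonneg a, norm_nonneg (q₀ lam)]
  · rintro _ ⟨z, hz, rfl⟩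
    have h1 := hnf.snd_eq z hz
    have h2 := hclose a a7 _ hz.2
    have h3 := hclose a a7 z hz.1
    have h4 := (norm_snd_le _).trans h2
    have h5 := (norm_snd_le _).trans h3
    rw [Prod.snd_sub] at h4 h5
    have e : (φ a z).1 * hh (φ a z) =
        ((φ a (henon (paramC lam a) a z)).2 - (henon (paramC lam a) a z).2)
          + (henon (paramC lam a) a z).2 - eigenMu lam a * (φ a z).2 := by
      rw [h1]; ring
    have e2 : ‖(henon (paramC lam a) a z).2‖ ≤ (‖q₀ lam‖ + ρ') * ‖a‖ := by
      rw [henon]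
      dsimp only
      rw [norm_mul, mul_comm]
      gcongr
      have h6 : ‖z.1 - q₀ lam‖ < ρ' := mem_ball_iff_norm.1 hz.1.1
      have := norm_le_norm_sub_add z.1 (q₀ lam)
      linarith
    have e3 : ‖eigenMu lam a * (φ a z).2‖ ≤ (r + M) * ‖a‖ := by
      rw [norm_mul, norm_eigenMu hlam]
      have h6 : ‖z.2‖ < r := mem_ball_zero_iff.1 hz.1.2
      have h7 : ‖(φ a z).2‖ ≤ r + M := by
        have := norm_le_norm_sub_add (φ a z).2 z.2
        nlinarith [norm_nonneg a]
      calc ‖a‖ ^ 2 * ‖(φ a z).2‖ ≤ ‖a‖ ^ 2 * (r + M) := by gcongr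
        _ = ‖a‖ * ((r + M) * ‖a‖) := by ring
        _ ≤ 1 * ((r + M) * ‖a‖) := by
          have : 0 ≤ r + M := by linarith
          gcongr
        _ = _ := one_mul _
    rw [e]
    refine (norm_sub_le _ _).trans ?_
    have h8 := norm_add_le ((φ a (henon (paramC lam a) a z)).2 - (henon (paramC lam a) a z).2)
      (henon (paramC lam a) a z).2
    linarith

end Main

end SemiParabolicHenon
theorem mainTheorem6 (p : ℤ) (q : ℕ) (hq : 0 < q) (hpq : IsCoprime p (q : ℤ))
    (lam : ℂ) (hlam : lam = Complex.exp (2 * Real.pi * Complex.I * (p / q))) :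
    (∃ (V₀ : Set ℂ) (ρ : ℝ) (φ₀ : ℂ → ℂ), IsNormalizingCoordinate lam q V₀ ρ φ₀) ∧
    ∀ (V₀ : Set ℂ) (ρ : ℝ) (φ₀ : ℂ → ℂ), IsNormalizingCoordinate lam q V₀ ρ φ₀ →
    ∀ ρ' : ℝ, 0 < ρ' → ball (q₀ lam) (2 * ρ') ⊆ V₀ →
    ∀ r : ℝ, 3 < r →
    ∃ δ > 0, ∃ ε > 0, ∃ (K : ℝ) (φ : ℂ → ℂ × ℂ → ℂ × ℂ) (C : ℂ → ℂ)
      (coeff : ℂ → ℕ → ℂ → ℂ) (g h : ℂ → ℂ × ℂ → ℂ),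
      (∀ c a : ℂ, (c, a) ∈ paramCurve lam → ‖a‖ < δ →
        localStableManifold lam c a r = {z ∈ tube lam ρ' r | (φ a z).1 = 0} ∧
        IsCoordinateChangeOn (φ a) (tube lam ρ' r) ∧
        MapsTo (φ a) (tube lam ρ' r) (ball 0 ρ ×ˢ ball 0 (r + K * ‖a‖)) ∧
        HasNormalForm lam (eigenMu lam a) (C a) q ε (coeff a) (g a) (h a)
          (henon c a) (tube lam ρ' r) (φ a) ∧
        ∀ w ∈ φ a '' (tube lam ρ' r ∩ henon c a ⁻¹' tube lam ρ' r),
          ‖w.1 * h a w‖ ≤ K * ‖a‖) ∧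
      DifferentiableOn ℂ (fun w : ℂ × ℂ × ℂ => φ w.1 w.2) (ball 0 δ ×ˢ tube lam ρ' r) ∧
      TendstoUniformlyOn φ (φ 0) (𝓝 0) (tube lam ρ' r) ∧
      ∀ z ∈ tube lam ρ' r, φ 0 z = (φ₀ z.1, z.2) := by
  have hprim := isPrimitiveRoot_lam hq hpq hlam
  have hnorm : ‖lam‖ = 1 := hprim.norm'_eq_one hq.ne'
  have hres : ∀ n, lam ^ n = 1 ↔ q ∣ n := hprim.pow_eq_one_iff_dvd
  refine ⟨exists_isNormalizingCoordinate hnorm hq hres, ?_⟩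
  intro V₀ ρ φ₀ hφ₀ ρ' hρ' hsub r hr
  obtain ⟨δ, s, φ, C, N⟩ := exists_isNormalFamily hnorm hq hres hφ₀ hρ' hsub hr
  obtain ⟨δ', hδ', hδ'δ, ε, hε, K, M, hclose, hconcl⟩ :=
    N.exists_conclusion hnorm hφ₀ hρ' hsub hr
  -- No regularity in `a` is asserted for the remainders, so they may be chosen separately for each
  -- parameter.
  choose! coeff g h hmain using hconcl
  have hsubU : tube lam ρ' r ⊆ ball (q₀ lam) (3 / 2 * ρ') ×ˢ ball (0 : ℂ) (r + 1) :=
    prod_mono (ball_subset_ball (by linarith)) (ball_subset_ball (by linarith))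
  have hzero : ∀ z ∈ tube lam ρ' r, φ 0 z = (φ₀ z.1, z.2) := fun z hz => N.zero z (hsubU hz)
  refine ⟨δ', hδ', ε, hε, K, φ, C, coeff, g, h, fun c a hca ha => ?_,
    N.diff.mono (prod_mono (ball_subset_ball hδ'δ) hsubU), ?_, hzero⟩
  · obtain rfl : c = paramC lam a := hca
    exact hmain a ha
  · rw [Metric.tendstoUniformlyOn_iff]
    intro κ hκ
    have ht : Tendsto (fun a : ℂ => M * ‖a‖) (𝓝 0) (𝓝 0) := by
      simpa using (tendsto_norm_zero (E := ℂ)).const_mul M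
    filter_upwards [ht.eventually_lt_const hκ, ball_mem_nhds (0 : ℂ) hδ'] with a ha1 ha2 z hz
    rw [dist_comm, dist_eq_norm, hzero z hz]
    exact (hclose a (mem_ball_zero_iff.1 ha2) z hz).trans_lt ha1
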